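/- Let $d\ge 1$, let $\mathcal P_2=\mathcal P_2(\mathbb R^d)$ be the set of Borel probability measures on $\mathbb R^d$ with finite second moment, $W_2$ the quadratic Wasserstein distance and $\Gamma_0(m,\nu)$ the set of optimal plans between $m,\nu\in\mathcal P_2$. **Calculus on $\mathcal P_2$.** For $U:\mathcal P_2\to\mathbb R$, a field $\zeta\in L^2(m;\mathbb R^d)$ is a subgradient of $U$ at $m$ if $U[\nu]-U[m]\ge \sup_{\gamma\in\Gamma_0(m,\nu)}\int \zeta(x)\cdot(y-x)\,\gamma(dx,dy)+o(W_2(m,\nu))$ (it is known that $\inf$ in place of $\sup$ gives the same notion); it is a supergradient of $U$ if $-\zeta$ is a subgradient of $-U$. $U$ is differentiable at $m$ if it has both a subgradient and a supergradient at $m$, and then $\nabla_wU[m]$ is the subgradient of minimal norm. Write $\zeta\cdot(U[m])=\int\langle\nabla_wU[m],\zeta\rangle\,dm$. $U$ is twice differentiable at $m$ if, for $\nu$ in a $W_2$-ball around $m$, $U$ is differentiable at $\nu$, $\nabla_wU[\nu]$ has a continuous version with $|\nabla_wU[\nu](x)|\le C(1+|x|)$, $C$ independent of $\nu$ and $x$,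 and there are bounded Borel matrix fields $\tilde A(x)$, $A(x,a)$, a concave modulus $\rho$ and a function $\epsilon\ge0$ with $\epsilon(t)\to0$ as $t\to0^+$ such that for all such $\nu$, all $\gamma\in\Gamma_0(m,\nu)$ and all $x,y\in\mathbb R^d$ $$\Big|\nabla_wU[\nu](y)-\nabla_wU[m](x)-\tilde A(x)(y-x)-\int A(x,a)(b-a)\,\gamma(da,db)\Big|\le|x-y|\rho(|x-y|)+W_2(m,\nu)\,\epsilon(W_2(m,\nu)).$$ $\mathrm{Hess}\,U[m]$ is the continuous bilinear extension to $T_m\times T_m$, with $T_m$ the closure of $\nabla C_c^\infty(\mathbb R^d)$ in $L^2(m)$, of $(\zeta_1,\zeta_2)\mapsto\zeta_1\cdot(\zeta_2\cdot(U[m]))-(\nabla\zeta_2\,\zeta_1)\cdot(U[m])$ on $\nabla C_c^\infty\times\nabla C_c^\infty$; here $U$ is differentiable near $m$ and $\nu\mapsto\zeta\cdot(U[\nu])$ is differentiable at $m$ for each $\zeta\in C_c^\infty(\mathbb R^d;\mathbb R^d)$. For $U$ twice differentiable at $m$, $\triangle_wU[m]=\sum_{i=1}^d\mathrm{Hess}\,U[m](\zeta_i,\zeta_i)$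 with $\zeta_i$ the Wasserstein gradient of $m\mapsto\int x_i\,m(dx)$. For complex-valued functions all these notions are applied to the real and imaginary parts. **Fourier series.** For $k\ge1$ and $\xi\in(\mathbb R^d)^k$ let $$F^k_\xi[m]=\frac1k\int \frac1{k!}\sum_{\sigma\in P_k}e^{-2\pi i\sum_j\langle\xi_{\sigma(j)},x_j\rangle}\,m(dx_1)\cdots m(dx_k),\qquad \lambda_k^2(\xi)=4\pi^2\Big|\sum_{j=1}^k\xi_j\Big|^2 .$$ $\mathcal A^0$ is the set of sequences $(a_k)_{k\ge1}$ of symmetric Borel functions $a_k:(\mathbb R^d)^k\to\mathbb C$ with $\sum_k\frac1{k!}\int|a_k|^2d\xi<\infty$. $\mathcal H^0$ is the set of $F:\mathcal P_2\to\mathbb C$ such that $F[m]=\sum_k\frac1{k!}\int a_k(\xi)F^k_\xi[m]\,d\xi$ for all $m$, for some $(a_k)\in\mathcal A^0$ with $\int|a_k|d\xi\le Ck!/k^\delta$ for all $k$, for some $C,\delta>0$. Such $(a_k)$ is unique up to null sets. If $F,G\in\mathcal H^0$ have coefficients $(a_k)$, $(b_k)$, then $\langle F;G\rangle_{H^0}=\sum_k\frac1{k!}\int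 a_k\,\overline{b_k}\,d\xi$; for $V,W\in(\mathcal H^0)^d$, $\langle V;W\rangle_{H^0}=\sum_n\langle V^n;W^n\rangle_{H^0}$ and $\|V\|_{H^0}^2=\langle V;V\rangle_{H^0}$. **Proposition.** Let $(a_k),(b_k)\in\mathcal A^0$, and let $C,\delta>0$ be such that, for every $k\ge1$, $c_k=a_k$ and $c_k=b_k$ both satisfy $$\int|c_k|\le\frac{Ck!}{k^\delta},\qquad \int|c_k||\xi_1|,\ \int|c_k||\xi_1|^2,\ \int|c_k||\xi_1|^3\le\frac{Ck!}{k^{1+\delta}},$$ and, when $k\ge2$, $$\int|c_k||\xi_1||\xi_2|\le\frac{Ck!}{k^{2+\delta}},\qquad\int|c_k||\xi_1|^2|\xi_2|\le\frac{Ck!}{k^{3+\delta}}.$$ Assume moreover $\int(|a_k|+|b_k|)\lambda_k^2\,d\xi\le Ck!/k^\delta$ for all $k$, $\sum_k\frac1{k!}\int|a_k|^2\lambda_k^4\,d\xi<\infty$ and $\sum_k\frac1{k!}\int|b_k|^2\lambda_k^2\,d\xi<\infty$. Put $F[m]=\sum_k\frac1{k!}\int a_kF^k_\xi[m]\,d\xi$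 and $G[m]=\sum_k\frac1{k!}\int b_kF^k_\xi[m]\,d\xi$. Then $F,G\in\mathcal H^0$, $F$ and $G$ are differentiable at every $m\in\mathcal P_2$, $F$ is twice differentiable and has a Hessian at every $m$, and 1. all components of $m\mapsto\int\nabla_wF[m](x)\,m(dx)$ and $m\mapsto\int\nabla_wG[m](x)\,m(dx)$ belong to $\mathcal H^0$; 2. $\triangle_wF\in\mathcal H^0$; 3. $-\langle\triangle_wF;G\rangle_{H^0}=\big\langle\int\nabla_wF[m](x)\,m(dx);\int\nabla_wG[m](x)\,m(dx)\big\rangle_{H^0}$; 4. in particular $-\langle\triangle_wF;F\rangle_{H^0}=\big\|\int\nabla_wF[m](x)\,m(dx)\big\|_{H^0}^2$. -/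

import Mathlib

open MeasureTheory Filter Topology
open scoped ENNReal Nat ContDiff

noncomputable section

namespace WassersteinFourier

/-- The base space `ℝ^d` with its Euclidean norm. -/
abbrev E (d : ℕ) := EuclideanSpace ℝ (Fin d)

/-! ### The Wasserstein space -/

/-- Borel probability measures on `ℝ^d` with finite second moment. -/
def P2 (d : ℕ) := {m : ProbabilityMeasure (E d) // MemLp id 2 (m : Measure (E d))}

variable {d : ℕ}

/-- The underlying measure. -/
def P2.meas (m : P2 d) : Measure (E d) := (m.1 : Measure (E d))

instance (m : P2 d) : IsProbabilityMeasure m.meas := by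
  unfold P2.meas; infer_instance

/-- `Γ(m, ν)`: the plans with first marginal `m` and second marginal `ν`. -/
def plans (m ν : P2 d) : Set (Measure (E d × E d)) :=
  {γ | γ.map Prod.fst = m.meas ∧ γ.map Prod.snd = ν.meas}

/-- The quadratic Wasserstein distance. -/
def W2 (m ν : P2 d) : ℝ :=
  √(sInf ((fun γ : Measure (E d × E d) => ∫ p, ‖p.1 - p.2‖ ^ 2 ∂γ) '' plans m ν))

/-- `Γ₀(m, ν)`: the optimal plans. -/
def optPlans (m ν : P2 d) : Set (Measure (E d × E d)) :=
  {γ | γ ∈ plans m ν ∧ W2 m ν ^ 2 = ∫ p, ‖p.1 - p.2‖ ^ 2 ∂γ}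

/-! ### Wasserstein gradient -/

/-- `L²(m)`: square integrable vector fields. -/
abbrev L2 (m : P2 d) := Lp (E d) 2 m.meas

/-- The subdifferential: `ζ` is a subgradient of `U` at `m` if
`U[ν] - U[m] ≥ sup_{γ ∈ Γ₀(m, ν)} ∫ ζ(x)·(y - x) γ(dx, dy) + o(W₂(m, ν))`
(it is known that `inf` in place of `sup` gives the same set). -/
def subdiff (U : P2 d → ℝ) (m : P2 d) : Set (L2 m) :=
  {ζ | ∀ ε > 0, ∃ δ > 0, ∀ ν : P2 d, W2 m ν < δ → ∀ γ ∈ optPlans m ν,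
    ∫ p, inner ℝ (ζ p.1) (p.2 - p.1) ∂γ - ε * W2 m ν ≤ U ν - U m}

/-- The superdifferential. -/
def superdiff (U : P2 d → ℝ) (m : P2 d) : Set (L2 m) :=
  {ζ | -ζ ∈ subdiff (fun ν => -U ν) m}

/-- Differentiability at `m` in the Wasserstein sense. -/
def WDifferentiableAt (U : P2 d → ℝ) (m : P2 d) : Prop :=
  (subdiff U m).Nonempty ∧ (superdiff U m).Nonempty

open Classical in
/-- The Wasserstein gradient `∇_w U[m]`: the element of minimal norm of the subdifferential
(and `0` if there is none). -/
def wGrad (U : P2 d → ℝ) (m : P2 d) : L2 m :=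
  if h : ∃ ζ ∈ subdiff U m, ∀ η ∈ subdiff U m, ‖ζ‖ ≤ ‖η‖ then h.choose else 0

/-- The function `ν ↦ ζ·(U[ν]) = ⟨∇_w U[ν]; ζ⟩_ν` for a vector field `ζ`. -/
def wDir (U : P2 d → ℝ) (ζ : E d → E d) (ν : P2 d) : ℝ :=
  ∫ x, inner ℝ (wGrad U ν x) (ζ x) ∂ν.meas

/-! ### Hessian and Wasserstein Laplacian -/

/-- `C_c^∞` functions, scalar or vector valued. -/
def IsTest {V : Type*} [NormedAddCommGroup V] [NormedSpace ℝ V] (f : E d → V) : Prop :=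
  ContDiff ℝ ∞ f ∧ HasCompactSupport f

/-- The tangent space `T_m`: the closure of `∇ C_c^∞` in `L²(m)`. -/
def tangent (m : P2 d) : Submodule ℝ (L2 m) :=
  (Submodule.span ℝ
    {v : L2 m | ∃ f : E d → ℝ, IsTest f ∧ v =ᵐ[m.meas] gradient f}).topologicalClosure

/-- `ζ₁·(ζ₂·(U[m])) - (∇ζ₂ ζ₁)·(U[m])`. -/
def preHess (U : P2 d → ℝ) (m : P2 d) (ζ₁ ζ₂ : E d → E d) : ℝ :=
  wDir (wDir U ζ₂) ζ₁ m - wDir U (fun x => fderiv ℝ ζ₂ x (ζ₁ x)) m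

/-- `U` has a Hessian at `m`, namely the bounded bilinear form `H` on the tangent space: `U` is
differentiable near `m`, all `ν ↦ ζ·(U[ν])` with `ζ ∈ C_c^∞` are differentiable at `m`, and `H`
extends `preHess` from `∇ C_c^∞` by continuity. -/
def IsHessianAt (U : P2 d → ℝ) (m : P2 d) (H : tangent m →L[ℝ] tangent m →L[ℝ] ℝ) : Prop :=
  (∃ r > 0, ∀ ν, W2 m ν < r → WDifferentiableAt U ν) ∧
  (∀ ζ : E d → E d, IsTest ζ → WDifferentiableAt (wDir U ζ) m) ∧
  ∀ f₁ f₂ : E d → ℝ, IsTest f₁ → IsTest f₂ → ∀ v₁ v₂ : tangent m,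
    (v₁ : L2 m) =ᵐ[m.meas] gradient f₁ → (v₂ : L2 m) =ᵐ[m.meas] gradient f₂ →
      H v₁ v₂ = preHess U m (gradient f₁) (gradient f₂)

/-- A concave modulus on `[0, ∞)`. -/
def IsConcaveModulus (ρ : ℝ → ℝ) : Prop :=
  ContinuousOn ρ (Set.Ici 0) ∧ MonotoneOn ρ (Set.Ici 0) ∧
  (∀ s ≥ 0, ∀ t ≥ 0, ρ (s + t) ≤ ρ s + ρ t) ∧ ρ 0 = 0 ∧ ConcaveOn ℝ (Set.Ici 0) ρ

/-- `U` is twice differentiable at `m`: near `m` it is differentiable with a continuous version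
`A ν` of `∇_w U[ν]`, of linear growth locally uniformly in `ν`, and `∇_w U` has a first order
expansion at `m` with bounded Borel coefficients `A₁`, `A₂`. -/
def WTwiceDifferentiableAt (U : P2 d → ℝ) (m : P2 d) : Prop :=
  ∃ (r : ℝ) (A : P2 d → E d → E d) (C : ℝ) (A₁ : E d → E d →L[ℝ] E d)
    (A₂ : E d × E d → E d →L[ℝ] E d) (ρ ε : ℝ → ℝ),
    0 < r ∧
    (∀ ν, W2 m ν < r → WDifferentiableAt U ν ∧ Continuous (A ν) ∧
      wGrad U ν =ᵐ[ν.meas] A ν ∧ ∀ x, ‖A ν x‖ ≤ C * (1 + ‖x‖)) ∧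
    Measurable A₁ ∧ (∃ K : ℝ, ∀ x, ‖A₁ x‖ ≤ K) ∧
    Measurable A₂ ∧ (∃ K : ℝ, ∀ z, ‖A₂ z‖ ≤ K) ∧
    IsConcaveModulus ρ ∧ (∀ t ≥ 0, 0 ≤ ε t) ∧ Tendsto ε (𝓝[>] 0) (𝓝 0) ∧
    ∀ ν, W2 m ν < r → ∀ γ ∈ optPlans m ν, ∀ x y : E d,
      ‖A ν y - A m x - (A₁ x (y - x) + ∫ p, A₂ (x, p.1) (p.2 - p.1) ∂γ)‖
        ≤ ‖x - y‖ * ρ ‖x - y‖ + W2 m ν * ε (W2 m ν)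

/-- The `i`-th moment `m ↦ ∫ x_i m(dx)`. -/
def moment (i : Fin d) (m : P2 d) : ℝ := ∫ x, x i ∂m.meas

/-- `U` is twice differentiable at `m`, has a Hessian there, and `v` is the value
`∑_i Hess U[m](ζ_i, ζ_i)` where `ζ_i` is the Wasserstein gradient of the `i`-th moment. -/
def HasWLaplacianAt (U : P2 d → ℝ) (m : P2 d) (v : ℝ) : Prop :=
  WTwiceDifferentiableAt U m ∧
  ∃ H : tangent m →L[ℝ] tangent m →L[ℝ] ℝ, IsHessianAt U m H ∧
    ∃ ζ : Fin d → tangent m, (∀ i, (ζ i : L2 m) = wGrad (moment i) m) ∧ v = ∑ i, H (ζ i) (ζ i)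

open Classical in
/-- The Wasserstein Laplacian of a real function (`0` where it does not exist). -/
def wLaplacianReal (U : P2 d → ℝ) (m : P2 d) : ℝ :=
  if h : ∃ v, HasWLaplacianAt U m v then h.choose else 0

/-! ### Complex valued functions

All operators act on the real and imaginary parts. -/

/-- Differentiability of a complex function on the Wasserstein space. -/
def CWDifferentiable (F : P2 d → ℂ) : Prop :=
  ∀ m, WDifferentiableAt (fun ν => (F ν).re) m ∧ WDifferentiableAt (fun ν => (F ν).im) m

/-- The Wasserstein Laplacian of a complex function exists everywhere. -/
def HasWLaplacian (F : P2 d → ℂ) : Prop :=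
  ∀ m, (∃ v, HasWLaplacianAt (fun ν => (F ν).re) m v) ∧
    ∃ v, HasWLaplacianAt (fun ν => (F ν).im) m v

/-- The Wasserstein Laplacian of a complex function. -/
def wLaplacian (F : P2 d → ℂ) (m : P2 d) : ℂ :=
  (wLaplacianReal (fun ν => (F ν).re) m : ℂ) + Complex.I * wLaplacianReal (fun ν => (F ν).im) m

/-- The `n`-th component of `m ↦ ∫ ∇_w F[m](x) m(dx)`. -/
def meanGrad (F : P2 d → ℂ) (n : Fin d) (m : P2 d) : ℂ :=
  (((∫ x, wGrad (fun ν => (F ν).re) m x ∂m.meas) n : ℝ) : ℂ)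
    + Complex.I * (((∫ x, wGrad (fun ν => (F ν).im) m x ∂m.meas) n : ℝ) : ℂ)

/-! ### Fourier series on the Wasserstein space and the space `𝓗⁰` -/

/-- The symmetrized exponential. -/
def symExp (k : ℕ+) (ξ x : Fin k → E d) : ℂ :=
  (((k : ℕ)! : ℂ))⁻¹ * ∑ σ : Equiv.Perm (Fin k),
    Complex.exp (-2 * Real.pi * Complex.I * ((∑ j, inner ℝ (ξ (σ j)) (x j) : ℝ) : ℂ))

/-- `F^k_ξ[m] = (1/k) ∫ Φ^k_ξ(x) m(dx_1) ⋯ m(dx_k)`. -/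
def fourierPoly (k : ℕ+) (ξ : Fin k → E d) (m : P2 d) : ℂ :=
  ((k : ℕ) : ℂ)⁻¹ * ∫ x, symExp k ξ x ∂(Measure.pi fun _ : Fin k => m.meas)

/-- `λ_k²(ξ) = 4π² |∑_j ξ_j|²`. -/
def lamSq (k : ℕ+) (ξ : Fin k → E d) : ℝ := 4 * Real.pi ^ 2 * ‖∑ j, ξ j‖ ^ 2

/-- Sequences `(a_k)_{k ≥ 1}` of functions on `(ℝ^d)^k`. -/
abbrev Coeffs (d : ℕ) := (k : ℕ+) → (Fin k → E d) → ℂ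

/-- `𝒜⁰`: Borel symmetric coefficients with `∑_k (1/k!) ∫ |a_k|² dξ < ∞`. -/
def MemA0 (a : Coeffs d) : Prop :=
  (∀ k, Measurable (a k) ∧
    ∀ (σ : Equiv.Perm (Fin k)) (ξ : Fin k → E d), a k (fun j => ξ (σ j)) = a k ξ) ∧
  ∑' k : ℕ+, ((k : ℕ)! : ℝ≥0∞)⁻¹ * ∫⁻ ξ, ‖a k ξ‖ₑ ^ 2 < ⊤

/-- `∫ |a_k| dξ ≤ C k! / k^δ` for all `k`. -/
def UniformBound (a : Coeffs d) (C δ : ℝ) : Prop :=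
  ∀ k : ℕ+, ∫⁻ ξ, ‖a k ξ‖ₑ ≤ ENNReal.ofReal (C * (k : ℕ)! / (k : ℝ) ^ δ)

/-- The moment bounds on the coefficients. They are meant for symmetric `a_k`, so that any index
`i` (any pair `i ≠ j`) plays the role of `1` (of `1, 2`); for `k = 1` there is no pair. -/
def MomentBounds (a : Coeffs d) (C δ : ℝ) : Prop :=
  ∀ (k : ℕ+) (i : Fin k),
    ∫⁻ ξ, ‖a k ξ‖ₑ * ‖ξ i‖ₑ ≤ ENNReal.ofReal (C * (k : ℕ)! / (k : ℝ) ^ (1 + δ)) ∧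
    ∫⁻ ξ, ‖a k ξ‖ₑ * ‖ξ i‖ₑ ^ 2 ≤ ENNReal.ofReal (C * (k : ℕ)! / (k : ℝ) ^ (1 + δ)) ∧
    ∫⁻ ξ, ‖a k ξ‖ₑ * ‖ξ i‖ₑ ^ 3 ≤ ENNReal.ofReal (C * (k : ℕ)! / (k : ℝ) ^ (1 + δ)) ∧
    ∀ j : Fin k, i ≠ j →
      ∫⁻ ξ, ‖a k ξ‖ₑ * ‖ξ i‖ₑ * ‖ξ j‖ₑ ≤ ENNReal.ofReal (C * (k : ℕ)! / (k : ℝ) ^ (2 + δ)) ∧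
      ∫⁻ ξ, ‖a k ξ‖ₑ * ‖ξ i‖ₑ ^ 2 * ‖ξ j‖ₑ
        ≤ ENNReal.ofReal (C * (k : ℕ)! / (k : ℝ) ^ (3 + δ))

/-- The `k`-th term of the Fourier series with coefficients `a`. -/
def fourierTerm (a : Coeffs d) (m : P2 d) (k : ℕ+) : ℂ :=
  ((k : ℕ)! : ℂ)⁻¹ * ∫ ξ, a k ξ * fourierPoly k ξ m

/-- The Fourier series with coefficients `a`. -/
def fourierSeries (a : Coeffs d) (m : P2 d) : ℂ := ∑' k : ℕ+, fourierTerm a m k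

/-- `a` is an admissible sequence of Fourier coefficients of `F`. -/
def HasCoeffs (F : P2 d → ℂ) (a : Coeffs d) : Prop :=
  MemA0 a ∧ (∃ C δ : ℝ, 0 < C ∧ 0 < δ ∧ UniformBound a C δ) ∧
    ∀ m, HasSum (fourierTerm a m) (F m)

/-- The space `𝓗⁰`. -/
def MemH0 (F : P2 d → ℂ) : Prop := ∃ a, HasCoeffs F a

open Classical in
/-- The (unique up to null sets) Fourier coefficients of an element of `𝓗⁰`. -/
def coeffs (F : P2 d → ℂ) : Coeffs d :=
  if h : MemH0 F then h.choose else fun _ _ => 0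

/-- `⟨F; G⟩_{H⁰} = ∑_k (1/k!) ∫ a_k b_k^* dξ`. -/
def H0inner (F G : P2 d → ℂ) : ℂ :=
  ∑' k : ℕ+, ((k : ℕ)! : ℂ)⁻¹ * ∫ ξ, coeffs F k ξ * (starRingEnd ℂ) (coeffs G k ξ)

/-- The inner product of vector valued functions, `∑_n ⟨V^n; W^n⟩_{H⁰}`. -/
def H0innerVec (V W : Fin d → P2 d → ℂ) : ℂ := ∑ n, H0inner (V n) (W n)

/-- The norm of a vector valued function, `‖V‖² = ⟨V; V⟩`. -/
def H0normVec (V : Fin d → P2 d → ℂ) : ℝ := √(H0innerVec V V).re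

end WassersteinFourier

end

open WassersteinFourier

/-! Integrating a symmetrized exponential against a product measure gives
$F^k_\xi[m]=\frac1k\prod_j\hat m(\xi_j)$ (`fourierPoly_eq`). A Fourier series is therefore a single
integral of monomials in $\hat m$ over the disjoint union of all $(\mathbb R^d)^k$, with density
$a_k/(k\,k!)$. On a monomial, the mean gradient acts as multiplication by $-2\pi i\sum_j\xi_j$ and
the Wasserstein Laplacian as multiplication by $-\lambda_k^2$: the spatial derivative of the
gradient contributes the diagonal terms $\xi_j\otimes\xi_j$, its derivative in the measure the terms
$\xi_j\otimes\xi_i$ with $i\ne j$. The integration by parts formula is then a pointwise identity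
between coefficients, `sum_innerDensity_gradCoeffs`.

To make this rigorous, `HasExpansion` collects a value, a gradient and its two derivatives, with
remainders controlled by the cost of an arbitrary plan. `monomial_hasExpansion` supplies it for
monomials with constant $2|w|(1+S)^3$, where $S=4\pi\sum_j|\xi_j|$. All its clauses are stable under
integration (`HasExpansion.integral`), and `isRegular_weight` extracts the integrability of the
constant from the moment bounds.

The candidate gradient must then be the subgradient of minimal norm. A small displacement along a
bounded gradient field with quadratic Taylor remainder is optimal (`map_mem_optPlans`), so all
subgradients and supergradients have the same inner product with such a field. Minimality of the
norm forces equality (`wGrad_eq_of_isGradientField`). The same pairing computes the Hessian on test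
gradients (`preHess_eq`) without identifying the gradient of $\zeta\cdot(U)$. Coordinate fields are
limits of test gradients, so the value of the Laplacian does not depend on the Hessian chosen
(`hasWLaplacianAt_and_eq`).

Finally, $\langle\cdot;\cdot\rangle_{H^0}$ uses chosen coefficients, hence needs their uniqueness,
`HasCoeffs.ae_eq`. The series is tested on discrete measures: an atom sent to infinity disappears by
Riemann–Lebesgue, scaling the remaining mass separates the degrees, polarization recovers products
of plane waves, and injectivity of the Fourier transform concludes. -/

namespace WassersteinFourier

noncomputable section

variable {d : ℕ}

/-! ### Plane waves -/

/-- The plane wave `x ↦ exp (-2πi ⟨ξ, x⟩)`. -/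
def wave (ξ x : E d) : ℂ :=
  Complex.exp (-2 * Real.pi * Complex.I * ((inner ℝ ξ x : ℝ) : ℂ))

/-- The Fourier transform of a measure. -/
def hat (m : P2 d) (ξ : E d) : ℂ := ∫ x, wave ξ x ∂m.meas

/-- The constant `-2πi`. -/
def tau : ℂ := -2 * Real.pi * Complex.I

lemma norm_tau : ‖tau‖ = 2 * Real.pi := by
  simp [tau, abs_of_pos Real.pi_pos]

lemma tau_sq : tau ^ 2 = ((-4 * Real.pi ^ 2 : ℝ) : ℂ) := by
  rw [tau, mul_pow, Complex.I_sq]; push_cast; ring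

lemma wave_eq (ξ x : E d) :
    wave ξ x = Complex.exp (Complex.I * ((-2 * Real.pi * inner ℝ ξ x : ℝ) : ℂ)) := by
  rw [wave]; push_cast; ring_nf

@[simp] lemma norm_wave (ξ x : E d) : ‖wave ξ x‖ = 1 := by
  rw [wave_eq, Complex.norm_exp_I_mul_ofReal]

@[simp] lemma wave_zero_right (ξ : E d) : wave ξ 0 = 1 := by simp [wave]

lemma wave_add (ξ x y : E d) : wave ξ (x + y) = wave ξ x * wave ξ y := by
  rw [wave, wave, wave, ← Complex.exp_add, inner_add_right]; push_cast; ring_nf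

lemma continuous_wave : Continuous fun p : E d × E d => wave p.1 p.2 := by
  unfold wave; fun_prop

lemma continuous_wave_right (ξ : E d) : Continuous (wave ξ) := by
  unfold wave; fun_prop

lemma continuous_wave_left (x : E d) : Continuous fun ξ => wave ξ x := by
  unfold wave; fun_prop

/-- Taylor's formula for |t| ≤ 1. For |t| ≥ 1 the triangle inequality gives 2|t|, and |t| ≤ t². -/
lemma norm_exp_I_sub_one_sub (t : ℝ) :
    ‖Complex.exp (Complex.I * t) - 1 - Complex.I * t‖ ≤ 2 * t ^ 2 := by
  rcases le_total |t| 1 with h | h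
  · have := Complex.norm_exp_sub_one_sub_id_le (x := Complex.I * t) (by simpa using h)
    refine this.trans ?_
    simp only [norm_mul, Complex.norm_I, one_mul, Complex.norm_real, Real.norm_eq_abs, sq_abs]
    nlinarith [sq_nonneg t]
  · calc _ ≤ ‖Complex.exp (Complex.I * t) - 1‖ + ‖Complex.I * t‖ := norm_sub_le _ _
      _ ≤ |t| + |t| := by
        gcongr
        · exact Real.norm_exp_I_mul_ofReal_sub_one_le
        · simp
      _ ≤ 2 * t ^ 2 := by rw [← sq_abs t]; nlinarith

lemma abs_two_pi_inner_le (ξ v : E d) : |-2 * Real.pi * inner ℝ ξ v| ≤ 2 * Real.pi * ‖ξ‖ * ‖v‖ := by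
  rw [abs_mul, abs_mul, abs_neg, abs_two, abs_of_pos Real.pi_pos, mul_assoc (2 * Real.pi)]
  gcongr
  exact abs_real_inner_le_norm ξ v

/-- The constant 4π replaces the sharper 2π so that one number u bounds the increment while u²
bounds the second order remainder. This is the form in which the product estimates consume it. -/
lemma norm_wave_sub_le (ξ x y : E d) :
    ‖wave ξ y - wave ξ x‖ ≤ 4 * Real.pi * ‖ξ‖ * ‖x - y‖ := by
  have h : wave ξ y - wave ξ x = wave ξ x * (wave ξ (y - x) - 1) := by
    rw [mul_sub, ← wave_add]; simp
  rw [h, norm_mul, norm_wave, one_mul, wave_eq, norm_sub_rev x y]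
  refine Real.norm_exp_I_mul_ofReal_sub_one_le.trans ((abs_two_pi_inner_le _ _).trans ?_)
  gcongr
  norm_num

lemma norm_wave_sub_sub_le (ξ x y : E d) :
    ‖wave ξ y - wave ξ x - tau * (inner ℝ ξ (y - x) : ℝ) * wave ξ x‖
      ≤ (4 * Real.pi * ‖ξ‖ * ‖x - y‖) ^ 2 := by
  have h : wave ξ y - wave ξ x - tau * (inner ℝ ξ (y - x) : ℝ) * wave ξ x =
      wave ξ x * (wave ξ (y - x) - 1 - tau * (inner ℝ ξ (y - x) : ℝ)) := by
    rw [mul_sub, mul_sub, ← wave_add]; simp; ring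
  have h2 : tau * (inner ℝ ξ (y - x) : ℝ) =
      Complex.I * ((-2 * Real.pi * inner ℝ ξ (y - x) : ℝ) : ℂ) := by
    rw [tau]; push_cast; ring
  rw [h, norm_mul, norm_wave, one_mul, h2, wave_eq, norm_sub_rev x y]
  refine (norm_exp_I_sub_one_sub _).trans ?_
  rw [← sq_abs]
  have := abs_two_pi_inner_le ξ (y - x)
  have h3 := pow_le_pow_left₀ (abs_nonneg _) this 2
  nlinarith [sq_nonneg (2 * Real.pi * ‖ξ‖ * ‖y - x‖)]

/-! ### Transport plans -/

section Plans

variable {m ν : P2 d} {γ : Measure (E d × E d)}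

lemma isProbabilityMeasure_of_mem_plans (h : γ ∈ plans m ν) : IsProbabilityMeasure γ := by
  constructor
  have := congrArg (fun μ => μ Set.univ) h.1
  simpa [Measure.map_apply measurable_fst] using this

lemma measurePreserving_fst_of_mem_plans (h : γ ∈ plans m ν) :
    MeasurePreserving Prod.fst γ m.meas := ⟨measurable_fst, h.1⟩

lemma measurePreserving_snd_of_mem_plans (h : γ ∈ plans m ν) :
    MeasurePreserving Prod.snd γ ν.meas := ⟨measurable_snd, h.2⟩

lemma memLp_id (m : P2 d) : MemLp (fun x => x) 2 m.meas := m.2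

lemma memLp_fst (h : γ ∈ plans m ν) : MemLp (fun p : E d × E d => p.1) 2 γ :=
  (memLp_id m).comp_measurePreserving (measurePreserving_fst_of_mem_plans h)

lemma memLp_snd (h : γ ∈ plans m ν) : MemLp (fun p : E d × E d => p.2) 2 γ :=
  (memLp_id ν).comp_measurePreserving (measurePreserving_snd_of_mem_plans h)

lemma memLp_displacement (h : γ ∈ plans m ν) : MemLp (fun p : E d × E d => p.2 - p.1) 2 γ :=
  (memLp_snd h).sub (memLp_fst h)

lemma integrable_displacement (h : γ ∈ plans m ν) :
    Integrable (fun p : E d × E d => p.2 - p.1) γ :=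
  have := isProbabilityMeasure_of_mem_plans h
  (memLp_displacement h).integrable (by norm_num)

lemma integrable_norm_sub (h : γ ∈ plans m ν) :
    Integrable (fun p : E d × E d => ‖p.1 - p.2‖) γ := by
  simpa only [norm_sub_rev] using (integrable_displacement h).norm

lemma integrable_cost (h : γ ∈ plans m ν) :
    Integrable (fun p : E d × E d => ‖p.1 - p.2‖ ^ 2) γ := by
  simpa only [norm_sub_rev] using (memLp_displacement h).integrable_norm_pow (p := 2) (by norm_num)

/-- The transport cost of a plan. -/
def cost (γ : Measure (E d × E d)) : ℝ := ∫ p, ‖p.1 - p.2‖ ^ 2 ∂γ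

lemma cost_nonneg (γ : Measure (E d × E d)) : 0 ≤ cost γ := integral_nonneg fun _ => by positivity

lemma integral_norm_sub_le (h : γ ∈ plans m ν) : ∫ p, ‖p.1 - p.2‖ ∂γ ≤ √(cost γ) := by
  have := isProbabilityMeasure_of_mem_plans h
  set c := ∫ p, ‖p.1 - p.2‖ ∂γ with hc
  apply Real.le_sqrt_of_sq_le
  -- Nonnegativity of a variance: since γ has mass one, expanding the square is the Cauchy–Schwarz
  -- inequality.
  have h0 : 0 ≤ ∫ p, (‖p.1 - p.2‖ - c) ^ 2 ∂γ := integral_nonneg fun _ => by positivity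
  have h1 : ∫ p, (‖p.1 - p.2‖ - c) ^ 2 ∂γ = cost γ - 2 * c * c + c ^ 2 := by
    have : ∀ p : E d × E d, (‖p.1 - p.2‖ - c) ^ 2 =
      ‖p.1 - p.2‖ ^ 2 - 2 * c * ‖p.1 - p.2‖ + c ^ 2 := fun p => by ring
    simp_rw [this]
    rw [integral_add, integral_sub, integral_const_mul, ← hc, cost]
    · simp
    · exact integrable_cost h
    · exact (integrable_norm_sub h).const_mul _
    · exact (integrable_cost h).sub ((integrable_norm_sub h).const_mul _)
    · exact integrable_const _
  nlinarith

lemma hat_eq_integral_fst (h : γ ∈ plans m ν) (ξ : E d) : hat m ξ = ∫ p, wave ξ p.1 ∂γ := by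
  rw [hat, ← h.1, integral_map measurable_fst.aemeasurable
    (continuous_wave_right ξ).aestronglyMeasurable]

lemma hat_eq_integral_snd (h : γ ∈ plans m ν) (ξ : E d) : hat ν ξ = ∫ p, wave ξ p.2 ∂γ := by
  rw [hat, ← h.2, integral_map measurable_snd.aemeasurable
    (continuous_wave_right ξ).aestronglyMeasurable]

end Plans

lemma integrable_wave (m : P2 d) (ξ : E d) : Integrable (wave ξ) m.meas :=
  Integrable.of_bound (continuous_wave_right ξ).aestronglyMeasurable 1 (by simp)

lemma norm_hat_le (m : P2 d) (ξ : E d) : ‖hat m ξ‖ ≤ 1 := by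
  refine (norm_integral_le_of_norm_le_const (C := 1) (by simp)).trans (by simp)

lemma continuous_hat (m : P2 d) : Continuous (hat m) := by
  refine continuous_of_dominated (bound := fun _ => 1) ?_ ?_ ?_ ?_
  · exact fun ξ => (continuous_wave_right ξ).aestronglyMeasurable
  · simp
  · exact integrable_const _
  · exact ae_of_all _ fun x => continuous_wave_left x

/-- The first variation of `hat m ξ` along a plan. -/
def hatVar (γ : Measure (E d × E d)) (ξ : E d) : ℂ :=
  ∫ p, tau * (inner ℝ ξ (p.2 - p.1) : ℝ) * wave ξ p.1 ∂γ

/-! ### Expansion of the Fourier transform along a plan -/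

section HatTaylor

variable {m ν : P2 d} {γ : Measure (E d × E d)}

lemma integrable_hatVar (h : γ ∈ plans m ν) (ξ : E d) :
    Integrable (fun p : E d × E d => tau * (inner ℝ ξ (p.2 - p.1) : ℝ) * wave ξ p.1) γ := by
  refine Integrable.mono' ((integrable_norm_sub h).const_mul (‖tau‖ * ‖ξ‖)) ?_ ?_
  · refine Continuous.aestronglyMeasurable ?_
    have := continuous_wave_right ξ
    fun_prop
  · refine ae_of_all _ fun p => ?_
    rw [norm_mul, norm_mul, norm_wave, mul_one, Complex.norm_real, mul_assoc, norm_sub_rev]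
    gcongr
    exact norm_inner_le_norm _ _

lemma integrable_wave_fst (h : γ ∈ plans m ν) (ξ : E d) :
    Integrable (fun p : E d × E d => wave ξ p.1) γ :=
  (measurePreserving_fst_of_mem_plans h).integrable_comp_of_integrable (integrable_wave m ξ)

lemma integrable_wave_snd (h : γ ∈ plans m ν) (ξ : E d) :
    Integrable (fun p : E d × E d => wave ξ p.2) γ :=
  (measurePreserving_snd_of_mem_plans h).integrable_comp_of_integrable (integrable_wave ν ξ)

lemma norm_hat_sub_le (h : γ ∈ plans m ν) (ξ : E d) :
    ‖hat ν ξ - hat m ξ‖ ≤ 4 * Real.pi * ‖ξ‖ * √(cost γ) := by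
  rw [hat_eq_integral_fst h, hat_eq_integral_snd h,
    ← integral_sub (integrable_wave_snd h ξ) (integrable_wave_fst h ξ)]
  calc _ ≤ ∫ p, 4 * Real.pi * ‖ξ‖ * ‖p.1 - p.2‖ ∂γ :=
        norm_integral_le_of_norm_le ((integrable_norm_sub h).const_mul _)
          (ae_of_all _ fun p => norm_wave_sub_le _ _ _)
    _ ≤ _ := by
        rw [integral_const_mul]
        gcongr
        exact integral_norm_sub_le h

lemma norm_hat_sub_sub_le (h : γ ∈ plans m ν) (ξ : E d) :
    ‖hat ν ξ - hat m ξ - hatVar γ ξ‖ ≤ (4 * Real.pi * ‖ξ‖ * √(cost γ)) ^ 2 := by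
  rw [hat_eq_integral_fst h, hat_eq_integral_snd h, hatVar,
    ← integral_sub (integrable_wave_snd h ξ) (integrable_wave_fst h ξ), ← integral_sub
    (f := fun p : E d × E d => wave ξ p.2 - wave ξ p.1)
    ((integrable_wave_snd h ξ).sub (integrable_wave_fst h ξ)) (integrable_hatVar h ξ)]
  calc _ ≤ ∫ p, (4 * Real.pi * ‖ξ‖) ^ 2 * ‖p.1 - p.2‖ ^ 2 ∂γ :=
        norm_integral_le_of_norm_le ((integrable_cost h).const_mul _)
          (ae_of_all _ fun p => by
            simpa only [mul_pow] using norm_wave_sub_sub_le ξ p.1 p.2)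
    _ = _ := by
        rw [integral_const_mul, mul_pow _ (√(cost γ)), Real.sq_sqrt (cost_nonneg γ), cost]

end HatTaylor

/-! ### Taylor expansion of a product of contractions -/

/-- The remainder of a product splits into the product of the increments, at most uS, and the two
remainders, at most u² and S². Sizes thus add under multiplication, which drives the induction over
the factors of a monomial. -/
lemma norm_mul_sub_sub_le {q p l Q P L : ℂ} {u S : ℝ} (hp : ‖p‖ ≤ 1) (hP : ‖P‖ ≤ 1)
    (hQ : ‖Q - P‖ ≤ S) (h1 : ‖q - p‖ ≤ u) (h2 : ‖q - p - l‖ ≤ u ^ 2)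
    (h3 : ‖Q - P - L‖ ≤ S ^ 2) : ‖q * Q - p * P - (l * P + p * L)‖ ≤ (u + S) ^ 2 := by
  have : q * Q - p * P - (l * P + p * L) =
    (q - p) * (Q - P) + (q - p - l) * P + p * (Q - P - L) := by ring
  rw [this]
  have hu : 0 ≤ u := (norm_nonneg _).trans h1
  have hS : 0 ≤ S := (norm_nonneg _).trans hQ
  calc _ ≤ ‖q - p‖ * ‖Q - P‖ + ‖q - p - l‖ * ‖P‖ + ‖p‖ * ‖Q - P - L‖ := by
        refine (norm_add₃_le).trans ?_
        simp only [norm_mul, le_refl]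
    _ ≤ u * S + u ^ 2 * 1 + 1 * S ^ 2 := by gcongr
    _ ≤ _ := by nlinarith [mul_nonneg hu hS]

lemma norm_prod_le_one' {ι : Type*} (s : Finset ι) {p : ι → ℂ} (hp : ∀ i, ‖p i‖ ≤ 1) :
    ‖∏ i ∈ s, p i‖ ≤ 1 := by
  rw [norm_prod]
  exact Finset.prod_le_one (fun _ _ => norm_nonneg _) fun i _ => hp i

lemma norm_prod_sub_prod_le' {ι : Type*} [DecidableEq ι] (s : Finset ι) {p q : ι → ℂ} {u : ι → ℝ}
    (hp : ∀ i, ‖p i‖ ≤ 1) (hq : ∀ i, ‖q i‖ ≤ 1) (h1 : ∀ i, ‖q i - p i‖ ≤ u i) :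
    ‖∏ i ∈ s, q i - ∏ i ∈ s, p i‖ ≤ ∑ i ∈ s, u i := by
  induction s using Finset.induction_on with
  | empty => simp
  | insert a s ha ih =>
    rw [Finset.prod_insert ha, Finset.prod_insert ha, Finset.sum_insert ha]
    have : q a * ∏ i ∈ s, q i - p a * ∏ i ∈ s, p i =
      (q a - p a) * ∏ i ∈ s, q i + p a * (∏ i ∈ s, q i - ∏ i ∈ s, p i) := by ring
    rw [this]
    refine (norm_add_le _ _).trans ?_
    rw [norm_mul, norm_mul]
    refine add_le_add ?_ ?_
    · exact (mul_le_of_le_one_right (norm_nonneg _) (norm_prod_le_one' s hq)).trans (h1 a)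
    · exact (mul_le_of_le_one_left (norm_nonneg _) (hp a)).trans ih

lemma norm_prod_sub_sub_le {ι : Type*} [DecidableEq ι] (s : Finset ι) {p q l : ι → ℂ} {u : ι → ℝ}
    (hp : ∀ i, ‖p i‖ ≤ 1) (hq : ∀ i, ‖q i‖ ≤ 1) (h1 : ∀ i, ‖q i - p i‖ ≤ u i)
    (h2 : ∀ i, ‖q i - p i - l i‖ ≤ u i ^ 2) :
    ‖∏ i ∈ s, q i - ∏ i ∈ s, p i - ∑ i ∈ s, l i * ∏ j ∈ s.erase i, p j‖ ≤ (∑ i ∈ s, u i) ^ 2 := by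
  induction s using Finset.induction_on with
  | empty => simp
  | insert a s ha ih =>
    rw [Finset.prod_insert ha, Finset.prod_insert ha, Finset.sum_insert ha,
      Finset.sum_insert ha, Finset.erase_insert ha]
    -- Erasing i ∈ s leaves the new factor p a in place, so the Leibniz sum over insert a s has the
    -- shape l P + p L of the two-factor estimate.
    have : ∑ i ∈ s, l i * ∏ j ∈ (insert a s).erase i, p j =
        p a * ∑ i ∈ s, l i * ∏ j ∈ s.erase i, p j := by
      rw [Finset.mul_sum]
      refine Finset.sum_congr rfl fun i hi => ?_
      have hia : a ≠ i := fun h => ha (h ▸ hi)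
      rw [Finset.erase_insert_of_ne hia, Finset.prod_insert (by simp [ha])]
      ring
    rw [this]
    exact norm_mul_sub_sub_le (hp a) (norm_prod_le_one' s hp) (norm_prod_sub_prod_le' s hp hq h1)
      (h1 a) (h2 a) ih

end

end WassersteinFourier

namespace WassersteinFourier

noncomputable section

variable {d : ℕ}

/-! ### Functionals with a second order expansion along all plans -/

/-- `U` has gradient `g`, with potential `pot`, and the gradient has a first order expansion with
coefficients `A₁`, `A₂`, all remainders being bounded by `K` times the transport cost of an
arbitrary plan. -/
structure HasExpansion (U : P2 d → ℝ) (g : P2 d → E d → E d) (A₁ : P2 d → E d → E d →L[ℝ] E d)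
    (A₂ : P2 d → E d × E d → E d →L[ℝ] E d) (pot : P2 d → E d → ℝ) (K : ℝ) : Prop where
  val_bound : ∀ m, |U m| ≤ K
  grad_bound : ∀ m x, ‖g m x‖ ≤ K
  hess₁_bound : ∀ m x, ‖A₁ m x‖ ≤ K
  hess₂_bound : ∀ m p, ‖A₂ m p‖ ≤ K
  hess₁_cont : ∀ m, Continuous (A₁ m)
  hess₂_cont : ∀ m, Continuous (A₂ m)
  pot_zero : ∀ m, pot m 0 = 0
  pot_exp : ∀ m x y, |pot m y - pot m x - inner ℝ (g m x) (y - x)| ≤ K * ‖x - y‖ ^ 2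
  val_exp : ∀ m ν, ∀ γ ∈ plans m ν,
    |U ν - U m - ∫ p, inner ℝ (g m p.1) (p.2 - p.1) ∂γ| ≤ K * cost γ
  grad_exp : ∀ m ν, ∀ γ ∈ plans m ν, ∀ x y,
    ‖g ν y - g m x - (A₁ m x (y - x) + ∫ p, A₂ m (x, p.1) (p.2 - p.1) ∂γ)‖
      ≤ K * (‖x - y‖ ^ 2 + cost γ)

/-! ### Monomials -/

section Monomial

set_option linter.unusedSectionVars false

variable {ι : Type*} [Fintype ι] [DecidableEq ι]

/-- The monomial `Re (w ∏ⱼ m̂(ξⱼ))`. -/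
def monoVal (w : ℂ) (ξ : ι → E d) (m : P2 d) : ℝ := (w * ∏ j, hat m (ξ j)).re

/-- The Wasserstein gradient of a monomial. -/
def monoGrad (w : ℂ) (ξ : ι → E d) (m : P2 d) (x : E d) : E d :=
  ∑ j, (w * tau * (wave (ξ j) x * ∏ i ∈ Finset.univ.erase j, hat m (ξ i))).re • ξ j

/-- The spatial derivative of the gradient of a monomial. -/
def monoHess₁ (w : ℂ) (ξ : ι → E d) (m : P2 d) (x : E d) : E d →L[ℝ] E d :=
  ∑ j, (w * tau ^ 2 * (wave (ξ j) x * ∏ i ∈ Finset.univ.erase j, hat m (ξ i))).re •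
    InnerProductSpace.rankOne ℝ (ξ j) (ξ j)

/-- The derivative of the gradient of a monomial in the measure. -/
def monoHess₂ (w : ℂ) (ξ : ι → E d) (m : P2 d) (p : E d × E d) : E d →L[ℝ] E d :=
  ∑ j, ∑ i ∈ Finset.univ.erase j, (w * tau ^ 2 * (wave (ξ j) p.1 * wave (ξ i) p.2 *
    ∏ l ∈ (Finset.univ.erase j).erase i, hat m (ξ l))).re •
      InnerProductSpace.rankOne ℝ (ξ j) (ξ i)

/-- A potential of the gradient of a monomial. -/
def monoPot (w : ℂ) (ξ : ι → E d) (m : P2 d) (x : E d) : ℝ :=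
  ∑ j, (w * ((wave (ξ j) x - 1) * ∏ i ∈ Finset.univ.erase j, hat m (ξ i))).re

/-- The size of a frequency vector. -/
def freqSize (ξ : ι → E d) : ℝ := ∑ j, 4 * Real.pi * ‖ξ j‖

lemma freqSize_nonneg (ξ : ι → E d) : 0 ≤ freqSize ξ :=
  Finset.sum_nonneg fun _ _ => by positivity

lemma abs_re_mul_le {w z : ℂ} (hz : ‖z‖ ≤ 1) : |(w * z).re| ≤ ‖w‖ := by
  refine (Complex.abs_re_le_norm _).trans ?_
  rw [norm_mul]
  exact mul_le_of_le_one_right (norm_nonneg _) hz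

lemma norm_prod_hat_le (s : Finset ι) (ξ : ι → E d) (m : P2 d) :
    ‖∏ i ∈ s, hat m (ξ i)‖ ≤ 1 := norm_prod_le_one' s fun i => norm_hat_le m (ξ i)

lemma norm_wave_mul_prod_le (s : Finset ι) (ξ : ι → E d) (m : P2 d) (η x : E d) :
    ‖wave η x * ∏ i ∈ s, hat m (ξ i)‖ ≤ 1 := by
  simpa using norm_prod_hat_le s ξ m

/-- The scalar product is real and moves inside the real part, where the integrand of `hatVar`
appears. -/
lemma integral_re_wave_mul_inner {m ν : P2 d} {γ : Measure (E d × E d)} (h : γ ∈ plans m ν)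
    (c : ℂ) (ξ : E d) :
    Integrable (fun p : E d × E d => (c * tau * wave ξ p.1).re * inner ℝ ξ (p.2 - p.1)) γ ∧
    ∫ p, (c * tau * wave ξ p.1).re * inner ℝ ξ (p.2 - p.1) ∂γ = (c * hatVar γ ξ).re := by
  have hi := (integrable_hatVar h ξ).const_mul c
  have e : ∀ p : E d × E d, (c * tau * wave ξ p.1).re * inner ℝ ξ (p.2 - p.1) =
      RCLike.re (c * (tau * (inner ℝ ξ (p.2 - p.1) : ℝ) * wave ξ p.1)) := fun p => by
    rw [show c * (tau * (inner ℝ ξ (p.2 - p.1) : ℝ) * wave ξ p.1) =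
      (inner ℝ ξ (p.2 - p.1) : ℝ) * (c * tau * wave ξ p.1) by ring]
    simp only [RCLike.re_to_complex, Complex.re_ofReal_mul]
    ring
  simp_rw [e]
  refine ⟨hi.re, ?_⟩
  rw [integral_re hi, integral_const_mul]
  rfl

lemma sum_norm_le_freqSize (ξ : ι → E d) : 2 * Real.pi * ∑ j, ‖ξ j‖ ≤ freqSize ξ := by
  rw [freqSize, ← Finset.mul_sum]
  have : 0 ≤ ∑ j, ‖ξ j‖ := Finset.sum_nonneg fun _ _ => norm_nonneg _
  nlinarith [Real.pi_pos, mul_nonneg Real.pi_pos.le this]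

lemma norm_sum_smul_le (w : ℂ) (ξ : ι → E d) (z : ι → ℂ) {B : ℝ} (hz : ∀ j, ‖z j‖ ≤ B) :
    ‖∑ j, (w * tau * z j).re • ξ j‖ ≤ ‖w‖ * freqSize ξ * B := by
  calc _ ≤ ∑ j, ‖w‖ * (2 * Real.pi) * B * ‖ξ j‖ := by
        refine norm_sum_le_of_le _ fun j _ => ?_
        rw [norm_smul, Real.norm_eq_abs]
        gcongr
        refine (Complex.abs_re_le_norm _).trans ?_
        rw [norm_mul, norm_mul, norm_tau]
        gcongr
        exact hz j
    _ = ‖w‖ * (2 * Real.pi * ∑ j, ‖ξ j‖) * B := by rw [← Finset.mul_sum]; ring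
    _ ≤ _ := by
        rcases isEmpty_or_nonempty ι with hι | ⟨⟨j⟩⟩
        · simp [freqSize]
        · have : 0 ≤ B := (norm_nonneg _).trans (hz j)
          gcongr
          exact sum_norm_le_freqSize ξ

lemma monoHess₂_apply (w : ℂ) (ξ : ι → E d) (m : P2 d) (x a v : E d) :
    monoHess₂ w ξ m (x, a) v = ∑ j, ∑ i ∈ Finset.univ.erase j,
      ((w * tau * (wave (ξ j) x * ∏ l ∈ (Finset.univ.erase j).erase i, hat m (ξ l)) * tau *
        wave (ξ i) a).re * inner ℝ (ξ i) v) • ξ j := by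
  simp only [monoHess₂, sum_apply, smul_apply,
    InnerProductSpace.rankOne_apply, smul_smul]
  refine Finset.sum_congr rfl fun j _ => Finset.sum_congr rfl fun i _ => ?_
  congr 3
  ring

/-- Pairing the gradient with the displacement produces the Leibniz sum of the first variations of
the factors $\hat m(\xi_j)$. What is left is the remainder of a product of contractions of sizes
4π‖ξ j‖√(cost γ), which sum to freqSize ξ * √(cost γ). -/
lemma monomial_val_exp (w : ℂ) (ξ : ι → E d) {m ν : P2 d} {γ : Measure (E d × E d)}
    (h : γ ∈ plans m ν) :
    |monoVal w ξ ν - monoVal w ξ m - ∫ p, inner ℝ (monoGrad w ξ m p.1) (p.2 - p.1) ∂γ|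
      ≤ ‖w‖ * freqSize ξ ^ 2 * cost γ := by
  have e : ∫ p, inner ℝ (monoGrad w ξ m p.1) (p.2 - p.1) ∂γ =
      (w * ∑ j, hatVar γ (ξ j) * ∏ i ∈ Finset.univ.erase j, hat m (ξ i)).re := by
    have : ∀ p : E d × E d, inner ℝ (monoGrad w ξ m p.1) (p.2 - p.1) =
        ∑ j, (w * (∏ i ∈ Finset.univ.erase j, hat m (ξ i)) * tau * wave (ξ j) p.1).re *
          inner ℝ (ξ j) (p.2 - p.1) := fun p => by
      rw [monoGrad, sum_inner]
      refine Finset.sum_congr rfl fun j _ => ?_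
      rw [real_inner_smul_left]
      congr 2
      ring
    simp_rw [this]
    rw [integral_finsetSum _ fun j _ => (integral_re_wave_mul_inner h _ (ξ j)).1, Finset.mul_sum,
      Complex.re_sum]
    refine Finset.sum_congr rfl fun j _ => ?_
    rw [(integral_re_wave_mul_inner h _ (ξ j)).2]
    congr 1
    ring
  rw [e, monoVal, monoVal, ← Complex.sub_re, ← Complex.sub_re, ← mul_sub, ← mul_sub]
  refine (Complex.abs_re_le_norm _).trans ?_
  rw [norm_mul, mul_assoc]
  gcongr
  have := norm_prod_sub_sub_le Finset.univ (fun j => norm_hat_le m (ξ j))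
    (fun j => norm_hat_le ν (ξ j)) (fun j => norm_hat_sub_le h (ξ j))
    (fun j => norm_hat_sub_sub_le h (ξ j))
  refine this.trans (le_of_eq ?_)
  rw [← Finset.sum_mul, mul_pow, Real.sq_sqrt (cost_nonneg γ), freqSize]

/-- The j-th component is a product of two contractions that vary independently: a wave, moved from
x to y, and the remaining Fourier transforms, moved from m to ν. One power of `freqSize` comes from
the vector ξ j and two from the quadratic remainder. -/
lemma monomial_grad_exp (w : ℂ) (ξ : ι → E d) {m ν : P2 d} {γ : Measure (E d × E d)}
    (h : γ ∈ plans m ν) (x y : E d) :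
    ‖monoGrad w ξ ν y - monoGrad w ξ m x -
      (monoHess₁ w ξ m x (y - x) + ∫ p, monoHess₂ w ξ m (x, p.1) (p.2 - p.1) ∂γ)‖
      ≤ 2 * (‖w‖ * freqSize ξ ^ 3) * (‖x - y‖ ^ 2 + cost γ) := by
  have e : ∫ p, monoHess₂ w ξ m (x, p.1) (p.2 - p.1) ∂γ = ∑ j, (w * tau * (wave (ξ j) x *
      ∑ i ∈ Finset.univ.erase j, hatVar γ (ξ i) *
        ∏ l ∈ (Finset.univ.erase j).erase i, hat m (ξ l))).re • ξ j := by
    simp_rw [monoHess₂_apply]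
    rw [integral_finsetSum _ fun j _ => integrable_finsetSum _ fun i _ =>
      (integral_re_wave_mul_inner h _ (ξ i)).1.smul_const _]
    refine Finset.sum_congr rfl fun j _ => ?_
    rw [integral_finsetSum _ fun i _ => (integral_re_wave_mul_inner h _ (ξ i)).1.smul_const _]
    simp_rw [integral_smul_const, (integral_re_wave_mul_inner h _ _).2]
    rw [← Finset.sum_smul, Finset.mul_sum, Finset.mul_sum, Complex.re_sum]
    congr 1
    refine Finset.sum_congr rfl fun i _ => ?_
    congr 1
    ring
  have key : monoGrad w ξ ν y - monoGrad w ξ m x -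
      (monoHess₁ w ξ m x (y - x) + ∫ p, monoHess₂ w ξ m (x, p.1) (p.2 - p.1) ∂γ) =
      ∑ j, (w * tau * (wave (ξ j) y * ∏ i ∈ Finset.univ.erase j, hat ν (ξ i) -
        wave (ξ j) x * ∏ i ∈ Finset.univ.erase j, hat m (ξ i) -
        (tau * (inner ℝ (ξ j) (y - x) : ℝ) * wave (ξ j) x *
          ∏ i ∈ Finset.univ.erase j, hat m (ξ i) +
          wave (ξ j) x * ∑ i ∈ Finset.univ.erase j, hatVar γ (ξ i) *
            ∏ l ∈ (Finset.univ.erase j).erase i, hat m (ξ l)))).re • ξ j := by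
    rw [e, monoGrad, monoGrad, monoHess₁, sum_apply, ← Finset.sum_sub_distrib,
      ← Finset.sum_add_distrib, ← Finset.sum_sub_distrib]
    refine Finset.sum_congr rfl fun j _ => ?_
    rw [smul_apply, InnerProductSpace.rankOne_apply, smul_smul, ← sub_smul,
      ← add_smul, ← sub_smul]
    congr 1
    rw [mul_comm (Complex.re _), ← Complex.re_ofReal_mul, ← Complex.sub_re, ← Complex.add_re,
      ← Complex.sub_re]
    congr 1
    ring
  rw [key]
  -- B bounds the square of the total size 4π‖ξ j‖‖x - y‖ + Σ 4π‖ξ i‖√(cost γ), the sum being over i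
  -- ≠ j, uniformly in j.
  refine (norm_sum_smul_le w ξ _ (B := (freqSize ξ * (‖x - y‖ + √(cost γ))) ^ 2)
    fun j => ?_).trans ?_
  · set s : Finset ι := Finset.univ.erase j
    have hp := fun i => norm_hat_le m (ξ i)
    have hq := fun i => norm_hat_le ν (ξ i)
    have h1 := fun i => norm_hat_sub_le h (ξ i)
    have h2 := fun i => norm_hat_sub_sub_le h (ξ i)
    refine (norm_mul_sub_sub_le (norm_wave _ _).le (norm_prod_hat_le s ξ m)
      (norm_prod_sub_prod_le' s hp hq h1) (norm_wave_sub_le (ξ j) x y)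
      (norm_wave_sub_sub_le (ξ j) x y) (norm_prod_sub_sub_le s hp hq h1 h2)).trans ?_
    have hs : 0 ≤ ∑ i ∈ s, 4 * Real.pi * ‖ξ i‖ * √(cost γ) :=
      Finset.sum_nonneg fun _ _ => by positivity
    refine pow_le_pow_left₀ (by positivity) ?_ 2
    rw [← Finset.sum_mul, mul_add]
    gcongr
    · exact Finset.single_le_sum (f := fun j => 4 * Real.pi * ‖ξ j‖)
        (fun _ _ => by positivity) (Finset.mem_univ j)
    · exact Finset.sum_le_sum_of_subset_of_nonneg (Finset.subset_univ _)
        fun _ _ _ => by positivity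
  · have := Real.sq_sqrt (cost_nonneg γ)
    have h2 : (‖x - y‖ + √(cost γ)) ^ 2 ≤ 2 * (‖x - y‖ ^ 2 + cost γ) := by
      nlinarith [sq_nonneg (‖x - y‖ - √(cost γ))]
    have hS := freqSize_nonneg ξ
    calc _ = ‖w‖ * freqSize ξ ^ 3 * (‖x - y‖ + √(cost γ)) ^ 2 := by ring
      _ ≤ ‖w‖ * freqSize ξ ^ 3 * (2 * (‖x - y‖ ^ 2 + cost γ)) := by gcongr
      _ = _ := by ring

/-- Differentiating a wave creates the factor `tau` and the vector ξ j of the gradient. Only the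
remainders of the individual waves survive, and their sum of squares is at most the square of the
sum. -/
lemma monomial_pot_exp (w : ℂ) (ξ : ι → E d) (m : P2 d) (x y : E d) :
    |monoPot w ξ m y - monoPot w ξ m x - inner ℝ (monoGrad w ξ m x) (y - x)|
      ≤ ‖w‖ * freqSize ξ ^ 2 * ‖x - y‖ ^ 2 := by
  have key : monoPot w ξ m y - monoPot w ξ m x - inner ℝ (monoGrad w ξ m x) (y - x) =
      ∑ j, (w * ((wave (ξ j) y - wave (ξ j) x -
        tau * (inner ℝ (ξ j) (y - x) : ℝ) * wave (ξ j) x) *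
          ∏ i ∈ Finset.univ.erase j, hat m (ξ i))).re := by
    rw [monoPot, monoPot, monoGrad, sum_inner, ← Finset.sum_sub_distrib,
      ← Finset.sum_sub_distrib]
    refine Finset.sum_congr rfl fun j _ => ?_
    rw [real_inner_smul_left, mul_comm (Complex.re _), ← Complex.re_ofReal_mul, ← Complex.sub_re,
      ← Complex.sub_re]
    congr 1
    ring
  rw [key]
  calc _ ≤ ∑ j, ‖w‖ * ‖x - y‖ ^ 2 * (4 * Real.pi * ‖ξ j‖) ^ 2 := by
        refine (Finset.abs_sum_le_sum_abs _ _).trans (Finset.sum_le_sum fun j _ => ?_)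
        refine (Complex.abs_re_le_norm _).trans ?_
        rw [norm_mul, norm_mul, mul_assoc ‖w‖]
        refine mul_le_mul_of_nonneg_left ?_ (norm_nonneg w)
        refine (mul_le_of_le_one_right (norm_nonneg _) (norm_prod_hat_le _ ξ m)).trans
          ((norm_wave_sub_sub_le _ _ _).trans (le_of_eq ?_))
        ring
    _ = ‖w‖ * ‖x - y‖ ^ 2 * ∑ j, (4 * Real.pi * ‖ξ j‖) ^ 2 := by rw [Finset.mul_sum]
    _ ≤ ‖w‖ * ‖x - y‖ ^ 2 * freqSize ξ ^ 2 := by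
        gcongr
        exact Finset.sum_sq_le_sq_sum_of_nonneg fun _ _ => by positivity
    _ = _ := by ring

lemma sum_sum_norm_le (ξ : ι → E d) (s : ι → Finset ι) (c : ι → ι → ℝ) {B : ℝ} (hB : 0 ≤ B)
    (hc : ∀ i j, |c j i| ≤ B * (2 * Real.pi) ^ 2) :
    ‖∑ j, ∑ i ∈ s j, c j i • InnerProductSpace.rankOne ℝ (ξ j) (ξ i)‖ ≤ B * freqSize ξ ^ 2 := by
  calc _ ≤ ∑ j, ∑ i ∈ s j, B * (2 * Real.pi) ^ 2 * (‖ξ j‖ * ‖ξ i‖) := by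
        refine norm_sum_le_of_le _ fun j _ => norm_sum_le_of_le _ fun i _ => ?_
        rw [norm_smul, InnerProductSpace.norm_rankOne, Real.norm_eq_abs]
        gcongr
        exact hc i j
    _ ≤ ∑ j, ∑ i, B * (2 * Real.pi) ^ 2 * (‖ξ j‖ * ‖ξ i‖) := by
        gcongr with j
        exact Finset.subset_univ _
    _ = B * (2 * Real.pi * ∑ j, ‖ξ j‖) ^ 2 := by
        simp_rw [← Finset.mul_sum]
        rw [← Finset.sum_mul]
        ring
    _ ≤ _ := by
        have : 0 ≤ ∑ j, ‖ξ j‖ := Finset.sum_nonneg fun _ _ => norm_nonneg _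
        gcongr
        exact sum_norm_le_freqSize ξ

lemma norm_monoHess₁_le (w : ℂ) (ξ : ι → E d) (m : P2 d) (x : E d) :
    ‖monoHess₁ w ξ m x‖ ≤ ‖w‖ * freqSize ξ ^ 2 := by
  have := sum_sum_norm_le ξ (fun j => {j}) (fun j _ => (w * tau ^ 2 *
    (wave (ξ j) x * ∏ i ∈ Finset.univ.erase j, hat m (ξ i))).re) (norm_nonneg w) fun i j => by
      refine (abs_re_mul_le (norm_wave_mul_prod_le _ ξ m _ x)).trans ?_
      rw [norm_mul, norm_pow, norm_tau]
  simpa [monoHess₁] using this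

lemma norm_monoHess₂_le (w : ℂ) (ξ : ι → E d) (m : P2 d) (p : E d × E d) :
    ‖monoHess₂ w ξ m p‖ ≤ ‖w‖ * freqSize ξ ^ 2 :=
  sum_sum_norm_le ξ _ _ (norm_nonneg w) fun i j => by
    refine (abs_re_mul_le ?_).trans ?_
    · simpa using norm_prod_hat_le _ ξ m
    · rw [norm_mul, norm_pow, norm_tau]

/-- The clauses cost powers of `freqSize` from 0 to 3. A single constant dominates them all; its
factor 2 comes from the gradient expansion. -/
theorem monomial_hasExpansion (w : ℂ) (ξ : ι → E d) :
    HasExpansion (monoVal w ξ) (monoGrad w ξ) (monoHess₁ w ξ) (monoHess₂ w ξ) (monoPot w ξ)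
      (2 * ‖w‖ * (1 + freqSize ξ) ^ 3) := by
  have hS := freqSize_nonneg ξ
  set S := freqSize ξ with hS'
  have hw := norm_nonneg w
  have h0 : ‖w‖ ≤ 2 * ‖w‖ * (1 + S) ^ 3 := by
    rw [mul_comm 2, mul_assoc]
    refine le_mul_of_one_le_right hw ?_
    nlinarith [pow_nonneg hS 2, pow_nonneg hS 3]
  have h1 : ‖w‖ * S ≤ 2 * ‖w‖ * (1 + S) ^ 3 := by
    rw [mul_comm 2, mul_assoc]
    refine mul_le_mul_of_nonneg_left ?_ hw
    nlinarith [pow_nonneg hS 2, pow_nonneg hS 3]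
  have h2 : ‖w‖ * S ^ 2 ≤ 2 * ‖w‖ * (1 + S) ^ 3 := by
    rw [mul_comm 2, mul_assoc]
    refine mul_le_mul_of_nonneg_left ?_ hw
    nlinarith [pow_nonneg hS 2, pow_nonneg hS 3]
  have h3 : 2 * (‖w‖ * S ^ 3) ≤ 2 * ‖w‖ * (1 + S) ^ 3 := by
    rw [← mul_assoc]
    refine mul_le_mul_of_nonneg_left ?_ (by positivity)
    nlinarith [pow_nonneg hS 2, pow_nonneg hS 3]
  have hwave := fun j => continuous_wave_right (ξ j)
  constructor
  · exact fun m => (abs_re_mul_le (norm_prod_hat_le _ ξ m)).trans h0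
  · intro m x
    have := norm_sum_smul_le w ξ (B := 1) _ fun j =>
      norm_wave_mul_prod_le (Finset.univ.erase j) ξ m (ξ j) x
    rw [mul_one] at this
    exact this.trans h1
  · exact fun m x => (norm_monoHess₁_le w ξ m x).trans h2
  · exact fun m p => (norm_monoHess₂_le w ξ m p).trans h2
  · intro m
    unfold monoHess₁
    fun_prop
  · intro m
    unfold monoHess₂
    fun_prop
  · simp [monoPot]
  · exact fun m x y => (monomial_pot_exp w ξ m x y).trans (by gcongr)
  · exact fun m ν γ h => (monomial_val_exp w ξ h).trans
      (mul_le_mul_of_nonneg_right h2 (cost_nonneg γ))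
  · exact fun m ν γ h x y => (monomial_grad_exp w ξ h x y).trans
      (mul_le_mul_of_nonneg_right h3 (add_nonneg (by positivity) (cost_nonneg γ)))

end Monomial

end

end WassersteinFourier

namespace WassersteinFourier

noncomputable section

variable {d : ℕ}

/-! ### Integrals of functionals with a second order expansion -/

lemma HasExpansion.const_nonneg {U : P2 d → ℝ} {g : P2 d → E d → E d}
    {A₁ : P2 d → E d → E d →L[ℝ] E d} {A₂ : P2 d → E d × E d → E d →L[ℝ] E d}
    {pot : P2 d → E d → ℝ} {K : ℝ} (h : HasExpansion U g A₁ A₂ pot K) (m : P2 d) : 0 ≤ K :=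
  (abs_nonneg _).trans (h.val_bound m)

lemma integrable_prod_of_le {Ω Z F : Type*} [MeasurableSpace Ω] [MeasurableSpace Z]
    [NormedAddCommGroup F] [MeasurableSpace F] [BorelSpace F] [SecondCountableTopology F]
    {π : Measure Ω} [SFinite π] {μ : Measure Z} [SFinite μ] {f : Ω → Z → F}
    (hf : Measurable (Function.uncurry f)) {b : Ω → ℝ} {K : Z → ℝ} (hb : Integrable b π)
    (hK : Integrable K μ) (hle : ∀ x z, ‖f x z‖ ≤ b x * K z) :
    Integrable (Function.uncurry f) (π.prod μ) :=
  (hb.mul_prod hK).mono' hf.aestronglyMeasurable (ae_of_all _ fun q => hle q.1 q.2)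

section Integral

variable {Z : Type*} [MeasurableSpace Z] {μ : Measure Z} [SFinite μ] {U : Z → P2 d → ℝ}
  {g : Z → P2 d → E d → E d} {A₁ : Z → P2 d → E d → E d →L[ℝ] E d}
  {A₂ : Z → P2 d → E d × E d → E d →L[ℝ] E d} {pot : Z → P2 d → E d → ℝ} {K : Z → ℝ}

/-- Every remainder is linear in the data and every bound is linear in K, so each clause can be
integrated in z. The joint measurability hypotheses allow Fubini between z and the transport plan.
-/
theorem HasExpansion.integral (h : ∀ z, HasExpansion (U z) (g z) (A₁ z) (A₂ z) (pot z) (K z))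
    (hK : Integrable K μ) (hU : ∀ m, Measurable fun z => U z m)
    (hg : ∀ m, Measurable fun q : Z × E d => g q.1 m q.2)
    (h₁ : ∀ m, Measurable fun q : Z × E d => A₁ q.1 m q.2)
    (h₂ : ∀ m, Measurable fun q : Z × (E d × E d) => A₂ q.1 m q.2)
    (hpot : ∀ m x, Measurable fun z => pot z m x) :
    HasExpansion (fun m => ∫ z, U z m ∂μ) (fun m x => ∫ z, g z m x ∂μ)
      (fun m x => ∫ z, A₁ z m x ∂μ) (fun m p => ∫ z, A₂ z m p ∂μ)
      (fun m x => ∫ z, pot z m x ∂μ) (∫ z, K z ∂μ) := by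
  have hgz : ∀ m x, Measurable fun z => g z m x := fun m x =>
    (hg m).comp (measurable_id.prodMk measurable_const)
  have h₁z : ∀ m x, Measurable fun z => A₁ z m x := fun m x =>
    (h₁ m).comp (measurable_id.prodMk measurable_const)
  have h₂z : ∀ m x, Measurable fun z => A₂ z m x := fun m x =>
    (h₂ m).comp (measurable_id.prodMk measurable_const)
  have iU : ∀ m, Integrable (fun z => U z m) μ := fun m =>
    hK.mono' (hU m).aestronglyMeasurable (ae_of_all _ fun z => (h z).val_bound m)
  have ig : ∀ m x, Integrable (fun z => g z m x) μ := fun m x =>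
    hK.mono' (hgz m x).aestronglyMeasurable (ae_of_all _ fun z => (h z).grad_bound m x)
  have i₁ : ∀ m x, Integrable (fun z => A₁ z m x) μ := fun m x =>
    hK.mono' (h₁z m x).aestronglyMeasurable (ae_of_all _ fun z => (h z).hess₁_bound m x)
  have i₂ : ∀ m x, Integrable (fun z => A₂ z m x) μ := fun m x =>
    hK.mono' (h₂z m x).aestronglyMeasurable (ae_of_all _ fun z => (h z).hess₂_bound m x)
  -- The normalization of the potentials at the origin is what makes them integrable in z: the
  -- expansion from 0 then controls the value itself and not only increments.
  have hpot_le : ∀ z m x, |pot z m x| ≤ K z * (‖x‖ + ‖x‖ ^ 2) := fun z m x => by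
    have e := (h z).pot_exp m 0 x
    rw [(h z).pot_zero, sub_zero, sub_zero, zero_sub, norm_neg] at e
    have e2 : |inner ℝ (g z m 0) x| ≤ K z * ‖x‖ := (abs_real_inner_le_norm _ _).trans
      (mul_le_mul_of_nonneg_right ((h z).grad_bound m 0) (norm_nonneg x))
    calc |pot z m x| = |(pot z m x - inner ℝ (g z m 0) x) + inner ℝ (g z m 0) x| := by ring_nf
      _ ≤ _ := (abs_add_le _ _).trans (add_le_add e e2)
      _ = _ := by ring
  have ipot : ∀ m x, Integrable (fun z => pot z m x) μ := fun m x =>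
    (hK.mul_const _).mono' (hpot m x).aestronglyMeasurable (ae_of_all _ fun z => hpot_le z m x)
  constructor
  · intro m
    rw [← Real.norm_eq_abs]
    exact norm_integral_le_of_norm_le hK (ae_of_all _ fun z => (h z).val_bound m)
  · exact fun m x => norm_integral_le_of_norm_le hK (ae_of_all _ fun z => (h z).grad_bound m x)
  · exact fun m x => norm_integral_le_of_norm_le hK (ae_of_all _ fun z => (h z).hess₁_bound m x)
  · exact fun m x => norm_integral_le_of_norm_le hK (ae_of_all _ fun z => (h z).hess₂_bound m x)
  · exact fun m => continuous_of_dominated (fun x => (h₁z m x).aestronglyMeasurable)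
      (fun x => ae_of_all _ fun z => (h z).hess₁_bound m x) hK
      (ae_of_all _ fun z => (h z).hess₁_cont m)
  · exact fun m => continuous_of_dominated (fun x => (h₂z m x).aestronglyMeasurable)
      (fun x => ae_of_all _ fun z => (h z).hess₂_bound m x) hK
      (ae_of_all _ fun z => (h z).hess₂_cont m)
  · intro m
    simp [(h _).pot_zero]
  · intro m x y
    rw [real_inner_comm, ← integral_inner (ig m x), ← integral_sub (ipot m y) (ipot m x),
      ← integral_sub (f := fun z => pot z m y - pot z m x) ((ipot m y).sub (ipot m x))
        ((ig m x).const_inner _), ← integral_mul_const, ← Real.norm_eq_abs]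
    refine norm_integral_le_of_norm_le (hK.mul_const _) (ae_of_all _ fun z => ?_)
    rw [real_inner_comm]
    exact (h z).pot_exp m x y
  · intro m ν γ hγ
    have := isProbabilityMeasure_of_mem_plans hγ
    have hint : Integrable (Function.uncurry fun (p : E d × E d) z =>
        (inner ℝ (g z m p.1) (p.2 - p.1) : ℝ)) (γ.prod μ) := by
      refine integrable_prod_of_le (b := fun p => ‖p.1 - p.2‖) ?_ (integrable_norm_sub hγ) hK
        fun p z => ?_
      · have := (hg m).comp (measurable_snd.prodMk measurable_fst.fst :
          Measurable fun q : (E d × E d) × Z => (q.2, q.1.1))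
        exact this.inner (measurable_fst.snd.sub measurable_fst.fst)
      · rw [mul_comm, norm_sub_rev]
        exact (norm_inner_le_norm _ _).trans
          (mul_le_mul_of_nonneg_right ((h z).grad_bound m _) (norm_nonneg _))
    have hint' : Integrable (fun z => ∫ p, (inner ℝ (g z m p.1) (p.2 - p.1) : ℝ) ∂γ) μ :=
      hint.integral_prod_right
    have e : ∫ p, (inner ℝ (∫ z, g z m p.1 ∂μ) (p.2 - p.1) : ℝ) ∂γ =
        ∫ z, ∫ p, (inner ℝ (g z m p.1) (p.2 - p.1) : ℝ) ∂γ ∂μ := by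
      rw [← integral_integral_swap hint]
      refine integral_congr_ae (ae_of_all _ fun p => ?_)
      simp only
      rw [real_inner_comm, ← integral_inner (ig m p.1)]
      simp_rw [real_inner_comm]
    rw [e, ← integral_sub (iU ν) (iU m),
      ← integral_sub (f := fun z => U z ν - U z m) ((iU ν).sub (iU m)) hint',
      ← integral_mul_const, ← Real.norm_eq_abs]
    exact norm_integral_le_of_norm_le (hK.mul_const _)
      (ae_of_all _ fun z => (h z).val_exp m ν γ hγ)
  · intro m ν γ hγ x y
    have := isProbabilityMeasure_of_mem_plans hγ
    have hint : Integrable (Function.uncurry fun (p : E d × E d) z =>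
        A₂ z m (x, p.1) (p.2 - p.1)) (γ.prod μ) := by
      refine integrable_prod_of_le (b := fun p => ‖p.1 - p.2‖) ?_ (integrable_norm_sub hγ) hK
        fun p z => ?_
      · have := (h₂ m).comp (measurable_snd.prodMk (measurable_const.prodMk measurable_fst.fst) :
          Measurable fun q : (E d × E d) × Z => (q.2, (x, q.1.1)))
        exact isBoundedBilinearMap_apply.continuous.measurable.comp
          (this.prodMk (measurable_fst.snd.sub measurable_fst.fst))
      · rw [mul_comm, norm_sub_rev]
        exact ((A₂ z m (x, p.1)).le_opNorm _).trans
          (mul_le_mul_of_nonneg_right ((h z).hess₂_bound m _) (norm_nonneg _))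
    have hint' : Integrable (fun z => ∫ p, A₂ z m (x, p.1) (p.2 - p.1) ∂γ) μ :=
      hint.integral_prod_right
    have e : ∫ p, (∫ z, A₂ z m (x, p.1) ∂μ) (p.2 - p.1) ∂γ =
        ∫ z, ∫ p, A₂ z m (x, p.1) (p.2 - p.1) ∂γ ∂μ := by
      rw [← integral_integral_swap hint]
      refine integral_congr_ae (ae_of_all _ fun p => ?_)
      simp only
      rw [ContinuousLinearMap.integral_apply (i₂ m _)]
    rw [e, ContinuousLinearMap.integral_apply (i₁ m x), ← integral_sub (ig ν y) (ig m x),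
      ← integral_add ((i₁ m x).apply_continuousLinearMap _) hint',
      ← integral_sub (f := fun z => g z ν y - g z m x)
        (g := fun z => A₁ z m x (y - x) + ∫ p, A₂ z m (x, p.1) (p.2 - p.1) ∂γ) ((ig ν y).sub (ig m x))
        (((i₁ m x).apply_continuousLinearMap _).add hint'),
      ← integral_mul_const]
    exact norm_integral_le_of_norm_le (hK.mul_const _)
      (ae_of_all _ fun z => (h z).grad_exp m ν γ hγ x y)

end Integral

end

end WassersteinFourier

namespace WassersteinFourier

noncomputable section

variable {d : ℕ}

/-! ### Optimal plans and the subdifferential -/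

lemma W2_nonneg (m ν : P2 d) : 0 ≤ W2 m ν := Real.sqrt_nonneg _

lemma W2_sq_eq_cost {m ν : P2 d} {γ : Measure (E d × E d)} (h : γ ∈ optPlans m ν) :
    W2 m ν ^ 2 = cost γ := h.2

lemma W2_eq_sqrt_cost {m ν : P2 d} {γ : Measure (E d × E d)} (h : γ ∈ optPlans m ν) :
    W2 m ν = √(cost γ) := by
  rw [← W2_sq_eq_cost h, Real.sqrt_sq (W2_nonneg m ν)]

/-- The displacement of a plan, as an element of `L²(γ)`. -/
def displacement {m ν : P2 d} {γ : Measure (E d × E d)} (h : γ ∈ plans m ν) : Lp (E d) 2 γ :=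
  (memLp_displacement h).toLp _

/-- The pullback of a vector field under the first marginal of a plan. -/
def pullFst {m ν : P2 d} {γ : Measure (E d × E d)} (h : γ ∈ plans m ν) :
    L2 m →ₗᵢ[ℝ] Lp (E d) 2 γ :=
  Lp.compMeasurePreservingₗᵢ ℝ Prod.fst (measurePreserving_fst_of_mem_plans h)

/-! ### Pairing of vector fields with displacements in L²(γ) -/

section Pairing

variable {m ν : P2 d} {γ : Measure (E d × E d)}

lemma integral_inner_displacement (h : γ ∈ plans m ν) (ζ : L2 m) :
    ∫ p, inner ℝ (ζ p.1) (p.2 - p.1) ∂γ = inner ℝ (pullFst h ζ) (displacement h) := by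
  rw [L2.inner_def]
  refine integral_congr_ae ?_
  filter_upwards [Lp.coeFn_compMeasurePreserving ζ (measurePreserving_fst_of_mem_plans h),
    (memLp_displacement h).coeFn_toLp] with p h1 h2
  change _ = inner ℝ ((Lp.compMeasurePreserving Prod.fst _ ζ : Lp (E d) 2 γ) p)
    (((memLp_displacement h).toLp _ : Lp (E d) 2 γ) p)
  rw [h1, h2, Function.comp]

lemma norm_displacement_sq (h : γ ∈ plans m ν) : ‖displacement h‖ ^ 2 = cost γ := by
  rw [← real_inner_self_eq_norm_sq, L2.inner_def, cost]
  refine integral_congr_ae ?_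
  filter_upwards [(memLp_displacement h).coeFn_toLp] with p h2
  rw [displacement, h2, real_inner_self_eq_norm_sq, norm_sub_rev]

lemma norm_displacement_of_optPlans (h : γ ∈ optPlans m ν) : ‖displacement h.1‖ = W2 m ν := by
  refine Eq.trans ?_ (W2_eq_sqrt_cost h).symm
  rw [← norm_displacement_sq h.1, Real.sqrt_sq (norm_nonneg _)]

lemma integral_inner_displacement_congr (h : γ ∈ plans m ν) {ζ ζ' : E d → E d}
    (hζ : ζ =ᵐ[m.meas] ζ') :
    ∫ p, inner ℝ (ζ p.1) (p.2 - p.1) ∂γ = ∫ p, inner ℝ (ζ' p.1) (p.2 - p.1) ∂γ := by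
  refine integral_congr_ae ?_
  filter_upwards [(measurePreserving_fst_of_mem_plans h).quasiMeasurePreserving.ae_eq_comp hζ]
    with p hp
  simp only [Function.comp] at hp
  rw [hp]

end Pairing

lemma convex_subdiff (U : P2 d → ℝ) (m : P2 d) : Convex ℝ (subdiff U m) := by
  intro ζ hζ η hη a b ha hb hab ε hε
  obtain ⟨δ₁, hδ₁, h₁⟩ := hζ ε hε
  obtain ⟨δ₂, hδ₂, h₂⟩ := hη ε hε
  refine ⟨min δ₁ δ₂, lt_min hδ₁ hδ₂, fun ν hν γ hγ => ?_⟩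
  have e₁ := h₁ ν (hν.trans_le (min_le_left _ _)) γ hγ
  have e₂ := h₂ ν (hν.trans_le (min_le_right _ _)) γ hγ
  rw [integral_inner_displacement hγ.1] at e₁ e₂ ⊢
  rw [map_add, map_smul, map_smul, inner_add_left, real_inner_smul_left, real_inner_smul_left]
  have := add_le_add (mul_le_mul_of_nonneg_left e₁ ha) (mul_le_mul_of_nonneg_left e₂ hb)
  have e : a * (U ν - U m) + b * (U ν - U m) = U ν - U m := by rw [← add_mul, hab, one_mul]
  have e' : a * (ε * W2 m ν) + b * (ε * W2 m ν) = ε * W2 m ν := by rw [← add_mul, hab, one_mul]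
  linarith

/-- The displacement of an optimal plan has norm exactly W₂, so replacing ζ by a field at distance
less than ε/2 changes the pairing by at most (ε/2) W₂. -/
lemma isClosed_subdiff (U : P2 d → ℝ) (m : P2 d) : IsClosed (subdiff U m) := by
  refine isClosed_of_closure_subset fun ζ hζ ε hε => ?_
  obtain ⟨η, hη, hd⟩ := Metric.mem_closure_iff.1 hζ (ε / 2) (by positivity)
  obtain ⟨δ, hδ, h⟩ := hη (ε / 2) (by positivity)
  refine ⟨δ, hδ, fun ν hν γ hγ => ?_⟩
  have e := h ν hν γ hγ
  rw [integral_inner_displacement hγ.1] at e ⊢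
  have : inner ℝ (pullFst hγ.1 ζ) (displacement hγ.1) -
      inner ℝ (pullFst hγ.1 η) (displacement hγ.1) ≤ ε / 2 * W2 m ν := by
    rw [← inner_sub_left, ← map_sub]
    refine (real_inner_le_norm _ _).trans ?_
    rw [norm_displacement_of_optPlans hγ, LinearIsometry.norm_map, ← dist_eq_norm]
    exact mul_le_mul_of_nonneg_right hd.le (W2_nonneg _ _)
  linarith

/-- The minimizer is the projection of 0 onto a closed convex set in a Hilbert space. Hence `wGrad`
takes its default value only when the subdifferential is empty. -/
lemma exists_min_subdiff {U : P2 d → ℝ} {m : P2 d} (h : (subdiff U m).Nonempty) :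
    ∃ ζ ∈ subdiff U m, ∀ η ∈ subdiff U m, ‖ζ‖ ≤ ‖η‖ := by
  obtain ⟨ζ, hζ, hmin⟩ := exists_norm_eq_iInf_of_complete_convex h
    (isClosed_subdiff U m).isComplete (convex_subdiff U m) 0
  refine ⟨ζ, hζ, fun η hη => ?_⟩
  rw [zero_sub, norm_neg] at hmin
  rw [hmin]
  refine (ciInf_le ⟨0, ?_⟩ (⟨η, hη⟩ : subdiff U m)).trans (by simp)
  rintro _ ⟨w, rfl⟩
  exact norm_nonneg _

lemma wGrad_mem {U : P2 d → ℝ} {m : P2 d} (h : (subdiff U m).Nonempty) :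
    wGrad U m ∈ subdiff U m := by
  have h' := exists_min_subdiff h
  rw [wGrad, dif_pos h']
  exact h'.choose_spec.1

lemma norm_wGrad_le {U : P2 d → ℝ} {m : P2 d} {η : L2 m} (hη : η ∈ subdiff U m) :
    ‖wGrad U m‖ ≤ ‖η‖ := by
  have h' := exists_min_subdiff ⟨η, hη⟩
  rw [wGrad, dif_pos h']
  exact h'.choose_spec.2 η hη

/-! ### Perturbations by gradients -/

/-- Bounded continuous fields which are gradients of functions with a quadratic Taylor
remainder. -/
def IsGradientField (g : E d → E d) : Prop :=
  Continuous g ∧ (∃ B, ∀ x, ‖g x‖ ≤ B) ∧ ∃ (pot : E d → ℝ) (K : ℝ), 0 ≤ K ∧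
    ∀ x y, |pot y - pot x - inner ℝ (g x) (y - x)| ≤ K * ‖x - y‖ ^ 2

lemma memLp_of_continuous_of_bound (m : P2 d) {g : E d → E d} (hg : Continuous g) {B : ℝ}
    (hB : ∀ x, ‖g x‖ ≤ B) : MemLp g 2 m.meas :=
  MemLp.of_bound hg.aestronglyMeasurable B (ae_of_all _ hB)

lemma IsGradientField.memLp {g : E d → E d} (hg : IsGradientField g) (m : P2 d) :
    MemLp g 2 m.meas :=
  memLp_of_continuous_of_bound m hg.1 hg.2.1.choose_spec

/-- The image of `m` under a map preserving finite second moments. -/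
def P2.push (m : P2 d) (T : E d → E d) (hT : MemLp T 2 m.meas) : P2 d :=
  ⟨⟨m.meas.map T, Measure.isProbabilityMeasure_map hT.1.aemeasurable⟩,
    (memLp_map_measure_iff aestronglyMeasurable_id hT.1.aemeasurable).2 hT⟩

lemma map_prodMk_mem_plans (m : P2 d) {T : E d → E d} (hT : MemLp T 2 m.meas)
    (hTm : Measurable T) : m.meas.map (fun x => (x, T x)) ∈ plans m (m.push T hT) := by
  have hm : Measurable fun x => (x, T x) := measurable_id.prodMk hTm
  constructor
  · rw [Measure.map_map measurable_fst hm]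
    exact Measure.map_id
  · rw [Measure.map_map measurable_snd hm]
    rfl

/-- The remainder squeezes the potential near each point and, applied from the origin, gives
quadratic growth, which the second moment of m absorbs. -/
lemma integrable_of_quadratic_remainder (m : P2 d) {g : E d → E d} {pot : E d → ℝ} {K : ℝ}
    (hpot : ∀ x y, |pot y - pot x - inner ℝ (g x) (y - x)| ≤ K * ‖x - y‖ ^ 2) :
    Continuous pot ∧ Integrable pot m.meas := by
  have hc : Continuous pot := by
    rw [continuous_iff_continuousAt]
    intro x
    have h1 : Tendsto (fun y => pot x + inner ℝ (g x) (y - x) - K * ‖x - y‖ ^ 2) (𝓝 x)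
        (𝓝 (pot x)) := by
      have : Continuous fun y => pot x + inner ℝ (g x) (y - x) - K * ‖x - y‖ ^ 2 := by fun_prop
      simpa using this.tendsto x
    have h2 : Tendsto (fun y => pot x + inner ℝ (g x) (y - x) + K * ‖x - y‖ ^ 2) (𝓝 x)
        (𝓝 (pot x)) := by
      have : Continuous fun y => pot x + inner ℝ (g x) (y - x) + K * ‖x - y‖ ^ 2 := by fun_prop
      simpa using this.tendsto x
    refine tendsto_of_tendsto_of_tendsto_of_le_of_le h1 h2 (fun y => ?_) fun y => ?_
    · have := (abs_le.1 (hpot x y)).1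
      simp only
      linarith
    · have := (abs_le.1 (hpot x y)).2
      simp only
      linarith
  refine ⟨hc, ?_⟩
  have i1 : Integrable (fun x : E d => ‖x‖) m.meas := ((memLp_id m).integrable (by norm_num)).norm
  have i2 : Integrable (fun x : E d => ‖x‖ ^ 2) m.meas :=
    (memLp_id m).integrable_norm_pow (p := 2) (by norm_num)
  refine ((integrable_const |pot 0|).add ((i1.const_mul ‖g 0‖).add (i2.const_mul K))).mono'
    hc.aestronglyMeasurable (ae_of_all _ fun x => ?_)
  have h := hpot 0 x
  rw [sub_zero, zero_sub, norm_neg] at h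
  have h2 := abs_real_inner_le_norm (g 0) x
  simp only [Pi.add_apply, Real.norm_eq_abs]
  calc |pot x| = |pot 0 + (inner ℝ (g 0) x + (pot x - pot 0 - inner ℝ (g 0) x))| := by ring_nf
    _ ≤ _ := (abs_add_le _ _).trans (add_le_add le_rfl ((abs_add_le _ _).trans (add_le_add h2 h)))

/-- Kantorovich duality with an explicit certificate. With T = id + t g, take φ(x) = -2t pot(x) and
ψ(T z) = 2t pot(z) + ‖t g(z)‖². For small t, φ(x) + ψ(T z) ≤ ‖x - T z‖², with equality when x = z,
so no plan between the same marginals costs less than the graph of T. -/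
lemma map_mem_optPlans (m : P2 d) {g : E d → E d} {pot : E d → ℝ} {K t : ℝ} (hg : Continuous g)
    (hgm : MemLp g 2 m.meas) (ht : 4 * (|t| * K) ≤ 1)
    (hpot : ∀ x y, |pot y - pot x - inner ℝ (g x) (y - x)| ≤ K * ‖x - y‖ ^ 2)
    (hT : MemLp (fun x => x + t • g x) 2 m.meas) :
    m.meas.map (fun x => (x, x + t • g x)) ∈ optPlans m (m.push (fun x => x + t • g x) hT) := by
  set T : E d → E d := fun x => x + t • g x with hTdef
  have hTc : Continuous T := by fun_prop
  have hγ := map_prodMk_mem_plans m hT hTc.measurable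
  refine ⟨hγ, ?_⟩
  obtain ⟨hpc, hpi⟩ := integrable_of_quadratic_remainder m hpot
  have hcost : cost (m.meas.map (fun x => (x, T x))) = ∫ x, ‖t • g x‖ ^ 2 ∂m.meas := by
    rw [cost, integral_map (by fun_prop) (by fun_prop)]
    simp [hTdef]
  have htsub : ∀ x z, |t * (pot x - pot z - inner ℝ (g z) (x - z))| ≤ 1 / 4 * ‖x - z‖ ^ 2 := by
    intro x z
    rw [abs_mul, norm_sub_rev x z]
    calc |t| * _ ≤ |t| * (K * ‖z - x‖ ^ 2) := by gcongr; exact hpot z x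
      _ = (|t| * K) * ‖z - x‖ ^ 2 := by ring
      _ ≤ _ := by gcongr; linarith
  -- The second dual potential is prescribed at T z, so it is well defined only if T is injective.
  -- If T z = T z', the expansions of the potential at z and at z' together bound ‖z - z'‖² by half
  -- of itself.
  have hinj : Function.Injective T := by
    intro z z' hz
    have e : z - z' = t • (g z' - g z) := by
      simp only [hTdef] at hz
      rw [smul_sub, sub_eq_sub_iff_add_eq_add, hz]
      abel
    have h1 := (abs_le.1 (htsub z z')).1
    have h2 := (abs_le.1 (htsub z' z)).1
    have e2 : ‖z - z'‖ ^ 2 = t * inner ℝ (g z') (z - z') + t * inner ℝ (g z) (z' - z) := by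
      rw [← real_inner_self_eq_norm_sq]
      nth_rewrite 1 [e]
      rw [real_inner_smul_left, inner_sub_left, ← neg_sub z z', inner_neg_right]
      ring
    rw [norm_sub_rev z' z] at h2
    have : ‖z - z'‖ ^ 2 ≤ 0 := by nlinarith
    exact sub_eq_zero.1 (norm_eq_zero.1 (pow_eq_zero_iff (two_ne_zero) |>.1
      (le_antisymm this (sq_nonneg _))))
  have hemb : MeasurableEmbedding T := hTc.measurableEmbedding hinj
  -- H is the second dual potential, extended measurably off the range of T, where its values play
  -- no role.
  obtain ⟨H, hHm, hH⟩ := hemb.exists_measurable_extend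
    (g := fun z => 2 * t * pot z + ‖t • g z‖ ^ 2) (by fun_prop) fun _ => ⟨0⟩
  have hineq : ∀ x z, -(2 * t) * pot x + H (T z) ≤ ‖x - T z‖ ^ 2 := by
    intro x z
    have e : H (T z) = 2 * t * pot z + ‖t • g z‖ ^ 2 := congrFun hH z
    have h1 := (abs_le.1 (htsub x z)).1
    have e2 : ‖x - T z‖ ^ 2 =
        ‖x - z‖ ^ 2 - 2 * (t * inner ℝ (g z) (x - z)) + ‖t • g z‖ ^ 2 := by
      rw [show x - T z = (x - z) - t • g z by simp only [hTdef]; abel, norm_sub_sq_real,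
        real_inner_smul_right, real_inner_comm]
    rw [e, e2]
    nlinarith [sq_nonneg ‖x - z‖]
  have hgi : Integrable (fun x => ‖t • g x‖ ^ 2) m.meas :=
    (hgm.const_smul t).integrable_norm_pow (p := 2) (by norm_num)
  have hmin : IsLeast ((fun γ : Measure (E d × E d) => ∫ p, ‖p.1 - p.2‖ ^ 2 ∂γ) ''
      plans m (m.push T hT)) (cost (m.meas.map (fun x => (x, T x)))) := by
    refine ⟨⟨_, hγ, rfl⟩, ?_⟩
    rintro _ ⟨γ', hγ', rfl⟩
    have hsnd := measurePreserving_snd_of_mem_plans hγ'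
    have hHT : Integrable (fun z => H (T z)) m.meas := by
      have : (fun z => H (T z)) = fun z => 2 * t * pot z + ‖t • g z‖ ^ 2 := hH
      rw [this]
      exact (hpi.const_mul _).add hgi
    have hHi : Integrable H (m.push T hT).meas :=
      (integrable_map_measure hHm.aestronglyMeasurable hTc.aemeasurable).2 hHT
    have hHγ : Integrable (fun p : E d × E d => H p.2) γ' := hsnd.integrable_comp_of_integrable hHi
    have hpγ : Integrable (fun p : E d × E d => pot p.1) γ' :=
      (measurePreserving_fst_of_mem_plans hγ').integrable_comp_of_integrable hpi
    -- The dual inequality is available only on the range of T, which carries the second marginal of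
    -- every competitor.
    have hrange : ∀ᵐ p ∂γ', p.2 ∈ Set.range T := by
      have : ∀ᵐ y ∂(m.push T hT).meas, y ∈ Set.range T :=
        (ae_map_iff hTc.aemeasurable hemb.measurableSet_range).2 (ae_of_all _ fun z => ⟨z, rfl⟩)
      exact hsnd.quasiMeasurePreserving.ae this
    have e1 : ∫ p : E d × E d, pot p.1 ∂γ' = ∫ x, pot x ∂m.meas := by
      rw [← hγ'.1, integral_map measurable_fst.aemeasurable hpc.aestronglyMeasurable]
    have e2 : ∫ p : E d × E d, H p.2 ∂γ' = ∫ z, H (T z) ∂m.meas := by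
      have : ∫ y, H y ∂(m.push T hT).meas = ∫ z, H (T z) ∂m.meas :=
        integral_map hTc.aemeasurable hHm.aestronglyMeasurable
      rw [← this, ← hγ'.2, integral_map measurable_snd.aemeasurable hHm.aestronglyMeasurable]
    have e3 : ∫ z, H (T z) ∂m.meas = 2 * t * ∫ x, pot x ∂m.meas + ∫ x, ‖t • g x‖ ^ 2 ∂m.meas := by
      have : (fun z => H (T z)) = fun z => 2 * t * pot z + ‖t • g z‖ ^ 2 := hH
      rw [this, integral_add (hpi.const_mul _) hgi, integral_const_mul]
    have : ∫ p : E d × E d, (-(2 * t) * pot p.1 + H p.2) ∂γ' ≤ ∫ p, ‖p.1 - p.2‖ ^ 2 ∂γ' := by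
      refine integral_mono_ae ((hpγ.const_mul _).add hHγ) (integrable_cost hγ') ?_
      filter_upwards [hrange] with p ⟨z, hz⟩
      rw [← hz]
      exact hineq p.1 z
    rw [integral_add (hpγ.const_mul _) hHγ, integral_const_mul] at this
    rw [e1, e2, e3] at this
    rw [hcost]
    simp only
    linarith
  rw [W2, hmin.csInf_eq, Real.sq_sqrt (cost_nonneg _), cost]

lemma exists_perturbation (m : P2 d) {g : E d → E d} (hg : IsGradientField g) :
    ∃ s > 0, ∀ t : ℝ, |t| ≤ s → ∃ ν : P2 d, ∃ γ ∈ optPlans m ν,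
      W2 m ν = |t| * ‖(hg.memLp m).toLp g‖ ∧
      ∀ ζ : L2 m, ∫ p, inner ℝ (ζ p.1) (p.2 - p.1) ∂γ =
        t * inner ℝ ζ ((hg.memLp m).toLp g) := by
  have hgm := hg.memLp m
  obtain ⟨hgc, -, pot, K, hK, hpot⟩ := id hg
  -- The smallness 4|t|K ≤ 1 required for optimality; adding 1 to K covers K = 0.
  refine ⟨1 / (4 * (K + 1)), by positivity, fun t ht => ?_⟩
  have ht' : 4 * (|t| * K) ≤ 1 := by
    rw [le_div_iff₀ (by positivity)] at ht
    nlinarith [abs_nonneg t]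
  have hT : MemLp (fun x => x + t • g x) 2 m.meas := (memLp_id m).add (hgm.const_smul t)
  have hγ := map_mem_optPlans m hgc hgm ht' hpot hT
  refine ⟨_, _, hγ, ?_, fun ζ => ?_⟩
  · rw [W2_eq_sqrt_cost hγ, cost, integral_map (by fun_prop) (by fun_prop)]
    have : ∫ x, ‖(x, x + t • g x).1 - (x, x + t • g x).2‖ ^ 2 ∂m.meas =
        (|t| * ‖hgm.toLp g‖) ^ 2 := by
      rw [mul_pow, ← real_inner_self_eq_norm_sq, L2.inner_def, ← integral_const_mul]
      refine integral_congr_ae ?_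
      filter_upwards [hgm.coeFn_toLp] with x hx
      rw [hx, real_inner_self_eq_norm_sq]
      simp [norm_smul, mul_pow]
    rw [this, Real.sqrt_sq (by positivity)]
  · have hmp : MeasurePreserving (fun x => (x, x + t • g x)) m.meas
      (m.meas.map (fun x => (x, x + t • g x))) := ⟨by fun_prop, rfl⟩
    rw [integral_map (by fun_prop), L2.inner_def, ← integral_const_mul]
    · refine integral_congr_ae ?_
      filter_upwards [hgm.coeFn_toLp] with x hx
      rw [hx, add_sub_cancel_left, real_inner_smul_right]
    · have h1 : AEStronglyMeasurable (fun p : E d × E d => ζ p.1)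
          (m.meas.map (fun x => (x, x + t • g x))) :=
        (Lp.aestronglyMeasurable ζ).comp_measurePreserving
          (measurePreserving_fst_of_mem_plans hγ.1)
      exact h1.inner (by fun_prop)

/-- Push m by id ± r g. Along these optimal plans the pairings are exactly ± r times the inner
products with g, while the errors are o(r). Comparing the lower bound from η with the upper bound
from Z, for both signs, forces equality. -/
theorem inner_eq_of_mem_subdiff_of_mem_superdiff {U : P2 d → ℝ} {m : P2 d} {η Z : L2 m}
    (hη : η ∈ subdiff U m) (hZ : Z ∈ superdiff U m) {g : E d → E d} (hg : IsGradientField g) :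
    inner ℝ η ((hg.memLp m).toLp g) = inner ℝ Z ((hg.memLp m).toLp g) := by
  set G := (hg.memLp m).toLp g
  obtain ⟨s, hs, hpert⟩ := exists_perturbation m hg
  have key : ∀ ε > 0, |(inner ℝ η G - inner ℝ Z G : ℝ)| ≤ ε * (2 * ‖G‖) := by
    intro ε hε
    obtain ⟨δ₁, hδ₁, h₁⟩ := hη ε hε
    obtain ⟨δ₂, hδ₂, h₂⟩ := hZ ε hε
    -- One radius at which the displacement is optimal and r‖G‖, the distance W₂ travelled, lies
    -- below both thresholds.
    obtain ⟨r, hr, hrs, hr1, hr2⟩ : ∃ r > 0, r ≤ s ∧ r * ‖G‖ < δ₁ ∧ r * ‖G‖ < δ₂ := by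
      have hc : Tendsto (fun r : ℝ => r * ‖G‖) (𝓝[>] 0) (𝓝 0) := by
        have : Continuous fun r : ℝ => r * ‖G‖ := by fun_prop
        simpa using (this.tendsto 0).mono_left nhdsWithin_le_nhds
      have := ((hc.eventually_lt_const hδ₁).and (hc.eventually_lt_const hδ₂)).and
        (((eventually_le_nhds hs).filter_mono nhdsWithin_le_nhds).and
          (self_mem_nhdsWithin : Set.Ioi (0 : ℝ) ∈ 𝓝[>] 0))
      obtain ⟨r, ⟨h1, h2⟩, h3, h4⟩ := this.exists
      exact ⟨r, h4, h3, h1, h2⟩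
    have main : ∀ t : ℝ, |t| = r → t * (inner ℝ η G - inner ℝ Z G) ≤ r * (ε * (2 * ‖G‖)) := by
      intro t ht
      obtain ⟨ν, γ, hγ, hW, hint⟩ := hpert t (ht.le.trans hrs)
      rw [ht] at hW
      have e₁ := h₁ ν (hW ▸ hr1) γ hγ
      have e₂ := h₂ ν (hW ▸ hr2) γ hγ
      rw [hint, hW] at e₁ e₂
      rw [inner_neg_left] at e₂
      nlinarith
    have a := main r (abs_of_pos hr)
    have b := main (-r) (by rw [abs_neg, abs_of_pos hr])
    rw [abs_le]
    constructor
    · refine le_of_mul_le_mul_left (?_ : r * _ ≤ r * _) hr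
      linarith
    · exact le_of_mul_le_mul_left a hr
  have : |(inner ℝ η G - inner ℝ Z G : ℝ)| ≤ 0 := by
    refine le_of_forall_pos_le_add fun ε hε => ?_
    have := key (ε / (2 * ‖G‖ + 1)) (by positivity)
    refine this.trans ?_
    rw [zero_add, div_mul_eq_mul_div, div_le_iff₀ (by positivity)]
    nlinarith
  exact sub_eq_zero.1 (abs_eq_zero.1 (le_antisymm this (abs_nonneg _)))

/-- The minimal subgradient has inner product ‖G‖² with G and norm at most ‖G‖. Expanding the square
of their difference gives 0. -/
theorem wGrad_eq_of_isGradientField {U : P2 d → ℝ} {m : P2 d} {g : E d → E d}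
    (hg : IsGradientField g) (hsub : (hg.memLp m).toLp g ∈ subdiff U m)
    (hsup : (hg.memLp m).toLp g ∈ superdiff U m) : wGrad U m = (hg.memLp m).toLp g := by
  have h1 := inner_eq_of_mem_subdiff_of_mem_superdiff (wGrad_mem ⟨_, hsub⟩) hsup hg
  have h2 := norm_wGrad_le hsub
  set G := (hg.memLp m).toLp g
  rw [real_inner_self_eq_norm_sq] at h1
  have h3 : ‖wGrad U m - G‖ ^ 2 ≤ 0 := by
    rw [norm_sub_sq_real, h1]
    nlinarith [pow_le_pow_left₀ (norm_nonneg _) h2 2]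
  exact sub_eq_zero.1 (norm_eq_zero.1 (pow_eq_zero_iff two_ne_zero |>.1
    (le_antisymm h3 (sq_nonneg _))))

lemma mem_subdiff_of_expansion {U : P2 d → ℝ} {m : P2 d} {Z : E d → E d} (hZ : MemLp Z 2 m.meas)
    {K : ℝ} (h : ∀ ν, ∀ γ ∈ plans m ν,
      -(K * cost γ) ≤ U ν - U m - ∫ p, inner ℝ (Z p.1) (p.2 - p.1) ∂γ) :
    hZ.toLp Z ∈ subdiff U m := by
  intro ε hε
  -- For an optimal plan the cost is W₂², so below this radius K * cost is at most ε W₂.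
  refine ⟨ε / (|K| + 1), by positivity, fun ν hν γ hγ => ?_⟩
  have e := h ν γ hγ.1
  rw [integral_inner_displacement_congr hγ.1 hZ.coeFn_toLp]
  have : K * cost γ ≤ ε * W2 m ν := by
    rw [← W2_sq_eq_cost hγ, sq, ← mul_assoc]
    refine mul_le_mul_of_nonneg_right ?_ (W2_nonneg _ _)
    rw [lt_div_iff₀ (by positivity)] at hν
    nlinarith [le_abs_self K, W2_nonneg m ν]
  linarith

lemma mem_superdiff_of_expansion {U : P2 d → ℝ} {m : P2 d} {Z : E d → E d}
    (hZ : MemLp Z 2 m.meas) {K : ℝ} (h : ∀ ν, ∀ γ ∈ plans m ν,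
      U ν - U m - ∫ p, inner ℝ (Z p.1) (p.2 - p.1) ∂γ ≤ K * cost γ) :
    hZ.toLp Z ∈ superdiff U m := by
  have : -(hZ.toLp Z) = hZ.neg.toLp (-Z) := rfl
  rw [superdiff, Set.mem_ofPred_eq, this]
  refine mem_subdiff_of_expansion hZ.neg (K := K) fun ν γ hγ => ?_
  have e := h ν γ hγ
  simp only [Pi.neg_apply, inner_neg_left, integral_neg]
  linarith

theorem isGradientField_and_wGrad_eq {U : P2 d → ℝ} {g : P2 d → E d → E d}
    {A₁ : P2 d → E d → E d →L[ℝ] E d} {A₂ : P2 d → E d × E d → E d →L[ℝ] E d}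
    {pot : P2 d → E d → ℝ} {K : ℝ} (h : HasExpansion U g A₁ A₂ pot K) (m : P2 d) :
    WDifferentiableAt U m ∧ IsGradientField (g m) ∧ wGrad U m =ᵐ[m.meas] g m := by
  have hK := h.const_nonneg m
  have hlip : ∀ x y, ‖g m y - g m x‖ ≤ K * (‖x - y‖ ^ 2) + K * ‖x - y‖ := by
    intro x y
    -- The diagonal plan from m to itself has zero cost and displacement, so the gradient expansion
    -- along it becomes an expansion in space alone and yields the continuity of g m.
    have hγ := map_prodMk_mem_plans m (memLp_id m) measurable_id
    have hpush : m.push _ (memLp_id m) = m := by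
      refine Subtype.ext (Subtype.ext ?_)
      exact Measure.map_id
    rw [hpush] at hγ
    have e := h.grad_exp m m _ hγ x y
    have h0 : ∫ p : E d × E d, A₂ m (x, p.1) (p.2 - p.1) ∂(m.meas.map fun x => (x, x)) = 0 := by
      have := h.hess₂_cont m
      rw [integral_map (by fun_prop)]
      · simp
      · refine Continuous.aestronglyMeasurable ?_
        fun_prop
    have h1 : cost (m.meas.map fun x => (x, x)) = 0 := by
      rw [cost, integral_map (by fun_prop) (by fun_prop)]
      simp
    rw [h0, h1, add_zero, add_zero] at e
    calc ‖g m y - g m x‖ = ‖g m y - g m x - A₁ m x (y - x) + A₁ m x (y - x)‖ := by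
          rw [sub_add_cancel]
      _ ≤ _ := (norm_add_le _ _).trans (add_le_add e ?_)
    rw [norm_sub_rev x y]
    exact ((A₁ m x).le_opNorm _).trans
      (mul_le_mul_of_nonneg_right (h.hess₁_bound m x) (norm_nonneg _))
  have hc : Continuous (g m) := by
    rw [continuous_iff_continuousAt]
    intro x
    rw [ContinuousAt, tendsto_iff_norm_sub_tendsto_zero]
    refine squeeze_zero (fun _ => norm_nonneg _) (hlip x) ?_
    have : Continuous fun y => K * (‖x - y‖ ^ 2) + K * ‖x - y‖ := by fun_prop
    simpa using this.tendsto x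
  have hg : IsGradientField (g m) := ⟨hc, ⟨K, h.grad_bound m⟩, pot m, K, hK, h.pot_exp m⟩
  have hsub : (hg.memLp m).toLp (g m) ∈ subdiff U m :=
    mem_subdiff_of_expansion _ fun ν γ hγ => (abs_le.1 (h.val_exp m ν γ hγ)).1
  have hsup : (hg.memLp m).toLp (g m) ∈ superdiff U m :=
    mem_superdiff_of_expansion _ fun ν γ hγ => (abs_le.1 (h.val_exp m ν γ hγ)).2
  refine ⟨⟨⟨_, hsub⟩, ⟨_, hsup⟩⟩, hg, ?_⟩
  rw [wGrad_eq_of_isGradientField hg hsub hsup]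
  exact (hg.memLp m).coeFn_toLp

end

end WassersteinFourier

namespace WassersteinFourier

noncomputable section

variable {d : ℕ}

/-! ### Test functions -/

lemma IsTest.exists_bound {V : Type*} [NormedAddCommGroup V] [NormedSpace ℝ V] {f : E d → V}
    (hf : IsTest f) : ∃ B : ℝ, 0 ≤ B ∧ (∀ x, ‖f x‖ ≤ B) ∧ (∀ x, ‖fderiv ℝ f x‖ ≤ B) ∧
      (∀ x y, ‖f y - f x‖ ≤ B * ‖x - y‖) ∧
      ∀ x y, ‖f y - f x - fderiv ℝ f x (y - x)‖ ≤ B * ‖x - y‖ ^ 2 := by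
  obtain ⟨hs, hc⟩ := hf
  have hd : Differentiable ℝ f := hs.differentiable (by simp)
  have hfd : ContDiff ℝ 1 (fderiv ℝ f) := hs.fderiv_right (by norm_cast)
  obtain ⟨B₁, h₁⟩ := hc.exists_bound_of_continuous hs.continuous
  obtain ⟨B₂, h₂⟩ := (hc.fderiv ℝ).exists_bound_of_continuous hfd.continuous
  obtain ⟨B₃, h₃⟩ := hfd.lipschitzWith_of_hasCompactSupport (hc.fderiv ℝ) (by simp)
  have hlip : ∀ x y, ‖f y - f x‖ ≤ B₂ * ‖x - y‖ := fun x y => by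
    rw [norm_sub_rev x y]
    exact convex_univ.norm_image_sub_le_of_norm_fderiv_le (fun z _ => hd z) (fun z _ => h₂ z)
      (Set.mem_univ x) (Set.mem_univ y)
  have hquad : ∀ x y, ‖f y - f x - fderiv ℝ f x (y - x)‖ ≤ B₃ * ‖x - y‖ ^ 2 := fun x y => by
    have : ‖f y - f x - fderiv ℝ f x (y - x)‖ ≤ B₃ * ‖y - x‖ * ‖y - x‖ := by
      refine (convex_closedBall x ‖y - x‖).norm_image_sub_le_of_norm_fderiv_le' (fun z _ => hd z)
        (fun z hz => ?_) (Metric.mem_closedBall_self (norm_nonneg _)) (by simp [dist_eq_norm])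
      rw [← dist_eq_norm]
      exact (h₃.dist_le_mul z x).trans (mul_le_mul_of_nonneg_left hz B₃.2)
    rwa [mul_assoc, ← sq, norm_sub_rev y x] at this
  have a₁ : 0 ≤ B₁ := (norm_nonneg _).trans (h₁ 0)
  have a₂ : 0 ≤ B₂ := (norm_nonneg _).trans (h₂ 0)
  have a₃ : (0 : ℝ) ≤ B₃ := B₃.2
  refine ⟨B₁ + B₂ + B₃, by positivity, fun x => (h₁ x).trans (by linarith),
    fun x => (h₂ x).trans (by linarith), fun x y => (hlip x y).trans ?_,
    fun x y => (hquad x y).trans ?_⟩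
  · exact mul_le_mul_of_nonneg_right (by linarith) (norm_nonneg _)
  · exact mul_le_mul_of_nonneg_right (by linarith) (by positivity)

lemma IsTest.gradient {f : E d → ℝ} (hf : IsTest f) : IsTest (gradient f) := by
  have : _root_.gradient f = (InnerProductSpace.toDual ℝ (E d)).symm ∘ fderiv ℝ f := rfl
  rw [this]
  constructor
  · exact (InnerProductSpace.toDual ℝ (E d)).symm.toContinuousLinearEquiv.contDiff.comp
      (hf.1.fderiv_right (by simp))
  · exact (hf.2.fderiv ℝ).comp_left (map_zero _)

lemma IsTest.isGradientField {f : E d → ℝ} (hf : IsTest f) :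
    IsGradientField (_root_.gradient f) := by
  obtain ⟨B, hB, -, h1, -, h2⟩ := hf.exists_bound
  refine ⟨hf.gradient.1.continuous, ⟨B, fun x => ?_⟩, f, B, hB, fun x y => ?_⟩
  · have : ‖_root_.gradient f x‖ = ‖fderiv ℝ f x‖ :=
      LinearIsometryEquiv.norm_map (InnerProductSpace.toDual ℝ (E d)).symm _
    rw [this]
    exact h1 x
  · rw [inner_gradient_left]
    exact h2 x y

/-! ### Differentiability of directional derivatives -/

/-- The gradient of `ν ↦ ζ·(U[ν])` at `m`, up to a field orthogonal to gradients. -/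
def dirGrad (g : P2 d → E d → E d) (A₁ : P2 d → E d → E d →L[ℝ] E d)
    (A₂ : P2 d → E d × E d → E d →L[ℝ] E d) (ζ : E d → E d) (m : P2 d) (x : E d) : E d :=
  (A₁ m x).adjoint (ζ x) + (fderiv ℝ ζ x).adjoint (g m x) +
    ∫ z, (A₂ m (z, x)).adjoint (ζ z) ∂m.meas

lemma integral_add₃ {X : Type*} [MeasurableSpace X] {μ : Measure X} {f₁ f₂ f₃ : X → ℝ}
    (h₁ : Integrable f₁ μ) (h₂ : Integrable f₂ μ) (h₃ : Integrable f₃ μ) :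
    Integrable (fun x => f₁ x + f₂ x + f₃ x) μ ∧
    ∫ x, (f₁ x + f₂ x + f₃ x) ∂μ = ∫ x, f₁ x ∂μ + ∫ x, f₂ x ∂μ + ∫ x, f₃ x ∂μ := by
  refine ⟨(h₁.add h₂).add h₃, ?_⟩
  rw [integral_add (f := fun x => f₁ x + f₂ x) (h₁.add h₂) h₃, integral_add h₁ h₂]

section DirGrad

variable {U : P2 d → ℝ} {g : P2 d → E d → E d} {A₁ : P2 d → E d → E d →L[ℝ] E d}
  {A₂ : P2 d → E d × E d → E d →L[ℝ] E d} {pot : P2 d → E d → ℝ} {K : ℝ} {ζ : E d → E d}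

lemma continuous_adjoint_apply {X : Type*} [TopologicalSpace X] {B : X → E d →L[ℝ] E d}
    {v : X → E d} (hB : Continuous B) (hv : Continuous v) :
    Continuous fun x => (B x).adjoint (v x) :=
  ((ContinuousLinearMap.adjoint (𝕜 := ℝ) (E := E d) (F := E d)).continuous.comp hB).clm_apply hv

lemma norm_adjoint_apply_le {B : E d →L[ℝ] E d} {K M : ℝ} (hB : ‖B‖ ≤ K) {v : E d}
    (hv : ‖v‖ ≤ M) : ‖B.adjoint v‖ ≤ K * M := by
  refine (B.adjoint.le_opNorm v).trans ?_
  rw [LinearIsometryEquiv.norm_map]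
  exact mul_le_mul hB hv (norm_nonneg _) ((norm_nonneg _).trans hB)

lemma integrable_adjoint_apply (h : HasExpansion U g A₁ A₂ pot K) (hζ : IsTest ζ) (m : P2 d)
    (x : E d) : Integrable (fun z => (A₂ m (z, x)).adjoint (ζ z)) m.meas := by
  obtain ⟨B, -, hB, -⟩ := hζ.exists_bound
  have hc : Continuous fun z => A₂ m (z, x) := (h.hess₂_cont m).comp (by fun_prop)
  exact Integrable.of_bound (continuous_adjoint_apply hc hζ.1.continuous).aestronglyMeasurable
    (K * B) (ae_of_all _ fun z => norm_adjoint_apply_le (h.hess₂_bound _ _) (hB z))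

lemma continuous_dirGrad (h : HasExpansion U g A₁ A₂ pot K) (hζ : IsTest ζ) (m : P2 d) :
    Continuous (dirGrad g A₁ A₂ ζ m) := by
  obtain ⟨B, -, hB, -⟩ := hζ.exists_bound
  have hζc := hζ.1.continuous
  refine ((continuous_adjoint_apply (h.hess₁_cont m) hζc).add (continuous_adjoint_apply
    (hζ.1.continuous_fderiv (by simp)) (isGradientField_and_wGrad_eq h m).2.1.1)).add ?_
  refine continuous_of_dominated (bound := fun _ => K * B) ?_ ?_ (integrable_const _) ?_
  · exact fun x => (integrable_adjoint_apply h hζ m x).1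
  · exact fun x => ae_of_all _ fun z => norm_adjoint_apply_le (h.hess₂_bound _ _) (hB z)
  · refine ae_of_all _ fun z => continuous_adjoint_apply ?_ continuous_const
    exact (h.hess₂_cont m).comp (by fun_prop)

lemma inner_dirGrad (h : HasExpansion U g A₁ A₂ pot K) (hζ : IsTest ζ) (m : P2 d) (x v : E d) :
    inner ℝ (dirGrad g A₁ A₂ ζ m x) v = inner ℝ (A₁ m x v) (ζ x) +
      inner ℝ (g m x) (fderiv ℝ ζ x v) + ∫ z, inner ℝ (A₂ m (z, x) v) (ζ z) ∂m.meas := by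
  rw [dirGrad, inner_add_left, inner_add_left, ContinuousLinearMap.adjoint_inner_left,
    ContinuousLinearMap.adjoint_inner_left, real_inner_comm (A₁ m x v)]
  congr 1
  rw [real_inner_comm, ← integral_inner (integrable_adjoint_apply h hζ m x)]
  simp_rw [ContinuousLinearMap.adjoint_inner_right]

lemma exists_bound_dirGrad (h : HasExpansion U g A₁ A₂ pot K) (hζ : IsTest ζ) (m : P2 d) :
    ∃ M, ∀ x, ‖dirGrad g A₁ A₂ ζ m x‖ ≤ M := by
  obtain ⟨B, -, hB, hB', -⟩ := hζ.exists_bound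
  refine ⟨K * B + B * K + K * B, fun x => norm_add₃_le.trans ?_⟩
  refine add_le_add (add_le_add (norm_adjoint_apply_le (h.hess₁_bound _ _) (hB x))
    (norm_adjoint_apply_le (hB' x) (h.grad_bound _ _))) ?_
  have := norm_integral_le_of_norm_le_const (μ := m.meas)
    (f := fun z => (A₂ m (z, x)).adjoint (ζ z)) (C := K * B)
    (ae_of_all _ fun z => norm_adjoint_apply_le (h.hess₂_bound m (z, x)) (hB z))
  simpa using this

lemma memLp_dirGrad (h : HasExpansion U g A₁ A₂ pot K) (hζ : IsTest ζ) (m : P2 d) :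
    MemLp (dirGrad g A₁ A₂ ζ m) 2 m.meas :=
  memLp_of_continuous_of_bound m (continuous_dirGrad h hζ m)
    (exists_bound_dirGrad h hζ m).choose_spec

lemma wDir_eq (h : HasExpansion U g A₁ A₂ pot K) (ζ : E d → E d) (m : P2 d) :
    wDir U ζ m = ∫ x, inner ℝ (g m x) (ζ x) ∂m.meas := by
  refine integral_congr_ae ?_
  filter_upwards [(isGradientField_and_wGrad_eq h m).2.2] with x hx
  rw [hx]

lemma integrable_clm_displacement {m ν : P2 d} {γ : Measure (E d × E d)} (hγ : γ ∈ plans m ν)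
    {B : E d × E d → E d →L[ℝ] E d} (hc : Continuous B) (hB : ∀ p, ‖B p‖ ≤ K) :
    Integrable (fun p : E d × E d => B p (p.2 - p.1)) γ := by
  refine ((integrable_norm_sub hγ).const_mul K).mono' ?_ (ae_of_all _ fun p => ?_)
  · exact (hc.clm_apply (by fun_prop)).aestronglyMeasurable
  · rw [norm_sub_rev p.1]
    exact ((B p).le_opNorm _).trans (mul_le_mul_of_nonneg_right (hB p) (norm_nonneg _))

/-- Along a plan, ∫ ⟨g[ν], ζ⟩ dν varies for three reasons: the gradient moves in space (A₁), it
moves with the measure (A₂), and ζ is evaluated at a moved point. These are the three terms of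
`dirGrad`. -/
theorem wDir_expansion (h : HasExpansion U g A₁ A₂ pot K) (hζ : IsTest ζ) (m : P2 d) :
    ∃ K', ∀ ν, ∀ γ ∈ plans m ν, |wDir U ζ ν - wDir U ζ m -
      ∫ p, inner ℝ (dirGrad g A₁ A₂ ζ m p.1) (p.2 - p.1) ∂γ| ≤ K' * cost γ := by
  obtain ⟨B, hB0, hB, hBd, hBl, hBq⟩ := hζ.exists_bound
  have hK := h.const_nonneg m
  have hζc := hζ.1.continuous
  have hDc : Continuous (fderiv ℝ ζ) := hζ.1.continuous_fderiv (by simp)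
  have hgc := fun ν => (isGradientField_and_wGrad_eq h ν).2.1.1
  have hA₁ := h.hess₁_cont m
  have hA₂ := h.hess₂_cont m
  refine ⟨8 * (K * B), fun ν γ hγ => ?_⟩
  have := isProbabilityMeasure_of_mem_plans hγ
  set I : E d → E d := fun x => ∫ q, A₂ m (x, q.1) (q.2 - q.1) ∂γ with hI
  have hIint : ∀ x, Integrable (fun q : E d × E d => A₂ m (x, q.1) (q.2 - q.1)) γ := fun x =>
    integrable_clm_displacement (B := fun q => A₂ m (x, q.1)) hγ (hA₂.comp (by fun_prop))
      fun q => h.hess₂_bound _ _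
  have hIle : ∀ x, ‖I x‖ ≤ K * √(cost γ) := fun x => by
    calc ‖I x‖ ≤ ∫ q, K * ‖q.1 - q.2‖ ∂γ := by
          refine norm_integral_le_of_norm_le ((integrable_norm_sub hγ).const_mul K)
            (ae_of_all _ fun q => ?_)
          rw [norm_sub_rev q.1]
          exact ((A₂ m (x, q.1)).le_opNorm _).trans
            (mul_le_mul_of_nonneg_right (h.hess₂_bound _ _) (norm_nonneg _))
      _ ≤ _ := by
          rw [integral_const_mul]
          exact mul_le_mul_of_nonneg_left (integral_norm_sub_le hγ) hK
  have hIc : Continuous I := by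
    refine continuous_of_dominated (bound := fun q : E d × E d => K * ‖q.1 - q.2‖)
      (fun x => (hIint x).1) (fun x => ae_of_all _ fun q => ?_)
      ((integrable_norm_sub hγ).const_mul K) (ae_of_all _ fun q => ?_)
    · rw [norm_sub_rev q.1]
      exact ((A₂ m (x, q.1)).le_opNorm _).trans
        (mul_le_mul_of_nonneg_right (h.hess₂_bound _ _) (norm_nonneg _))
    · exact (hA₂.comp (by fun_prop : Continuous fun x => (x, q.1))).clm_apply continuous_const
  -- the two sides as integrals over the plan
  have iν : Integrable (fun p : E d × E d => (inner ℝ (g ν p.2) (ζ p.2) : ℝ)) γ := by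
    refine Integrable.of_bound (C := K * B) ?_ (ae_of_all _ fun p => ?_)
    · exact (((hgc ν).comp continuous_snd).inner (hζc.comp continuous_snd)).aestronglyMeasurable
    · exact (norm_inner_le_norm _ _).trans
        (mul_le_mul (h.grad_bound _ _) (hB _) (norm_nonneg _) hK)
  have im : Integrable (fun p : E d × E d => (inner ℝ (g m p.1) (ζ p.1) : ℝ)) γ := by
    refine Integrable.of_bound (C := K * B) ?_ (ae_of_all _ fun p => ?_)
    · exact (((hgc m).comp continuous_fst).inner (hζc.comp continuous_fst)).aestronglyMeasurable
    · exact (norm_inner_le_norm _ _).trans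
        (mul_le_mul (h.grad_bound _ _) (hB _) (norm_nonneg _) hK)
  have eν : wDir U ζ ν = ∫ p, inner ℝ (g ν p.2) (ζ p.2) ∂γ := by
    rw [wDir_eq h, ← hγ.2, integral_map measurable_snd.aemeasurable
      ((hgc ν).inner hζc).aestronglyMeasurable]
  have em : wDir U ζ m = ∫ p, inner ℝ (g m p.1) (ζ p.1) ∂γ := by
    rw [wDir_eq h, ← hγ.1, integral_map measurable_fst.aemeasurable
      ((hgc m).inner hζc).aestronglyMeasurable]
  have i1 : Integrable (fun p : E d × E d => (inner ℝ (A₁ m p.1 (p.2 - p.1)) (ζ p.1) : ℝ)) γ := by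
    have := integrable_clm_displacement (B := fun q => A₁ m q.1) hγ (hA₁.comp continuous_fst)
      fun q => h.hess₁_bound _ _
    refine (this.norm.mul_const B).mono' ?_ (ae_of_all _ fun p => ?_)
    · exact this.1.inner (hζc.comp continuous_fst).aestronglyMeasurable
    · exact (norm_inner_le_norm _ _).trans (mul_le_mul_of_nonneg_left (hB _) (norm_nonneg _))
  have i2 : Integrable
      (fun p : E d × E d => (inner ℝ (g m p.1) (fderiv ℝ ζ p.1 (p.2 - p.1)) : ℝ)) γ := by
    have := integrable_clm_displacement (B := fun q => fderiv ℝ ζ q.1) hγ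
      (hDc.comp continuous_fst) fun q => hBd _
    refine (this.norm.const_mul K).mono' ?_ (ae_of_all _ fun p => ?_)
    · exact ((hgc m).comp continuous_fst).aestronglyMeasurable.inner this.1
    · exact (norm_inner_le_norm _ _).trans
        (mul_le_mul_of_nonneg_right (h.grad_bound _ _) (norm_nonneg _))
  have i3 : Integrable (fun p : E d × E d => (inner ℝ (I p.1) (ζ p.1) : ℝ)) γ := by
    refine Integrable.of_bound (C := K * √(cost γ) * B) ?_ (ae_of_all _ fun p => ?_)
    · exact ((hIc.comp continuous_fst).inner (hζc.comp continuous_fst)).aestronglyMeasurable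
    · exact (norm_inner_le_norm _ _).trans
        (mul_le_mul (hIle _) (hB _) (norm_nonneg _) (by positivity))
  have hprod : Integrable (Function.uncurry fun p q : E d × E d =>
      (inner ℝ (A₂ m (p.1, q.1) (q.2 - q.1)) (ζ p.1) : ℝ)) (γ.prod γ) := by
    refine integrable_prod_of_le (b := fun _ => B) ?_ (integrable_const _)
      ((integrable_norm_sub hγ).const_mul K) fun p q => ?_
    · refine Continuous.measurable ?_
      have : Continuous fun r : (E d × E d) × (E d × E d) => A₂ m (r.1.1, r.2.1) :=
        hA₂.comp (by fun_prop)
      exact (this.clm_apply (by fun_prop)).inner (hζc.comp (by fun_prop))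
    · rw [mul_comm B, norm_sub_rev q.1]
      refine (norm_inner_le_norm _ _).trans (mul_le_mul ?_ (hB _) (norm_nonneg _) (by positivity))
      exact ((A₂ m (p.1, q.1)).le_opNorm _).trans
        (mul_le_mul_of_nonneg_right (h.hess₂_bound _ _) (norm_nonneg _))
  -- Fubini on γ ⊗ γ brings the displacement acted on by A₂ into the outer variable, where it can be
  -- paired with a field evaluated at that point.
  have e3 : ∫ p, inner ℝ (I p.1) (ζ p.1) ∂γ =
      ∫ q, ∫ z, inner ℝ (A₂ m (z, q.1) (q.2 - q.1)) (ζ z) ∂m.meas ∂γ := by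
    calc _ = ∫ p, ∫ q, (inner ℝ (A₂ m (p.1, q.1) (q.2 - q.1)) (ζ p.1) : ℝ) ∂γ ∂γ := by
          refine integral_congr_ae (ae_of_all _ fun p => ?_)
          simp only [hI]
          rw [real_inner_comm, ← integral_inner (hIint p.1)]
          simp_rw [real_inner_comm]
      _ = ∫ q, ∫ p, (inner ℝ (A₂ m (p.1, q.1) (q.2 - q.1)) (ζ p.1) : ℝ) ∂γ ∂γ :=
          integral_integral_swap hprod
      _ = _ := by
          refine integral_congr_ae (ae_of_all _ fun q => ?_)
          simp only
          rw [← hγ.1, integral_map measurable_fst.aemeasurable]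
          have : Continuous fun z => A₂ m (z, q.1) := hA₂.comp (by fun_prop)
          exact ((this.clm_apply continuous_const).inner hζc).aestronglyMeasurable
  have i3' : Integrable (fun q : E d × E d =>
      ∫ z, (inner ℝ (A₂ m (z, q.1) (q.2 - q.1)) (ζ z) : ℝ) ∂m.meas) γ := by
    refine hprod.integral_prod_right.congr (ae_of_all _ fun q => ?_)
    simp only [Function.uncurry]
    rw [← hγ.1, integral_map measurable_fst.aemeasurable]
    have : Continuous fun z => A₂ m (z, q.1) := hA₂.comp (by fun_prop)
    exact ((this.clm_apply continuous_const).inner hζc).aestronglyMeasurable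
  have eD : ∫ p, inner ℝ (dirGrad g A₁ A₂ ζ m p.1) (p.2 - p.1) ∂γ =
      ∫ p, (inner ℝ (A₁ m p.1 (p.2 - p.1)) (ζ p.1) +
        inner ℝ (g m p.1) (fderiv ℝ ζ p.1 (p.2 - p.1)) + inner ℝ (I p.1) (ζ p.1)) ∂γ := by
    simp_rw [inner_dirGrad h hζ]
    rw [(integral_add₃ i1 i2 i3').2, (integral_add₃ i1 i2 i3).2, e3]
  rw [eν, em, eD, ← integral_sub iν im, ← integral_sub
    (f := fun p : E d × E d => (inner ℝ (g ν p.2) (ζ p.2) : ℝ) - inner ℝ (g m p.1) (ζ p.1))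
    (iν.sub im) (integral_add₃ i1 i2 i3).1, ← Real.norm_eq_abs]
  -- With s = ‖x - y‖ and W² = cost γ, the three error terms total KB(3s² + sW + W²) ≤ 4KB(s² + W²).
  -- Integrating s² gives cost γ once more, hence the constant 8.
  have hbound : Integrable (fun p : E d × E d => 4 * (K * B) * (‖p.1 - p.2‖ ^ 2 + cost γ)) γ :=
    ((integrable_cost hγ).add (integrable_const _)).const_mul _
  refine (norm_integral_le_of_norm_le hbound (ae_of_all _ fun p => ?_)).trans (le_of_eq ?_)
  · set x := p.1
    set y := p.2
    set s := ‖x - y‖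
    set W := √(cost γ)
    have hW : W ^ 2 = cost γ := Real.sq_sqrt (cost_nonneg γ)
    have hW0 : 0 ≤ W := Real.sqrt_nonneg _
    have hs : 0 ≤ s := norm_nonneg _
    set Λ := A₁ m x (y - x) + I x with hΛ
    have hΛle : ‖Λ‖ ≤ K * (s + W) := by
      refine (norm_add_le _ _).trans ?_
      rw [mul_add]
      refine add_le_add ?_ (hIle x)
      simp only [s]
      rw [norm_sub_rev x]
      exact ((A₁ m x).le_opNorm _).trans
        (mul_le_mul_of_nonneg_right (h.hess₁_bound _ _) (norm_nonneg _))
    have split : (inner ℝ (g ν y) (ζ y) : ℝ) - inner ℝ (g m x) (ζ x) -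
        (inner ℝ (A₁ m x (y - x)) (ζ x) + inner ℝ (g m x) (fderiv ℝ ζ x (y - x)) +
          inner ℝ (I x) (ζ x)) =
        inner ℝ (g ν y - g m x - Λ) (ζ y) + inner ℝ Λ (ζ y - ζ x) +
          inner ℝ (g m x) (ζ y - ζ x - fderiv ℝ ζ x (y - x)) := by
      simp only [hΛ, inner_sub_left, inner_sub_right, inner_add_left]
      ring
    rw [split]
    refine norm_add₃_le.trans ?_
    have t1 : ‖(inner ℝ (g ν y - g m x - Λ) (ζ y) : ℝ)‖ ≤ K * (s ^ 2 + W ^ 2) * B :=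
      (norm_inner_le_norm _ _).trans (mul_le_mul (by rw [hW]; exact h.grad_exp m ν γ hγ x y)
        (hB y) (norm_nonneg _) (by positivity))
    have t2 : ‖(inner ℝ Λ (ζ y - ζ x) : ℝ)‖ ≤ K * (s + W) * (B * s) :=
      (norm_inner_le_norm _ _).trans (mul_le_mul hΛle (hBl x y) (norm_nonneg _) (by positivity))
    have t3 : ‖(inner ℝ (g m x) (ζ y - ζ x - fderiv ℝ ζ x (y - x)) : ℝ)‖ ≤ K * (B * s ^ 2) :=
      (norm_inner_le_norm _ _).trans
        (mul_le_mul (h.grad_bound _ _) (hBq x y) (norm_nonneg _) hK)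
    refine (add_le_add (add_le_add t1 t2) t3).trans ?_
    rw [← hW]
    have hKB : 0 ≤ K * B := mul_nonneg hK hB0
    nlinarith [mul_nonneg hKB (sq_nonneg (s - W)), mul_nonneg hKB (sq_nonneg s),
      mul_nonneg hKB (sq_nonneg W)]
  · rw [integral_const_mul, integral_add (integrable_cost hγ) (integrable_const _)]
    simp only [integral_const, probReal_univ, one_smul]
    rw [← cost]
    ring

lemma wDifferentiableAt_wDir (h : HasExpansion U g A₁ A₂ pot K) (hζ : IsTest ζ) (m : P2 d) :
    (memLp_dirGrad h hζ m).toLp _ ∈ subdiff (wDir U ζ) m ∧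
      (memLp_dirGrad h hζ m).toLp _ ∈ superdiff (wDir U ζ) m := by
  obtain ⟨K', hK'⟩ := wDir_expansion h hζ m
  exact ⟨mem_subdiff_of_expansion _ fun ν γ hγ => (abs_le.1 (hK' ν γ hγ)).1,
    mem_superdiff_of_expansion _ fun ν γ hγ => (abs_le.1 (hK' ν γ hγ)).2⟩

/-- `dirGrad` need not be the minimal subgradient of the directional derivative, but here it is
paired with a test gradient, and that pairing is the same for all sub- and supergradients. The term
in fderiv ℝ ζ₂ cancels against the one subtracted in `preHess`. -/
theorem preHess_eq (h : HasExpansion U g A₁ A₂ pot K) (m : P2 d) {f₁ f₂ : E d → ℝ}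
    (hf₁ : IsTest f₁) (hf₂ : IsTest f₂) :
    preHess U m (_root_.gradient f₁) (_root_.gradient f₂) =
      ∫ x, inner ℝ (A₁ m x (_root_.gradient f₁ x)) (_root_.gradient f₂ x) ∂m.meas +
      ∫ p, inner ℝ (A₂ m p (_root_.gradient f₁ p.2)) (_root_.gradient f₂ p.1)
        ∂(m.meas.prod m.meas) := by
  have hζ := hf₂.gradient
  set ζ₁ := _root_.gradient f₁
  set ζ₂ := _root_.gradient f₂
  have hg₁ := hf₁.isGradientField
  obtain ⟨B, hB0, hB, hBd, -⟩ := hζ.exists_bound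
  obtain ⟨-, ⟨M, hM⟩, -⟩ := id hg₁
  have hM0 : 0 ≤ M := (norm_nonneg _).trans (hM 0)
  have hK := h.const_nonneg m
  have hζ₁c : Continuous ζ₁ := hg₁.1
  have hζ₂c : Continuous ζ₂ := hζ.1.continuous
  obtain ⟨hsub, hsup⟩ := wDifferentiableAt_wDir h hζ m
  have e := inner_eq_of_mem_subdiff_of_mem_superdiff (wGrad_mem ⟨_, hsub⟩) hsup hg₁
  have e1 : wDir (wDir U ζ₂) ζ₁ m = inner ℝ (wGrad (wDir U ζ₂) m) ((hg₁.memLp m).toLp ζ₁) := by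
    rw [L2.inner_def, wDir]
    refine integral_congr_ae ?_
    filter_upwards [(hg₁.memLp m).coeFn_toLp] with x hx
    rw [hx]
  have e2 : inner ℝ ((memLp_dirGrad h hζ m).toLp _) ((hg₁.memLp m).toLp ζ₁) =
      ∫ x, (inner ℝ (A₁ m x (ζ₁ x)) (ζ₂ x) + inner ℝ (g m x) (fderiv ℝ ζ₂ x (ζ₁ x)) +
        ∫ z, inner ℝ (A₂ m (z, x) (ζ₁ x)) (ζ₂ z) ∂m.meas) ∂m.meas := by
    rw [L2.inner_def]
    refine integral_congr_ae ?_
    filter_upwards [(hg₁.memLp m).coeFn_toLp, (memLp_dirGrad h hζ m).coeFn_toLp] with x hx hx'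
    rw [hx, hx', inner_dirGrad h hζ]
  have i1 : Integrable (fun x => (inner ℝ (A₁ m x (ζ₁ x)) (ζ₂ x) : ℝ)) m.meas := by
    refine Integrable.of_bound (C := K * M * B) ?_ (ae_of_all _ fun x => ?_)
    · exact (((h.hess₁_cont m).clm_apply hζ₁c).inner hζ₂c).aestronglyMeasurable
    · exact (norm_inner_le_norm _ _).trans (mul_le_mul (((A₁ m x).le_opNorm _).trans
        (mul_le_mul (h.hess₁_bound _ _) (hM x) (norm_nonneg _) hK)) (hB x) (norm_nonneg _)
          (by positivity))
  have i2 : Integrable (fun x => (inner ℝ (g m x) (fderiv ℝ ζ₂ x (ζ₁ x)) : ℝ)) m.meas := by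
    refine Integrable.of_bound (C := K * (B * M)) ?_ (ae_of_all _ fun x => ?_)
    · exact ((isGradientField_and_wGrad_eq h m).2.1.1.inner
        ((hζ.1.continuous_fderiv (by simp)).clm_apply hζ₁c)).aestronglyMeasurable
    · exact (norm_inner_le_norm _ _).trans (mul_le_mul (h.grad_bound _ _)
        (((fderiv ℝ ζ₂ x).le_opNorm _).trans
          (mul_le_mul (hBd _) (hM x) (norm_nonneg _) hB0)) (norm_nonneg _) hK)
  have i3 : Integrable (fun p : E d × E d => (inner ℝ (A₂ m p (ζ₁ p.2)) (ζ₂ p.1) : ℝ))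
      (m.meas.prod m.meas) := by
    refine Integrable.of_bound (C := K * M * B) ?_ (ae_of_all _ fun p => ?_)
    · exact (((h.hess₂_cont m).clm_apply (hζ₁c.comp continuous_snd)).inner
        (hζ₂c.comp continuous_fst)).aestronglyMeasurable
    · exact (norm_inner_le_norm _ _).trans (mul_le_mul (((A₂ m p).le_opNorm _).trans
        (mul_le_mul (h.hess₂_bound _ _) (hM _) (norm_nonneg _) hK)) (hB _) (norm_nonneg _)
          (by positivity))
  have i3' : Integrable (fun x => ∫ z, (inner ℝ (A₂ m (z, x) (ζ₁ x)) (ζ₂ z) : ℝ) ∂m.meas)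
      m.meas := i3.integral_prod_right
  rw [preHess, wDir_eq h, e1, e, e2, (integral_add₃ i1 i2 i3').2,
    integral_prod_symm _ i3]
  ring

end DirGrad

end

end WassersteinFourier

namespace WassersteinFourier

noncomputable section

variable {d : ℕ}

/-! ### The Hessian -/

/-- Pullbacks under p and q are isometries into L²(π), and a bounded operator field acts on L²(π) by
Hölder's inequality. Identity maps on m give the A₁ part of the Hessian, the projections of m ⊗ m
the A₂ part. -/
lemma exists_bilinearForm {X : Type*} [MeasurableSpace X] {π : Measure X} [IsFiniteMeasure π]
    {m : P2 d} {p q : X → E d} (hp : MeasurePreserving p π m.meas)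
    (hq : MeasurePreserving q π m.meas) {B : X → E d →L[ℝ] E d} (hB : AEStronglyMeasurable B π)
    {K : ℝ} (hK : ∀ x, ‖B x‖ ≤ K) : ∃ H : L2 m →L[ℝ] L2 m →L[ℝ] ℝ,
      ∀ v₁ v₂, H v₁ v₂ = ∫ x, inner ℝ (B x (v₁ (q x))) (v₂ (p x)) ∂π := by
  have hBL : MemLp B ∞ π := memLp_top_of_bound hB K (ae_of_all _ hK)
  let T : Lp (E d) 2 π →L[ℝ] Lp (E d) 2 π :=
    (ContinuousLinearMap.id ℝ (E d →L[ℝ] E d)).holderL π ∞ 2 2 (hBL.toLp B)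
  let P : L2 m →ₗᵢ[ℝ] Lp (E d) 2 π := Lp.compMeasurePreservingₗᵢ ℝ p hp
  let Q : L2 m →ₗᵢ[ℝ] Lp (E d) 2 π := Lp.compMeasurePreservingₗᵢ ℝ q hq
  refine ⟨LinearMap.mkContinuous₂ (LinearMap.mk₂ ℝ
    (fun v₁ v₂ => (inner ℝ (T (Q v₁)) (P v₂) : ℝ)) ?_ ?_ ?_ ?_) ‖T‖ ?_, fun v₁ v₂ => ?_⟩
  · intro a b c
    rw [map_add, map_add, inner_add_left]
  · intro a b c
    rw [map_smul, map_smul, real_inner_smul_left, smul_eq_mul]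
  · intro a b c
    rw [map_add, inner_add_right]
  · intro a b c
    rw [map_smul, real_inner_smul_right, smul_eq_mul]
  · intro v₁ v₂
    change ‖(inner ℝ (T (Q v₁)) (P v₂) : ℝ)‖ ≤ _
    refine (norm_inner_le_norm _ _).trans ?_
    rw [P.norm_map, ← Q.norm_map v₁]
    exact mul_le_mul_of_nonneg_right (T.le_opNorm _) (norm_nonneg _)
  · change (inner ℝ (T (Q v₁)) (P v₂) : ℝ) = _
    rw [L2.inner_def]
    refine integral_congr_ae ?_
    filter_upwards [Lp.coeFn_compMeasurePreserving v₁ hq, Lp.coeFn_compMeasurePreserving v₂ hp,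
      (ContinuousLinearMap.id ℝ (E d →L[ℝ] E d)).coeFn_holder (r := 2) (hBL.toLp B) (Q v₁),
      hBL.coeFn_toLp] with x h1 h2 h3 h4
    change inner ℝ (((ContinuousLinearMap.id ℝ (E d →L[ℝ] E d)).holder 2 (hBL.toLp B) (Q v₁) :
      Lp (E d) 2 π) x) ((Lp.compMeasurePreserving p hp v₂ : Lp (E d) 2 π) x) = _
    rw [h3, h2, h4]
    change inner ℝ (B x ((Lp.compMeasurePreserving q hq v₁ : Lp (E d) 2 π) x)) _ = _
    rw [h1]
    rfl

section Hessian

variable {U : P2 d → ℝ} {g : P2 d → E d → E d} {A₁ : P2 d → E d → E d →L[ℝ] E d}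
  {A₂ : P2 d → E d × E d → E d →L[ℝ] E d} {pot : P2 d → E d → ℝ} {K : ℝ}

lemma HasExpansion.exists_hessForm (h : HasExpansion U g A₁ A₂ pot K) (m : P2 d) :
    ∃ H : L2 m →L[ℝ] L2 m →L[ℝ] ℝ, ∀ v₁ v₂, H v₁ v₂ =
      ∫ x, inner ℝ (A₁ m x (v₁ x)) (v₂ x) ∂m.meas +
      ∫ p, inner ℝ (A₂ m p (v₁ p.2)) (v₂ p.1) ∂(m.meas.prod m.meas) := by
  obtain ⟨H₁, h₁⟩ := exists_bilinearForm (m := m) (MeasurePreserving.id m.meas)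
    (MeasurePreserving.id m.meas) (h.hess₁_cont m).aestronglyMeasurable (h.hess₁_bound m)
  obtain ⟨H₂, h₂⟩ := exists_bilinearForm (m := m) (π := m.meas.prod m.meas)
    measurePreserving_fst measurePreserving_snd (h.hess₂_cont m).aestronglyMeasurable
    (h.hess₂_bound m)
  refine ⟨H₁ + H₂, fun v₁ v₂ => ?_⟩
  rw [add_apply, add_apply, h₁, h₂]
  rfl

/-- The Hessian form evaluated at fields equal almost everywhere to `ζ₁` and `ζ₂`. -/
lemma hessForm_congr {m : P2 d} {v₁ v₂ : L2 m} {ζ₁ ζ₂ : E d → E d} (hv₁ : v₁ =ᵐ[m.meas] ζ₁)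
    (hv₂ : v₂ =ᵐ[m.meas] ζ₂) (B₁ : E d → E d →L[ℝ] E d) (B₂ : E d × E d → E d →L[ℝ] E d) :
    ∫ x, inner ℝ (B₁ x (v₁ x)) (v₂ x) ∂m.meas +
      ∫ p, inner ℝ (B₂ p (v₁ p.2)) (v₂ p.1) ∂(m.meas.prod m.meas) =
    ∫ x, inner ℝ (B₁ x (ζ₁ x)) (ζ₂ x) ∂m.meas +
      ∫ p, inner ℝ (B₂ p (ζ₁ p.2)) (ζ₂ p.1) ∂(m.meas.prod m.meas) := by
  congr 1
  · refine integral_congr_ae ?_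
    filter_upwards [hv₁, hv₂] with x h1 h2
    rw [h1, h2]
  · refine integral_congr_ae ?_
    filter_upwards [Measure.quasiMeasurePreserving_snd.ae_eq_comp hv₁,
      Measure.quasiMeasurePreserving_fst.ae_eq_comp hv₂] with p h1 h2
    simp only [Function.comp] at h1 h2
    rw [h1, h2]

lemma exists_isHessianAt (h : HasExpansion U g A₁ A₂ pot K) (m : P2 d) :
    ∃ H : tangent m →L[ℝ] tangent m →L[ℝ] ℝ, IsHessianAt U m H ∧
      ∀ v₁ v₂ : tangent m, H v₁ v₂ =
        ∫ x, inner ℝ (A₁ m x ((v₁ : L2 m) x)) ((v₂ : L2 m) x) ∂m.meas +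
        ∫ p, inner ℝ (A₂ m p ((v₁ : L2 m) p.2)) ((v₂ : L2 m) p.1) ∂(m.meas.prod m.meas) := by
  obtain ⟨H, hH⟩ := h.exists_hessForm m
  refine ⟨H.bilinearComp (tangent m).subtypeL (tangent m).subtypeL,
    ⟨⟨1, one_pos, fun ν _ => (isGradientField_and_wGrad_eq h ν).1⟩, fun ζ hζ => ?_, ?_⟩,
    fun v₁ v₂ => hH v₁ v₂⟩
  · obtain ⟨h1, h2⟩ := wDifferentiableAt_wDir h hζ m
    exact ⟨⟨_, h1⟩, ⟨_, h2⟩⟩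
  · intro f₁ f₂ hf₁ hf₂ v₁ v₂ hv₁ hv₂
    rw [preHess_eq h m hf₁ hf₂]
    exact (hH v₁ v₂).trans (hessForm_congr hv₁ hv₂ _ _)

/-- The remainder K(‖x - y‖² + W₂²) corresponds to the linear moduli ρ(s) = Ks and ε(t) = Kt. -/
lemma wTwiceDifferentiableAt (h : HasExpansion U g A₁ A₂ pot K) (m : P2 d) :
    WTwiceDifferentiableAt U m := by
  have hK := h.const_nonneg m
  refine ⟨1, g, K, A₁ m, A₂ m, fun s => K * s, fun t => K * t, one_pos, fun ν _ => ?_,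
    (h.hess₁_cont m).measurable, ⟨K, h.hess₁_bound m⟩, (h.hess₂_cont m).measurable,
    ⟨K, h.hess₂_bound m⟩, ?_, fun t ht => mul_nonneg hK ht, ?_, ?_⟩
  · obtain ⟨h1, h2, h3⟩ := isGradientField_and_wGrad_eq h ν
    refine ⟨h1, h2.1, h3, fun x => (h.grad_bound ν x).trans ?_⟩
    exact le_mul_of_one_le_right hK (by linarith [norm_nonneg x])
  · refine ⟨by fun_prop, fun a _ b _ hab => mul_le_mul_of_nonneg_left hab hK,
      fun s _ t _ => (mul_add K s t).le, mul_zero K, ?_⟩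
    exact ((LinearMap.mulLeft ℝ K).concaveOn (convex_Ici 0))
  · have : Continuous fun t : ℝ => K * t := by fun_prop
    simpa using (this.tendsto 0).mono_left nhdsWithin_le_nhds
  · intro ν _ γ hγ x y
    refine (h.grad_exp m ν γ hγ.1 x y).trans (le_of_eq ?_)
    rw [← W2_sq_eq_cost hγ]
    ring

end Hessian

/-! ### Moments and the Laplacian -/

/-- The `i`-th coordinate field. -/
def coordVec (i : Fin d) : E d := EuclideanSpace.single i 1

lemma inner_coordVec (i : Fin d) (x : E d) : inner ℝ (coordVec i) x = x i := by
  simp [coordVec, EuclideanSpace.inner_single_left]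

lemma isGradientField_coordVec (i : Fin d) : IsGradientField fun _ : E d => coordVec i := by
  refine ⟨continuous_const, ⟨_, fun _ => le_rfl⟩, fun x => x i, 0, le_rfl, fun x y => ?_⟩
  rw [inner_coordVec]
  simp

/-- A moment is exactly affine along every plan, so the constant coordinate field is both a sub- and
a supergradient with zero remainder. -/
lemma wGrad_moment (i : Fin d) (m : P2 d) :
    wGrad (moment i) m = ((isGradientField_coordVec i).memLp m).toLp _ := by
  have key : ∀ ν, ∀ γ ∈ plans m ν, moment i ν - moment i m -
      ∫ p, inner ℝ (coordVec i) (p.2 - p.1) ∂γ = 0 := by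
    intro ν γ hγ
    have := isProbabilityMeasure_of_mem_plans hγ
    have hc : Continuous fun x : E d => x i := by fun_prop
    have h1 : moment i m = ∫ p : E d × E d, p.1 i ∂γ := by
      rw [moment, ← hγ.1, integral_map measurable_fst.aemeasurable hc.aestronglyMeasurable]
    have h2 : moment i ν = ∫ p : E d × E d, p.2 i ∂γ := by
      rw [moment, ← hγ.2, integral_map measurable_snd.aemeasurable hc.aestronglyMeasurable]
    have j1 : Integrable (fun p : E d × E d => p.1 i) γ :=
      ((EuclideanSpace.proj (𝕜 := ℝ) i).comp_memLp' (memLp_fst hγ)).integrable (by norm_num)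
    have j2 : Integrable (fun p : E d × E d => p.2 i) γ :=
      ((EuclideanSpace.proj (𝕜 := ℝ) i).comp_memLp' (memLp_snd hγ)).integrable (by norm_num)
    simp_rw [inner_coordVec, PiLp.sub_apply]
    rw [h1, h2, integral_sub j2 j1, sub_self]
  exact wGrad_eq_of_isGradientField (isGradientField_coordVec i)
    (mem_subdiff_of_expansion _ (K := 0) fun ν γ hγ => by rw [key ν γ hγ]; simp)
    (mem_superdiff_of_expansion _ (K := 0) fun ν γ hγ => by rw [key ν γ hγ]; simp)

/-- Cut off the coordinate to f₀ = x_i χ and zoom: the gradient of c⁻¹ f₀(c x) is ∇f₀(c x). It is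
uniformly bounded and tends to ∇f₀(0) = e_i as c → 0, so dominated convergence applies. -/
lemma exists_gradient_tendsto_coordVec (i : Fin d) (m : P2 d) :
    ∃ f : ℕ → E d → ℝ, (∀ n, IsTest (f n)) ∧ ∃ s : ℕ → L2 m,
      (∀ n, s n =ᵐ[m.meas] gradient (f n)) ∧
      Tendsto s atTop (𝓝 (((isGradientField_coordVec i).memLp m).toLp _)) := by
  let χ : ContDiffBump (0 : E d) := ⟨1, 2, one_pos, one_lt_two⟩
  let f₀ : E d → ℝ := fun x => x i * χ x
  have hf₀ : IsTest f₀ := by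
    refine ⟨?_, ?_⟩
    · have h1 : ContDiff ℝ ∞ fun x : E d => x i := (EuclideanSpace.proj (𝕜 := ℝ) i).contDiff
      exact h1.mul χ.contDiff
    · exact χ.hasCompactSupport.mul_left
  have hgrad0 : gradient f₀ 0 = coordVec i := by
    have hev : f₀ =ᶠ[𝓝 0] fun x => inner ℝ (coordVec i) x := by
      filter_upwards [χ.eventuallyEq_one] with x hx
      simp only [f₀, hx, Pi.one_apply, mul_one, inner_coordVec]
    refine HasGradientAt.gradient ?_
    rw [hasGradientAt_iff_hasFDerivAt]
    exact ((InnerProductSpace.toDual ℝ (E d) (coordVec i)).hasFDerivAt).congr_of_eventuallyEq hev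
  obtain ⟨hgc, ⟨B, hB⟩, -⟩ := hf₀.isGradientField
  let c : ℕ → ℝ := fun n => ((n : ℝ) + 1)⁻¹
  have hc0 : ∀ n, c n ≠ 0 := fun n => by positivity
  let f : ℕ → E d → ℝ := fun n x => (c n)⁻¹ * f₀ (c n • x)
  have hgrad : ∀ n x, gradient (f n) x = gradient f₀ (c n • x) := by
    intro n x
    refine HasGradientAt.gradient ?_
    rw [hasGradientAt_iff_hasFDerivAt]
    have h1 : HasFDerivAt f₀ (fderiv ℝ f₀ (c n • x)) (c n • x) :=
      (hf₀.1.differentiable (by simp) _).hasFDerivAt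
    have h2 : HasFDerivAt (fun x : E d => c n • x) (c n • ContinuousLinearMap.id ℝ (E d)) x :=
      (hasFDerivAt_id x).const_smul (c n)
    have h3 := (h1.comp x h2).const_mul (c n)⁻¹
    refine h3.congr_fderiv ?_
    ext v
    rw [InnerProductSpace.toDual_apply_apply, inner_gradient_left]
    simp [hc0 n]
  have hf : ∀ n, IsTest (f n) := fun n => by
    refine ⟨contDiff_const.mul (hf₀.1.comp (contDiff_const_smul (c n))), ?_⟩
    exact (hf₀.2.comp_smul (hc0 n)).mul_left
  let s : ℕ → L2 m := fun n => ((hf n).isGradientField.memLp m).toLp _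
  have hs : ∀ n, s n =ᵐ[m.meas] gradient (f n) := fun n => MemLp.coeFn_toLp _
  refine ⟨f, hf, s, hs, ?_⟩
  rw [tendsto_iff_norm_sub_tendsto_zero]
  have hsq : ∀ n, ‖s n - ((isGradientField_coordVec i).memLp m).toLp _‖ ^ 2 =
      ∫ x, ‖gradient f₀ (c n • x) - coordVec i‖ ^ 2 ∂m.meas := fun n => by
    rw [← real_inner_self_eq_norm_sq, L2.inner_def]
    refine integral_congr_ae ?_
    filter_upwards [Lp.coeFn_sub (s n) (((isGradientField_coordVec i).memLp m).toLp _), hs n,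
      ((isGradientField_coordVec i).memLp m).coeFn_toLp] with x h1 h2 h3
    rw [h1, Pi.sub_apply, h2, h3, hgrad, real_inner_self_eq_norm_sq]
  have hlim : Tendsto (fun n => ∫ x, ‖gradient f₀ (c n • x) - coordVec i‖ ^ 2 ∂m.meas) atTop
      (𝓝 0) := by
    have := tendsto_integral_of_dominated_convergence (μ := m.meas)
      (F := fun n x => ‖gradient f₀ (c n • x) - coordVec i‖ ^ 2) (f := fun _ => (0 : ℝ))
      (fun _ => (B + ‖coordVec i‖) ^ 2) (fun n => ?_) (integrable_const _) (fun n => ?_) ?_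
    · simpa using this
    · refine Continuous.aestronglyMeasurable ?_
      exact ((hgc.comp (continuous_const_smul (c n))).sub continuous_const).norm.pow 2
    · refine ae_of_all _ fun x => ?_
      rw [norm_pow, norm_norm]
      exact pow_le_pow_left₀ (norm_nonneg _)
        ((norm_sub_le _ _).trans (add_le_add (hB _) le_rfl)) 2
    · refine ae_of_all _ fun x => ?_
      have hcn : Tendsto c atTop (𝓝 0) := by
        simpa [c, one_div] using tendsto_one_div_add_atTop_nhds_zero_nat (𝕜 := ℝ)
      have h1 : Tendsto (fun n => c n • x) atTop (𝓝 0) := by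
        simpa using hcn.smul_const x
      have h2 := (((hgc.tendsto 0).comp h1).sub_const (coordVec i)).norm.pow 2
      rw [hgrad0] at h2
      simpa using h2
  simp_rw [← hsq] at hlim
  have := hlim.sqrt
  simpa [Real.sqrt_sq] using this

section Laplacian

variable {U : P2 d → ℝ} {g : P2 d → E d → E d} {A₁ : P2 d → E d → E d →L[ℝ] E d}
  {A₂ : P2 d → E d × E d → E d →L[ℝ] E d} {pot : P2 d → E d → ℝ} {K : ℝ}

lemma wGrad_moment_mem_tangent (i : Fin d) (m : P2 d) : wGrad (moment i) m ∈ tangent m := by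
  obtain ⟨f, hf, s, hs, hlim⟩ := exists_gradient_tendsto_coordVec i m
  rw [wGrad_moment]
  refine mem_closure_of_tendsto hlim (Eventually.of_forall fun n => ?_)
  exact Submodule.subset_span ⟨f n, hf n, hs n⟩

/-- Both forms agree with `preHess` on test gradients and are continuous, so they agree at their
limits. The Laplacian is thus independent of the choices in its definition. -/
lemma IsHessianAt.eq_of_eq_wGrad_moment {m : P2 d} {H H' : tangent m →L[ℝ] tangent m →L[ℝ] ℝ}
    (hH : IsHessianAt U m H) (hH' : IsHessianAt U m H') {i : Fin d} {ζ : tangent m}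
    (hζ : (ζ : L2 m) = wGrad (moment i) m) : H ζ ζ = H' ζ ζ := by
  obtain ⟨f, hf, s, hs, hlim⟩ := exists_gradient_tendsto_coordVec i m
  have hmem : ∀ n, s n ∈ tangent m := fun n =>
    Submodule.le_topologicalClosure _ (Submodule.subset_span ⟨f n, hf n, hs n⟩)
  let t : ℕ → tangent m := fun n => ⟨s n, hmem n⟩
  have ht : Tendsto t atTop (𝓝 ζ) := by
    rw [tendsto_subtype_rng, hζ, wGrad_moment]
    exact hlim
  have hconv : ∀ G : tangent m →L[ℝ] tangent m →L[ℝ] ℝ,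
      Tendsto (fun n => G (t n) (t n)) atTop (𝓝 (G ζ ζ)) := fun G =>
    ((G.continuous.clm_apply continuous_id).tendsto ζ).comp ht
  refine tendsto_nhds_unique (hconv H) ((hconv H').congr fun n => ?_)
  rw [hH.2.2 _ _ (hf n) (hf n) _ _ (hs n) (hs n), hH'.2.2 _ _ (hf n) (hf n) _ _ (hs n) (hs n)]

theorem hasWLaplacianAt_and_eq (h : HasExpansion U g A₁ A₂ pot K) (m : P2 d) :
    (∃ v, HasWLaplacianAt U m v) ∧ wLaplacianReal U m =
      ∑ i, (∫ x, inner ℝ (A₁ m x (coordVec i)) (coordVec i) ∂m.meas +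
        ∫ p, inner ℝ (A₂ m p (coordVec i)) (coordVec i) ∂(m.meas.prod m.meas)) := by
  obtain ⟨H, hH, hval⟩ := exists_isHessianAt h m
  let ζ : Fin d → tangent m := fun i => ⟨wGrad (moment i) m, wGrad_moment_mem_tangent i m⟩
  have hex : ∃ v, HasWLaplacianAt U m v :=
    ⟨_, wTwiceDifferentiableAt h m, H, hH, ζ, fun i => rfl, rfl⟩
  refine ⟨hex, ?_⟩
  rw [wLaplacianReal, dif_pos hex]
  obtain ⟨-, H', hH', ζ', hζ', hv⟩ := hex.choose_spec
  rw [hv]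
  refine Finset.sum_congr rfl fun i _ => ?_
  rw [hH'.eq_of_eq_wGrad_moment hH (hζ' i), hval]
  have : ((ζ' i : tangent m) : L2 m) =ᵐ[m.meas] fun _ => coordVec i := by
    rw [hζ', wGrad_moment]
    exact MemLp.coeFn_toLp _
  exact hessForm_congr this this _ _

end Laplacian

end

end WassersteinFourier

namespace WassersteinFourier

noncomputable section

variable {d : ℕ}

/-! ### The space of all frequencies -/

/-- The disjoint union of the frequency spaces `(ℝ^d)^k`. -/
abbrev Freq (d : ℕ) := Σ k : ℕ+, Fin k → E d

/-- The inclusion of a frequency space. -/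
def freqMk (k : ℕ+) (ξ : Fin k → E d) : Freq d := ⟨k, ξ⟩

/-- The sum of the Lebesgue measures on the frequency spaces. -/
def freqMeasure : Measure (Freq d) :=
  Measure.sum fun k : ℕ+ => (volume : Measure (Fin k → E d)).map (freqMk k)

instance : SFinite (freqMeasure (d := d)) := by
  unfold freqMeasure; infer_instance

lemma measurable_freqMk (k : ℕ+) : Measurable (freqMk (d := d) k) :=
  fun _ hs => (MeasurableSpace.measurableSet_iInf.1 hs k :)

lemma measurableSet_freq_iff {s : Set (Freq d)} :
    MeasurableSet s ↔ ∀ k : ℕ+, MeasurableSet (freqMk k ⁻¹' s) :=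
  MeasurableSpace.measurableSet_iInf

lemma measurableEmbedding_freqMk (k : ℕ+) :
    MeasurableEmbedding (freqMk (d := d) k) where
  injective := fun _ _ h => eq_of_heq (Sigma.mk.inj h).2
  measurable := measurable_freqMk k
  measurableSet_image' := fun s hs => by
    rw [measurableSet_freq_iff]
    intro l
    by_cases h : k = l
    · subst h
      rwa [Set.preimage_image_eq]
      exact fun _ _ h => eq_of_heq (Sigma.mk.inj h).2
    · convert MeasurableSet.empty
      ext ξ
      simp only [Set.mem_preimage, Set.mem_image, Set.mem_empty_iff_false, iff_false, not_exists,
        not_and]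
      exact fun η _ he => h (congrArg Sigma.fst he)

lemma measurable_freq {β : Type*} [MeasurableSpace β] {f : Freq d → β}
    (h : ∀ k : ℕ+, Measurable fun ξ : Fin k → E d => f ⟨k, ξ⟩) : Measurable f :=
  fun _ hs => measurableSet_freq_iff.2 fun k => h k hs

/-- The preimage of a measurable set is a countable union, over the degree, of images under
measurable embeddings; joint measurability may thus be checked in each degree. -/
lemma measurable_freq_prod {β X : Type*} [MeasurableSpace β] [MeasurableSpace X]
    {f : Freq d × X → β}
    (h : ∀ k : ℕ+, Measurable fun q : (Fin k → E d) × X => f (⟨k, q.1⟩, q.2)) :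
    Measurable f := by
  intro s hs
  have hk : ∀ k : ℕ+, MeasurableEmbedding
      (Prod.map (freqMk (d := d) k) (id : X → X)) := fun k =>
    (measurableEmbedding_freqMk k).prodMap MeasurableEmbedding.id
  have : f ⁻¹' s = ⋃ k : ℕ+, Prod.map (freqMk (d := d) k) (id : X → X) ''
      ((fun q : (Fin k → E d) × X => f (⟨k, q.1⟩, q.2)) ⁻¹' s) := by
    ext ⟨⟨k, ξ⟩, x⟩
    simp only [Set.mem_preimage, Set.mem_iUnion, Set.mem_image]
    constructor
    · exact fun hx => ⟨k, (ξ, x), hx, rfl⟩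
    · rintro ⟨l, ⟨η, y⟩, hy, he⟩
      rw [← he]
      exact hy
  rw [this]
  exact MeasurableSet.iUnion fun k => (hk k).measurableSet_image.2 (h k hs)

lemma lintegral_freq (f : Freq d → ℝ≥0∞) :
    ∫⁻ z, f z ∂freqMeasure = ∑' k : ℕ+, ∫⁻ ξ : Fin k → E d, f ⟨k, ξ⟩ := by
  rw [freqMeasure, lintegral_sum_measure]
  simp_rw [(measurableEmbedding_freqMk _).lintegral_map]
  rfl

lemma integrable_freq_section {F : Type*} [NormedAddCommGroup F] {f : Freq d → F}
    (hf : Integrable f freqMeasure) (k : ℕ+) : Integrable fun ξ : Fin k → E d => f ⟨k, ξ⟩ :=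
  (measurableEmbedding_freqMk k).integrable_map_iff.1 ((integrable_sum_measure_iff.1 hf).1 k)

lemma hasSum_integral_freq {F : Type*} [NormedAddCommGroup F] [NormedSpace ℝ F] {f : Freq d → F}
    (hf : Integrable f freqMeasure) :
    HasSum (fun k : ℕ+ => ∫ ξ : Fin k → E d, f ⟨k, ξ⟩) (∫ z, f z ∂freqMeasure) := by
  have := hasSum_integral_measure hf
  simp only [(measurableEmbedding_freqMk _).integral_map] at this
  exact this

lemma summable_integral_norm_freq {F : Type*} [NormedAddCommGroup F] {f : Freq d → F}
    (hf : Integrable f freqMeasure) :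
    Summable fun k : ℕ+ => ∫ ξ : Fin k → E d, ‖f ⟨k, ξ⟩‖ :=
  (hasSum_integral_freq hf.norm).summable

/-! ### Fourier series as integrals over all frequencies -/

/-- All variables have the same law m, so every permutation contributes the same product and the k!
cancels. -/
lemma fourierPoly_eq (k : ℕ+) (ξ : Fin k → E d) (m : P2 d) :
    fourierPoly k ξ m = ((k : ℕ) : ℂ)⁻¹ * ∏ j, hat m (ξ j) := by
  have h1 : ∀ x : Fin k → E d, symExp k ξ x =
      (((k : ℕ)! : ℂ))⁻¹ * ∑ σ : Equiv.Perm (Fin k), ∏ j, wave (ξ (σ j)) (x j) := fun x => by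
    rw [symExp]
    congr 1
    refine Finset.sum_congr rfl fun σ _ => ?_
    simp only [wave]
    rw [← Complex.exp_sum, ← Finset.mul_sum]
    push_cast
    rfl
  have h2 : ∀ σ : Equiv.Perm (Fin k), Integrable
      (fun x : Fin k → E d => ∏ j, wave (ξ (σ j)) (x j)) (Measure.pi fun _ => m.meas) :=
    fun σ => Integrable.fintype_prod fun j => integrable_wave m (ξ (σ j))
  rw [fourierPoly]
  congr 1
  simp_rw [h1]
  rw [integral_const_mul, integral_finsetSum _ fun σ _ => h2 σ]
  have h3 : ∀ σ : Equiv.Perm (Fin k),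
      ∫ x : Fin k → E d, ∏ j, wave (ξ (σ j)) (x j) ∂(Measure.pi fun _ => m.meas) =
        ∏ j, hat m (ξ j) := fun σ => by
    rw [integral_fintype_prod_eq_prod (fun j x => wave (ξ (σ j)) x)]
    exact Equiv.prod_comp σ fun j => hat m (ξ j)
  simp_rw [h3]
  rw [Finset.sum_const, Finset.card_univ, Fintype.card_perm, Fintype.card_fin, nsmul_eq_mul,
    ← mul_assoc, inv_mul_cancel₀ (by exact_mod_cast Nat.factorial_ne_zero _), one_mul]

/-- The coefficient of the product of Fourier transforms in the Fourier series. -/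
def weight (a : Coeffs d) (z : Freq d) : ℂ := (((z.1 : ℕ) : ℂ) * ((z.1 : ℕ)! : ℂ))⁻¹ * a z.1 z.2

/-- The value of a product of Fourier transforms. -/
def hatProd (m : P2 d) (z : Freq d) : ℂ := ∏ j, hat m (z.2 j)

lemma norm_hatProd_le (m : P2 d) (z : Freq d) : ‖hatProd m z‖ ≤ 1 :=
  norm_prod_le_one' _ fun j => norm_hat_le m (z.2 j)

lemma measurable_hatProd (m : P2 d) : Measurable (hatProd m) := by
  refine measurable_freq fun k => Continuous.measurable ?_
  exact continuous_finsetProd Finset.univ fun j _ => (continuous_hat m).comp (continuous_apply j)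

lemma Integrable.mul_hatProd {w : Freq d → ℂ} (hw : Integrable w freqMeasure) (m : P2 d) :
    Integrable (fun z => w z * hatProd m z) freqMeasure := by
  refine hw.norm.mono' (hw.1.mul (measurable_hatProd m).aestronglyMeasurable)
    (ae_of_all _ fun z => ?_)
  rw [norm_mul]
  exact mul_le_of_le_one_right (norm_nonneg _) (norm_hatProd_le m z)

lemma fourierTerm_eq (a : Coeffs d) (m : P2 d) (k : ℕ+) :
    fourierTerm a m k = ∫ ξ : Fin k → E d, weight a ⟨k, ξ⟩ * hatProd m ⟨k, ξ⟩ := by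
  rw [fourierTerm, ← integral_const_mul]
  refine integral_congr_ae (ae_of_all _ fun ξ => ?_)
  simp only [fourierPoly_eq, weight, hatProd, mul_inv]
  ring

lemma measurable_weight {a : Coeffs d} (ha : ∀ k, Measurable (a k)) : Measurable (weight a) :=
  measurable_freq fun k => (ha k).const_mul (((k : ℕ) : ℂ) * ((k : ℕ)! : ℂ))⁻¹

/-- The 1/k in $F^k_\xi$ turns the bound C k!/k^δ into the summable C/k^{1+δ}. -/
lemma tsum_weight_lt_top {G : ℕ+ → ℝ≥0∞} {C δ : ℝ} (hδ : 0 < δ)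
    (hG : ∀ k, G k ≤ ENNReal.ofReal (C * (k : ℕ)! / (k : ℝ) ^ δ)) :
    ∑' k : ℕ+, ‖(((k : ℕ) : ℂ) * ((k : ℕ)! : ℂ))⁻¹‖ₑ * G k < ⊤ := by
  have hs : Summable fun k : ℕ+ => |C| * ((k : ℕ) : ℝ) ^ (-(1 + δ)) := by
    refine Summable.mul_left _ ?_
    exact (Real.summable_nat_rpow.2 (by linarith : -(1 + δ) < -1)).comp_injective
      PNat.coe_injective
  refine lt_of_le_of_lt (ENNReal.tsum_le_tsum fun k => ?_) hs.tsum_ofReal_lt_top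
  have hk : (0 : ℝ) < (k : ℕ) := by exact_mod_cast k.pos
  have hf : (0 : ℝ) < ((k : ℕ)! : ℝ) := by exact_mod_cast Nat.factorial_pos _
  refine (mul_le_mul_right (hG k) _).trans ?_
  have : ‖(((k : ℕ) : ℂ) * ((k : ℕ)! : ℂ))⁻¹‖ₑ =
      ENNReal.ofReal (((k : ℕ) : ℝ) * ((k : ℕ)! : ℝ))⁻¹ := by
    rw [← ofReal_norm, norm_inv, norm_mul, Complex.norm_natCast, Complex.norm_natCast]
  rw [this, ← ENNReal.ofReal_mul (by positivity)]
  refine ENNReal.ofReal_le_ofReal ?_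
  rw [neg_add, Real.rpow_add hk, Real.rpow_neg hk.le, Real.rpow_neg hk.le, Real.rpow_one]
  have hkd : 0 < ((k : ℕ) : ℝ) ^ δ := Real.rpow_pos_of_pos hk δ
  calc _ = C * ((((k : ℕ) : ℝ))⁻¹ * (((k : ℕ) : ℝ) ^ δ)⁻¹) := by field_simp
    _ ≤ _ := by gcongr; exact le_abs_self C

lemma integrable_weight_mul {a : Coeffs d} (ha : ∀ k, Measurable (a k)) {h : Freq d → ℝ}
    (hh : Measurable h) {C δ : ℝ} (hδ : 0 < δ)
    (hb : ∀ k : ℕ+, ∫⁻ ξ : Fin k → E d, ‖a k ξ‖ₑ * ‖h ⟨k, ξ⟩‖ₑ ≤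
      ENNReal.ofReal (C * (k : ℕ)! / (k : ℝ) ^ δ)) :
    Integrable (fun z => ‖weight a z‖ * h z) freqMeasure := by
  refine ⟨((measurable_weight ha).norm.mul hh).aestronglyMeasurable, ?_⟩
  rw [HasFiniteIntegral, lintegral_freq]
  refine lt_of_le_of_lt (ENNReal.tsum_le_tsum fun k => ?_) (tsum_weight_lt_top hδ hb)
  rw [← lintegral_const_mul']
  · refine lintegral_mono fun ξ => ?_
    rw [enorm_mul, enorm_norm, weight, enorm_mul, mul_assoc]
  · exact enorm_ne_top

lemma integrable_weight {a : Coeffs d} (ha : ∀ k, Measurable (a k)) {C δ : ℝ} (hδ : 0 < δ)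
    (hb : UniformBound a C δ) : Integrable (weight a) freqMeasure := by
  rw [← integrable_norm_iff (measurable_weight ha).aestronglyMeasurable]
  simpa using integrable_weight_mul ha (h := fun _ => 1) measurable_const hδ (C := C)
    (fun k => by simpa using hb k)

lemma hasSum_fourierTerm {a : Coeffs d} (ha : Integrable (weight a) freqMeasure) (m : P2 d) :
    HasSum (fourierTerm a m) (∫ z, weight a z * hatProd m z ∂freqMeasure) := by
  have := hasSum_integral_freq (Integrable.mul_hatProd ha m)
  simpa only [← fourierTerm_eq] using this

lemma hasCoeffs_of_eq_integral {F : P2 d → ℂ} {a : Coeffs d} (ha : MemA0 a) {C δ : ℝ}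
    (hδ : 0 < δ) (hb : UniformBound a C δ)
    (hF : ∀ m, F m = ∫ z, weight a z * hatProd m z ∂freqMeasure) : HasCoeffs F a := by
  -- Membership in 𝓗⁰ asks for a positive constant, whereas C carries no sign condition here.
  refine ⟨ha, ⟨max C 1, δ, by positivity, hδ, fun k => (hb k).trans ?_⟩, fun m => ?_⟩
  · refine ENNReal.ofReal_le_ofReal ?_
    gcongr
    exact le_max_left _ _
  · rw [hF]
    exact hasSum_fourierTerm (integrable_weight (fun k => (ha.1 k).1) hδ hb) m

lemma HasCoeffs.eq_integral {F : P2 d → ℂ} {a : Coeffs d} (h : HasCoeffs F a) :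
    Integrable (weight a) freqMeasure ∧
      ∀ m, F m = ∫ z, weight a z * hatProd m z ∂freqMeasure := by
  obtain ⟨ha, ⟨C, δ, -, hδ, hb⟩, hF⟩ := h
  have hi := integrable_weight (fun k => (ha.1 k).1) hδ hb
  exact ⟨hi, fun m => (hF m).unique (hasSum_fourierTerm hi m)⟩

end

end WassersteinFourier

namespace WassersteinFourier

noncomputable section

variable {d : ℕ}

/-! ### Uniqueness of the coefficients -/

lemma exists_discrete {ι : Type} [Fintype ι] (p : ι → ℝ) (hp : ∀ i, 0 ≤ p i) (hsum : ∑ i, p i = 1)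
    (x : ι → E d) : ∃ m : P2 d, ∀ ξ, hat m ξ = ∑ i, (p i : ℂ) * wave ξ (x i) := by
  classical
  let _ : MeasurableSpace ι := ⊤
  have hsum' : ∑ i, ENNReal.ofReal (p i) = 1 := by
    rw [← ENNReal.ofReal_sum_of_nonneg fun i _ => hp i, hsum, ENNReal.ofReal_one]
  let q : PMF ι := PMF.ofFintype (fun i => ENNReal.ofReal (p i)) hsum'
  have hx : Measurable x := measurable_from_top
  have hL : MemLp x 2 q.toMeasure := by
    refine MemLp.of_bound hx.aestronglyMeasurable (∑ i, ‖x i‖) (ae_of_all _ fun i => ?_)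
    exact Finset.single_le_sum (f := fun i => ‖x i‖) (fun _ _ => norm_nonneg _) (Finset.mem_univ i)
  refine ⟨⟨⟨q.toMeasure.map x, Measure.isProbabilityMeasure_map hx.aemeasurable⟩,
    (memLp_map_measure_iff aestronglyMeasurable_id hx.aemeasurable).2 hL⟩, fun ξ => ?_⟩
  change ∫ y, wave ξ y ∂(q.toMeasure.map x) = _
  rw [integral_map hx.aemeasurable (continuous_wave_right ξ).aestronglyMeasurable,
    PMF.integral_eq_sum]
  refine Finset.sum_congr rfl fun i _ => ?_
  simp [q, ENNReal.toReal_ofReal (hp i)]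

/-! ### Polarization: from powers of sums to permanents -/

section Polarization

variable {ι : Type*} [Fintype ι] [DecidableEq ι]

/-- The permanent as an alternating sum of products of partial row sums. -/
lemma sum_powerset_prod_sum (z : ι → ι → ℂ) :
    ∑ J ∈ (Finset.univ : Finset ι).powerset,
      (∏ _l ∈ Finset.univ \ J, (-1 : ℂ)) * ∏ i, ∑ l ∈ J, z l i =
    ∑ σ : Equiv.Perm ι, ∏ i, z (σ i) i := by
  have h1 : ∀ J : Finset ι, ∏ i, ∑ l ∈ J, z l i =
      ∑ p : ι → ι, if ∀ i, p i ∈ J then ∏ i, z (p i) i else 0 := fun J => by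
    rw [Finset.prod_univ_sum, ← Finset.sum_filter]
    refine Finset.sum_congr ?_ fun _ _ => rfl
    ext p
    simp [Fintype.mem_piFinset]
  have h2 : ∀ p : ι → ι, ∑ J ∈ (Finset.univ : Finset ι).powerset,
      (∏ _l ∈ Finset.univ \ J, (-1 : ℂ)) * (if ∀ i, p i ∈ J then ∏ i, z (p i) i else 0) =
      if Function.Surjective p then ∏ i, z (p i) i else 0 := fun p => by
    have h3 : ∀ J : Finset ι, (∏ _l ∈ Finset.univ \ J, (-1 : ℂ)) *
        (if ∀ i, p i ∈ J then ∏ i, z (p i) i else 0) =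
        ((∏ _l ∈ J, (1 : ℂ)) * ∏ l ∈ Finset.univ \ J, if ∃ i, p i = l then (0 : ℂ) else -1) *
          ∏ i, z (p i) i := fun J => by
      rw [Finset.prod_const_one, one_mul]
      split_ifs with h
      · congr 1
        refine Finset.prod_congr rfl fun l hl => ?_
        rw [if_neg]
        rintro ⟨i, rfl⟩
        exact (Finset.mem_sdiff.1 hl).2 (h i)
      · push Not at h
        obtain ⟨i, hi⟩ := h
        rw [mul_zero, Finset.prod_eq_zero (i := p i) (by simpa using hi), zero_mul]
        rw [if_pos ⟨i, rfl⟩]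
    simp_rw [h3]
    rw [← Finset.sum_mul, ← Finset.prod_add]
    split_ifs with hs
    · rw [Finset.prod_eq_one, one_mul]
      intro l _
      rw [if_pos (hs l), add_zero]
    · unfold Function.Surjective at hs
      push Not at hs
      obtain ⟨l, hl⟩ := hs
      rw [Finset.prod_eq_zero (Finset.mem_univ l), zero_mul]
      rw [if_neg, add_neg_cancel]
      rintro ⟨i, hi⟩
      exact hl i hi
  simp_rw [h1, Finset.mul_sum]
  rw [Finset.sum_comm]
  simp_rw [h2]
  symm
  refine Finset.sum_of_injOn (fun σ : Equiv.Perm ι => (σ : ι → ι)) ?_ ?_ ?_ ?_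
  · exact fun σ _ τ _ h => DFunLike.coe_injective h
  · exact fun σ _ => Finset.mem_coe.2 (Finset.mem_univ _)
  · intro p _ hp
    rw [if_neg]
    intro hs
    exact hp ⟨Equiv.ofBijective p (Finite.injective_iff_bijective.1
      (Finite.injective_iff_surjective.2 hs)), by simp, rfl⟩
  · intro σ _
    rw [if_pos σ.surjective]

end Polarization

/-- Once the lower coefficients vanish, the tail is at most t^{k+1} Σ‖c j‖. Dividing by t^k and
letting t → 0 kills c k. -/
lemma eq_zero_of_powerSeries_eq_zero {c : ℕ+ → ℂ} (hc : Summable fun k => ‖c k‖)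
    (h : ∀ t : ℝ, 0 < t → t ≤ 1 → ∑' k : ℕ+, (t : ℂ) ^ (k : ℕ) * c k = 0) (k : ℕ+) : c k = 0 := by
  induction k using PNat.strongInductionOn with
  | _ k ih =>
    set M := ∑' j, ‖c j‖
    have hM : 0 ≤ M := tsum_nonneg fun _ => norm_nonneg _
    have key : ∀ t : ℝ, 0 < t → t ≤ 1 → ‖c k‖ ≤ t * M := by
      intro t ht ht1
      have hle : ∀ j : ℕ+, ‖(t : ℂ) ^ (j : ℕ) * c j‖ ≤ ‖c j‖ := fun j => by
        rw [norm_mul, norm_pow, Complex.norm_real, Real.norm_eq_abs, abs_of_pos ht]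
        exact mul_le_of_le_one_left (norm_nonneg _) (pow_le_one₀ ht.le ht1)
      have hs : Summable fun j : ℕ+ => (t : ℂ) ^ (j : ℕ) * c j :=
        Summable.of_norm_bounded hc hle
      have e := h t ht ht1
      rw [hs.tsum_eq_add_tsum_ite k, add_eq_zero_iff_eq_neg] at e
      have hle2 : ∀ j : ℕ+, ‖if j = k then 0 else (t : ℂ) ^ (j : ℕ) * c j‖ ≤
          t ^ ((k : ℕ) + 1) * ‖c j‖ := fun j => by
        split_ifs with hjk
        · rw [norm_zero]; positivity
        · rcases lt_or_gt_of_ne hjk with hlt | hgt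
          · rw [ih j hlt, mul_zero, norm_zero, mul_zero]
          · rw [norm_mul, norm_pow, Complex.norm_real, Real.norm_eq_abs, abs_of_pos ht]
            refine mul_le_mul_of_nonneg_right ?_ (norm_nonneg _)
            exact pow_le_pow_of_le_one ht.le ht1 (Nat.succ_le_of_lt hgt)
      have hn : ‖(t : ℂ) ^ (k : ℕ) * c k‖ ≤ t ^ ((k : ℕ) + 1) * M := by
        rw [e, norm_neg, ← tsum_mul_left]
        exact tsum_of_norm_bounded (hc.mul_left _).hasSum hle2
      rw [norm_mul, norm_pow, Complex.norm_real, Real.norm_eq_abs, abs_of_pos ht, pow_succ,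
        mul_assoc] at hn
      exact le_of_mul_le_mul_left hn (pow_pos ht _)
    have : ‖c k‖ ≤ 0 := by
      refine le_of_forall_pos_le_add fun ε hε => ?_
      have hm : 0 < min 1 (ε / (M + 1)) := by positivity
      refine (key _ hm (min_le_left _ _)).trans ?_
      rw [zero_add]
      calc min 1 (ε / (M + 1)) * M ≤ ε / (M + 1) * M := by gcongr; exact min_le_right _ _
        _ ≤ ε := by rw [div_mul_eq_mul_div, div_le_iff₀ (by positivity)]; nlinarith
    exact norm_le_zero_iff.1 this

/-! ### Sending an atom to infinity -/

section RiemannLebesgue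

variable {ι : Type*} [Fintype ι] [DecidableEq ι]

/-- The waves combine into one oscillation with phase n L, where L ξ = Σ ⟨e, ξ j⟩ over j in t is a
nonzero functional. The Riemann–Lebesgue lemma applies as n L → ∞. -/
lemma tendsto_integral_mul_prod_wave {f : (ι → E d) → ℂ} {e : E d} (he : e ≠ 0)
    {t : Finset ι} (ht : t.Nonempty) :
    Tendsto (fun n : ℕ => ∫ ξ, f ξ * ∏ j ∈ t, wave (ξ j) ((n : ℝ) • e)) atTop (𝓝 0) := by
  let L : StrongDual ℝ (ι → E d) :=
    ∑ j ∈ t, (innerSL ℝ e).comp (ContinuousLinearMap.proj j : (ι → E d) →L[ℝ] E d)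
  have hL : ∀ ξ, L ξ = ∑ j ∈ t, inner ℝ e (ξ j) := fun ξ => by
    simp [L, sum_apply]
  have hL0 : L ≠ 0 := by
    obtain ⟨j, hj⟩ := ht
    intro h
    have h1 : L (Pi.single j e) = 0 := by rw [h]; rfl
    rw [hL, Finset.sum_eq_single j] at h1
    · rw [Pi.single_eq_same, real_inner_self_eq_norm_sq] at h1
      exact he (norm_eq_zero.1 (pow_eq_zero_iff two_ne_zero |>.1 h1))
    · intro i _ hij
      rw [Pi.single_eq_of_ne hij, inner_zero_right]
    · exact fun h => absurd hj h
  have hlim : Tendsto (fun n : ℕ => (n : ℝ) • L) atTop (cocompact (StrongDual ℝ (ι → E d))) := by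
    rw [← Metric.cobounded_eq_cocompact, ← tendsto_norm_atTop_iff_cobounded]
    simp_rw [norm_smul, Real.norm_natCast]
    exact tendsto_natCast_atTop_atTop.atTop_mul_const (norm_pos_iff.2 hL0)
  refine ((tendsto_integral_exp_smul_cocompact f volume).comp hlim).congr fun n => ?_
  refine integral_congr_ae (ae_of_all _ fun ξ => ?_)
  simp only [Circle.smul_def, Real.fourierChar_apply, smul_eq_mul, wave]
  rw [mul_comm, ← Complex.exp_sum, ← Finset.mul_sum]
  congr 2
  rw [smul_apply, hL]
  simp_rw [real_inner_smul_right, real_inner_comm e]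
  rw [← Complex.ofReal_sum, ← Finset.mul_sum, smul_eq_mul]
  push_cast
  ring

/-- After expansion of the product over subsets t, every term with a factor from the receding atom
oscillates away; only t = ∅ remains. -/
lemma tendsto_integral_mul_prod_add {f : (ι → E d) → ℂ} (hf : Integrable f) {e : E d} (he : e ≠ 0)
    {A : E d → ℂ} (hA : Continuous A) {M : ℝ} (hM : ∀ ξ, ‖A ξ‖ ≤ M) (c : ℂ) :
    Tendsto (fun n : ℕ => ∫ ξ, f ξ * ∏ j, (c * wave (ξ j) ((n : ℝ) • e) + A (ξ j))) atTop
      (𝓝 (∫ ξ, f ξ * ∏ j, A (ξ j))) := by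
  let G : Finset ι → (ι → E d) → ℂ := fun t ξ =>
    f ξ * ((∏ _j ∈ t, c) * ∏ j ∈ Finset.univ \ t, A (ξ j))
  have hM0 : 0 ≤ M := (norm_nonneg _).trans (hM 0)
  have hG : ∀ t, Integrable (G t) := fun t => by
    refine hf.mul_bdd (c := ‖∏ _j ∈ t, c‖ * M ^ (Finset.univ \ t).card) ?_
      (ae_of_all _ fun ξ => ?_)
    · refine Continuous.aestronglyMeasurable (continuous_const.mul ?_)
      exact continuous_finsetProd _ fun j _ => hA.comp (continuous_apply j)
    · rw [norm_mul]
      refine mul_le_mul_of_nonneg_left ?_ (norm_nonneg _)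
      rw [norm_prod]
      exact (Finset.prod_le_prod (fun _ _ => norm_nonneg _) fun j _ => hM _).trans_eq
        (Finset.prod_const _)
  have hGw : ∀ t (n : ℕ), Integrable
      (fun ξ => G t ξ * ∏ j ∈ t, wave (ξ j) ((n : ℝ) • e)) := fun t n => by
    refine (hG t).mul_bdd (c := 1) ?_ (ae_of_all _ fun ξ => ?_)
    · refine Continuous.aestronglyMeasurable ?_
      exact continuous_finsetProd _ fun j _ => (continuous_wave_left _).comp (continuous_apply j)
    · exact norm_prod_le_one' t fun j => (norm_wave _ _).le
  have hexp : ∀ n : ℕ, ∫ ξ, f ξ * ∏ j, (c * wave (ξ j) ((n : ℝ) • e) + A (ξ j)) =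
      ∑ t ∈ (Finset.univ : Finset ι).powerset,
        ∫ ξ, G t ξ * ∏ j ∈ t, wave (ξ j) ((n : ℝ) • e) := fun n => by
    rw [← integral_finsetSum _ fun t _ => hGw t n]
    refine integral_congr_ae (ae_of_all _ fun ξ => ?_)
    simp only [G]
    rw [Finset.prod_add, Finset.mul_sum]
    refine Finset.sum_congr rfl fun t _ => ?_
    rw [Finset.prod_mul_distrib]
    ring
  simp_rw [hexp]
  have hlim : ∫ ξ, f ξ * ∏ j, A (ξ j) =
      ∑ t ∈ (Finset.univ : Finset ι).powerset, if t = ∅ then ∫ ξ, f ξ * ∏ j, A (ξ j) else 0 := by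
    rw [Finset.sum_ite_eq' _ ∅, if_pos (Finset.empty_mem_powerset _)]
  rw [hlim]
  refine tendsto_finsetSum _ fun t _ => ?_
  split_ifs with h
  · subst h
    simp [G]
  · exact tendsto_integral_mul_prod_wave he (Finset.nonempty_iff_ne_empty.2 h)

end RiemannLebesgue

/-! ### Injectivity of the Fourier transform on integrable functions -/

section Injectivity

variable {V : Type*} [NormedAddCommGroup V] [NormedSpace ℝ V] [MeasurableSpace V] [BorelSpace V]
  [SecondCountableTopology V] [CompleteSpace V] {μ : Measure V}

/-- The positive and negative parts are densities of two finite measures with the same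
characteristic function, so they agree almost everywhere; as one of them vanishes at each point, so
does u. -/
lemma ae_eq_zero_of_integral_exp_real {u : V → ℝ} (hu : Integrable u μ)
    (h : ∀ L : StrongDual ℝ V, ∫ v, (u v : ℂ) * Complex.exp ((L v : ℂ) * Complex.I) ∂μ = 0) :
    u =ᵐ[μ] 0 := by
  have := isFiniteMeasure_withDensity_ofReal hu.2
  have := isFiniteMeasure_withDensity_ofReal hu.neg.2
  have hum : AEMeasurable (fun v => ENNReal.ofReal (u v)) μ := hu.1.aemeasurable.ennreal_ofReal
  have hum' : AEMeasurable (fun v => ENNReal.ofReal ((-u) v)) μ :=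
    hu.neg.1.aemeasurable.ennreal_ofReal
  have hexp : ∀ L : StrongDual ℝ V, ∀ v, ‖Complex.exp ((L v : ℂ) * Complex.I)‖ = 1 := fun L v =>
    Complex.norm_exp_ofReal_mul_I (L v)
  have hint : ∀ L : StrongDual ℝ V, ∀ w : V → ℝ, Integrable w μ → Integrable
      (fun v => (ENNReal.ofReal (w v)).toReal • Complex.exp ((L v : ℂ) * Complex.I)) μ := by
    intro L w hw
    refine hw.norm.mono' ?_ (ae_of_all _ fun v => ?_)
    · refine (hw.1.aemeasurable.ennreal_ofReal.ennreal_toReal.aestronglyMeasurable).smul ?_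
      exact Continuous.aestronglyMeasurable (by fun_prop)
    · rw [norm_smul, hexp, mul_one, Real.norm_eq_abs, abs_of_nonneg ENNReal.toReal_nonneg,
        ENNReal.toReal_ofReal']
      exact max_le (le_abs_self _) (abs_nonneg _)
  have heq : μ.withDensity (fun v => ENNReal.ofReal (u v)) =
      μ.withDensity (fun v => ENNReal.ofReal ((-u) v)) := by
    refine Measure.ext_of_charFunDual (funext fun L => ?_)
    rw [charFunDual_apply, charFunDual_apply, integral_withDensity_eq_integral_toReal_smul₀ hum
      (ae_of_all _ fun v => ENNReal.ofReal_lt_top), integral_withDensity_eq_integral_toReal_smul₀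
      hum' (ae_of_all _ fun v => ENNReal.ofReal_lt_top), ← sub_eq_zero,
      ← integral_sub (hint L u hu) (hint L (-u) hu.neg), ← h L]
    refine integral_congr_ae (ae_of_all _ fun v => ?_)
    simp only
    rw [← sub_smul, Pi.neg_apply, ENNReal.toReal_ofReal', ENNReal.toReal_ofReal',
      ← Complex.real_smul]
    congr 1
    rcases le_total (u v) 0 with hv | hv
    · rw [max_eq_right hv, max_eq_left (by linarith)]; ring
    · rw [max_eq_left hv, max_eq_right (by linarith)]; ring
  have hae := (withDensity_eq_iff hum hum' (by
    have := hu.2.lt_top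
    refine (lt_of_le_of_lt (lintegral_mono fun v => ?_) this).ne
    exact Real.ofReal_le_enorm _)).1 heq
  filter_upwards [hae] with v hv
  simp only [Pi.neg_apply] at hv
  rcases le_total (u v) 0 with h0 | h0
  · rw [ENNReal.ofReal_of_nonpos h0, eq_comm, ENNReal.ofReal_eq_zero] at hv
    simp only [Pi.zero_apply]; linarith
  · rw [ENNReal.ofReal_of_nonpos (by linarith : -u v ≤ 0), ENNReal.ofReal_eq_zero] at hv
    simp only [Pi.zero_apply]; linarith

/-- Conjugating the hypothesis at -L gives it for the conjugate of f. It therefore passes to the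
real and imaginary parts. -/
lemma ae_eq_zero_of_integral_exp {f : V → ℂ} (hf : Integrable f μ)
    (h : ∀ L : StrongDual ℝ V, ∫ v, f v * Complex.exp ((L v : ℂ) * Complex.I) ∂μ = 0) :
    f =ᵐ[μ] 0 := by
  have hi : ∀ L : StrongDual ℝ V,
      Integrable (fun v => f v * Complex.exp ((L v : ℂ) * Complex.I)) μ := fun L => by
    refine hf.mul_bdd (c := 1) (Continuous.aestronglyMeasurable (by fun_prop))
      (ae_of_all _ fun v => ?_)
    rw [Complex.norm_exp_ofReal_mul_I]
  have hconj : ∀ L : StrongDual ℝ V,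
      ∫ v, (starRingEnd ℂ) (f v) * Complex.exp ((L v : ℂ) * Complex.I) ∂μ = 0 := fun L => by
    have := congrArg (starRingEnd ℂ) (h (-L))
    rw [← integral_conj, map_zero] at this
    rw [← this]
    refine integral_congr_ae (ae_of_all _ fun v => ?_)
    simp only
    rw [map_mul, ← Complex.exp_conj]
    simp
  have hci : ∀ L : StrongDual ℝ V,
      Integrable (fun v => (starRingEnd ℂ) (f v) * Complex.exp ((L v : ℂ) * Complex.I)) μ :=
    fun L => by
    have hc : Integrable (fun v => (starRingEnd ℂ) (f v)) μ :=
      hf.norm.mono' (Complex.continuous_conj.comp_aestronglyMeasurable hf.1)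
        (ae_of_all _ fun v => by simp)
    refine hc.mul_bdd (c := 1) (Continuous.aestronglyMeasurable (by fun_prop))
      (ae_of_all _ fun v => ?_)
    rw [Complex.norm_exp_ofReal_mul_I]
  have hre := ae_eq_zero_of_integral_exp_real hf.re fun L => by
    have e : ∀ v, ((RCLike.re (f v) : ℝ) : ℂ) * Complex.exp ((L v : ℂ) * Complex.I) =
        (f v * Complex.exp ((L v : ℂ) * Complex.I) +
          (starRingEnd ℂ) (f v) * Complex.exp ((L v : ℂ) * Complex.I)) * (1 / 2) := fun v => by
      rw [← add_mul, Complex.add_conj, RCLike.re_to_complex]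
      push_cast
      ring
    simp_rw [e]
    rw [integral_mul_const, integral_add (hi L) (hci L), h L, hconj L]
    simp
  have him := ae_eq_zero_of_integral_exp_real hf.im fun L => by
    have e : ∀ v, ((RCLike.im (f v) : ℝ) : ℂ) * Complex.exp ((L v : ℂ) * Complex.I) =
        (f v * Complex.exp ((L v : ℂ) * Complex.I) -
          (starRingEnd ℂ) (f v) * Complex.exp ((L v : ℂ) * Complex.I)) * (1 / (2 * Complex.I)) :=
      fun v => by
      rw [← sub_mul, Complex.sub_conj, RCLike.im_to_complex]
      have := Complex.I_ne_zero
      push_cast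
      field_simp
    simp_rw [e]
    rw [integral_mul_const, integral_sub (hi L) (hci L), h L, hconj L]
    simp
  filter_upwards [hre, him] with v h1 h2
  exact Complex.ext h1 h2

end Injectivity

lemma ae_eq_zero_of_integral_prod_wave {ι : Type*} [Fintype ι] [DecidableEq ι]
    {f : (ι → E d) → ℂ} (hf : Integrable f)
    (h : ∀ x : ι → E d, ∫ ξ, f ξ * ∏ j, wave (ξ j) (x j) = 0) : f =ᵐ[volume] 0 := by
  refine ae_eq_zero_of_integral_exp hf fun L => ?_
  let x : ι → E d := fun j => (-(2 * Real.pi)⁻¹) • (InnerProductSpace.toDual ℝ (E d)).symm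
    (L.comp (ContinuousLinearMap.single ℝ (fun _ => E d) j))
  rw [← h x]
  refine integral_congr_ae (ae_of_all _ fun ξ => ?_)
  simp only [wave]
  rw [← Complex.exp_sum, ← Finset.mul_sum]
  congr 2
  have hL : L ξ = ∑ j, (L.comp (ContinuousLinearMap.single ℝ (fun _ => E d) j)) (ξ j) :=
    (ContinuousLinearMap.sum_comp_single ℝ (fun _ => E d) L ξ).symm
  have hx : ∀ j, inner ℝ (ξ j) (x j) = -(2 * Real.pi)⁻¹ *
      (L.comp (ContinuousLinearMap.single ℝ (fun _ => E d) j)) (ξ j) := fun j => by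
    rw [real_inner_smul_right, real_inner_comm, InnerProductSpace.toDual_symm_apply]
  simp_rw [hx]
  rw [← Complex.ofReal_sum, ← Finset.mul_sum, ← hL]
  have : (Real.pi : ℂ) ≠ 0 := by exact_mod_cast Real.pi_ne_zero
  push_cast
  field_simp

/-- Permuting the points amounts to permuting the frequencies, which preserves both f and Lebesgue
measure. -/
lemma integral_mul_prod_wave_perm {ι : Type*} [Fintype ι] [DecidableEq ι] {f : (ι → E d) → ℂ}
    (hsymm : ∀ (σ : Equiv.Perm ι) ξ, f (fun j => ξ (σ j)) = f ξ) (x : ι → E d)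
    (σ : Equiv.Perm ι) :
    ∫ ξ, f ξ * ∏ j, wave (ξ j) (x (σ j)) = ∫ ξ, f ξ * ∏ j, wave (ξ j) (x j) := by
  rw [← (volume_measurePreserving_piCongrLeft (fun _ : ι => E d) σ).integral_comp'
    (fun ξ => f ξ * ∏ j, wave (ξ j) (x j))]
  refine integral_congr_ae (ae_of_all _ fun ξ => ?_)
  have e : ∀ i, (MeasurableEquiv.piCongrLeft (fun _ : ι => E d) σ) ξ (σ i) = ξ i := fun i =>
    Equiv.piCongrLeft_apply_apply (fun _ : ι => E d) σ ξ i
  simp only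
  rw [← hsymm σ ((MeasurableEquiv.piCongrLeft (fun _ : ι => E d) σ) ξ)]
  simp_rw [e]
  rw [← Equiv.prod_comp σ fun j =>
    wave ((MeasurableEquiv.piCongrLeft (fun _ : ι => E d) σ) ξ j) (x j)]
  simp_rw [e]

/-- It suffices to annihilate all products of k waves, at points x₁, …, x_k. Positive dimension
provides a direction e along which an auxiliary atom can escape. -/
theorem ae_eq_zero_of_integral_hatProd (hd : 0 < d) {w : Freq d → ℂ}
    (hw : Integrable w freqMeasure)
    (hsymm : ∀ (k : ℕ+) (σ : Equiv.Perm (Fin k)) (ξ : Fin k → E d),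
      w ⟨k, fun j => ξ (σ j)⟩ = w ⟨k, ξ⟩)
    (h : ∀ m : P2 d, ∫ z, w z * hatProd m z ∂freqMeasure = 0) (k : ℕ+) :
    (fun ξ : Fin k → E d => w ⟨k, ξ⟩) =ᵐ[volume] 0 := by
  classical
  have hwk := integrable_freq_section hw k
  refine ae_eq_zero_of_integral_prod_wave hwk fun x => ?_
  let e : E d := coordVec ⟨0, hd⟩
  have he : e ≠ 0 := by simp [e, coordVec]
  have hk : (0 : ℝ) < (k : ℕ) := by exact_mod_cast k.pos
  -- vanishing for sub-probability combinations of the points `x l`, in every degree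
  have hvan : ∀ J : Finset (Fin k), ∫ ξ : Fin k → E d, w ⟨k, ξ⟩ *
      ∏ j, ∑ l ∈ J, wave (ξ j) (x l) = 0 := by
    intro J
    -- Mass 1/k at each of at most k points keeps the total mass at most 1. In degree k this
    -- introduces only a nonzero constant factor.
    let B : E d → ℂ := fun ξ => ∑ l ∈ J, (((k : ℕ) : ℝ)⁻¹ : ℂ) * wave ξ (x l)
    have hBc : Continuous B := continuous_finsetSum _ fun l _ =>
      continuous_const.mul (continuous_wave_left _)
    have hB1 : ∀ ξ, ‖B ξ‖ ≤ 1 := fun ξ => by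
      refine (norm_sum_le _ _).trans ?_
      simp only [norm_mul, norm_wave, mul_one, norm_inv, Complex.norm_real, Real.norm_natCast,
        Finset.sum_const, nsmul_eq_mul]
      rw [← div_eq_mul_inv, div_le_one hk]
      exact_mod_cast (Finset.card_le_univ J).trans (by simp)
    have hpow : ∀ t : ℝ, 0 < t → t ≤ 1 → ∑' n : ℕ+, (t : ℂ) ^ (n : ℕ) *
        ∫ ξ : Fin n → E d, w ⟨n, ξ⟩ * ∏ j, B (ξ j) = 0 := by
      intro t ht ht1
      let s : ℝ := t * ∑ _l ∈ J, ((k : ℕ) : ℝ)⁻¹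
      have hs0 : 0 ≤ s := by positivity
      have hs1 : s ≤ 1 := by
        refine mul_le_one₀ ht1 (by positivity) ?_
        rw [Finset.sum_const, nsmul_eq_mul, ← div_eq_mul_inv, div_le_one hk]
        exact_mod_cast (Finset.card_le_univ J).trans (by simp)
      -- A probability vector: mass t/k at each x l with l ∈ J, and the remaining mass 1 - s on the
      -- escaping atom `none`.
      let p : Option (Fin k) → ℝ
        | none => 1 - s
        | some l => if l ∈ J then t * ((k : ℕ) : ℝ)⁻¹ else 0
      have hp0 : ∀ i, 0 ≤ p i := by
        rintro (_ | l)
        · simp only [p]; linarith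
        · simp only [p]; split_ifs <;> positivity
      have hp1 : ∑ i, p i = 1 := by
        rw [Fintype.sum_option]
        simp only [p, Finset.sum_ite_mem, Finset.univ_inter, ← Finset.mul_sum]
        simp [s]
      have hm : ∀ n : ℕ, ∃ m : P2 d, ∀ ξ, hat m ξ =
          ((1 - s : ℝ) : ℂ) * wave ξ ((n : ℝ) • e) + t * B ξ := fun n => by
        obtain ⟨m, hm⟩ := exists_discrete p hp0 hp1 fun i => i.elim ((n : ℝ) • e) x
        refine ⟨m, fun ξ => ?_⟩
        rw [hm, Fintype.sum_option]
        congr 1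
        simp only [p, Option.elim, B, Finset.mul_sum]
        rw [← Finset.sum_subset (Finset.subset_univ J)]
        · refine Finset.sum_congr rfl fun l hl => ?_
          rw [if_pos hl]
          push_cast
          ring
        · intro l _ hl
          rw [if_neg hl]
          simp
      choose m hm using hm
      -- The escaping atom disappears degree by degree, and the integrals of ‖w‖ dominate the sum
      -- over degrees. The scaling t of the surviving mass then appears as t^i in degree i.
      have hlim : Tendsto (fun n : ℕ => ∑' i : ℕ+, ∫ ξ : Fin i → E d,
          w ⟨i, ξ⟩ * hatProd (m n) ⟨i, ξ⟩) atTop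
          (𝓝 (∑' i : ℕ+, ∫ ξ : Fin i → E d, w ⟨i, ξ⟩ * ∏ j, (t * B (ξ j)))) := by
        refine tendsto_tsum_of_dominated_convergence (summable_integral_norm_freq hw)
          (fun i => ?_) (Eventually.of_forall fun n i => ?_)
        · simp only [hatProd, hm]
          exact tendsto_integral_mul_prod_add (A := fun ξ => (t : ℂ) * B ξ)
            (integrable_freq_section hw i) he
            (continuous_const.mul hBc) (M := t) (fun ξ => by
              rw [norm_mul, Complex.norm_real, Real.norm_eq_abs, abs_of_pos ht]
              exact mul_le_of_le_one_right ht.le (hB1 ξ)) _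
        · refine norm_integral_le_of_norm_le (integrable_freq_section hw i).norm
            (ae_of_all _ fun ξ => ?_)
          rw [norm_mul]
          exact mul_le_of_le_one_right (norm_nonneg _) (norm_hatProd_le _ _)
      have hz : ∀ n : ℕ, ∑' i : ℕ+, ∫ ξ : Fin i → E d, w ⟨i, ξ⟩ * hatProd (m n) ⟨i, ξ⟩ = 0 :=
        fun n => by
        rw [(hasSum_integral_freq (Integrable.mul_hatProd hw (m n))).tsum_eq, h]
      simp_rw [hz] at hlim
      rw [tendsto_nhds_unique tendsto_const_nhds hlim]
      refine tsum_congr fun i => ?_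
      rw [← integral_const_mul]
      refine integral_congr_ae (ae_of_all _ fun ξ => ?_)
      simp only [Finset.prod_mul_distrib, Finset.prod_const, Finset.card_univ, Fintype.card_fin]
      ring
    have hsum : Summable fun n : ℕ+ => ‖∫ ξ : Fin n → E d, w ⟨n, ξ⟩ * ∏ j, B (ξ j)‖ := by
      refine Summable.of_nonneg_of_le (fun _ => norm_nonneg _) (fun n => ?_)
        (summable_integral_norm_freq hw)
      refine norm_integral_le_of_norm_le (integrable_freq_section hw n).norm
        (ae_of_all _ fun ξ => ?_)
      rw [norm_mul]
      exact mul_le_of_le_one_right (norm_nonneg _) (norm_prod_le_one' _ fun j => hB1 (ξ j))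
    have := eq_zero_of_powerSeries_eq_zero hsum hpow k
    simp only [B, ← Finset.mul_sum, Finset.prod_mul_distrib, Finset.prod_const] at this
    simp_rw [mul_left_comm] at this
    rw [integral_const_mul] at this
    refine (mul_eq_zero.1 this).resolve_left (pow_ne_zero _ (inv_ne_zero ?_))
    exact_mod_cast hk.ne'
  have hint : ∀ J : Finset (Fin k), Integrable fun ξ : Fin k → E d =>
      w ⟨k, ξ⟩ * ∏ j, ∑ l ∈ J, wave (ξ j) (x l) := fun J => by
    refine hwk.mul_bdd (c := (J.card : ℝ) ^ (Finset.univ : Finset (Fin k)).card) ?_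
      (ae_of_all _ fun ξ => ?_)
    · refine Continuous.aestronglyMeasurable ?_
      exact continuous_finsetProd _ fun j _ => continuous_finsetSum _ fun l _ =>
        (continuous_wave_left _).comp (continuous_apply j)
    · rw [norm_prod]
      refine (Finset.prod_le_prod (fun _ _ => norm_nonneg _) fun j _ =>
        (norm_sum_le _ _).trans_eq ?_).trans_eq (Finset.prod_const _)
      simp
  have hintσ : ∀ σ : Equiv.Perm (Fin k), Integrable fun ξ : Fin k → E d =>
      w ⟨k, ξ⟩ * ∏ j, wave (ξ j) (x (σ j)) := fun σ => by
    refine hwk.mul_bdd (c := 1) ?_ (ae_of_all _ fun ξ => ?_)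
    · refine Continuous.aestronglyMeasurable ?_
      exact continuous_finsetProd _ fun j _ => (continuous_wave_left _).comp (continuous_apply j)
    · exact norm_prod_le_one' _ fun j => (norm_wave _ _).le
  have hpol : ∑ σ : Equiv.Perm (Fin k), ∫ ξ : Fin k → E d,
      w ⟨k, ξ⟩ * ∏ j, wave (ξ j) (x (σ j)) = 0 := by
    rw [← integral_finsetSum _ fun σ _ => hintσ σ]
    have : ∀ ξ : Fin k → E d, ∑ σ : Equiv.Perm (Fin k), w ⟨k, ξ⟩ * ∏ j, wave (ξ j) (x (σ j)) =
        ∑ J ∈ (Finset.univ : Finset (Fin k)).powerset, (∏ _l ∈ Finset.univ \ J, (-1 : ℂ)) *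
          (w ⟨k, ξ⟩ * ∏ j, ∑ l ∈ J, wave (ξ j) (x l)) := fun ξ => by
      rw [← Finset.mul_sum, ← sum_powerset_prod_sum fun l j => wave (ξ j) (x l), Finset.mul_sum]
      exact Finset.sum_congr rfl fun J _ => mul_left_comm _ _ _
    simp_rw [this]
    rw [integral_finsetSum _ fun J _ => (hint J).const_mul _]
    refine Finset.sum_eq_zero fun J _ => ?_
    rw [integral_const_mul, hvan J, mul_zero]
  -- Symmetry makes all k! terms of the polarized sum equal, so each of them vanishes.
  simp_rw [integral_mul_prod_wave_perm (f := fun ξ : Fin k → E d => w ⟨k, ξ⟩) (hsymm k) x] at hpol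
  rw [Finset.sum_const, nsmul_eq_mul, mul_eq_zero] at hpol
  refine hpol.resolve_left ?_
  simp [Fintype.card_perm, Nat.factorial_ne_zero]

theorem HasCoeffs.ae_eq (hd : 0 < d) {F : P2 d → ℂ} {a b : Coeffs d} (ha : HasCoeffs F a)
    (hb : HasCoeffs F b) (k : ℕ+) : a k =ᵐ[volume] b k := by
  obtain ⟨ia, ea⟩ := ha.eq_integral
  obtain ⟨ib, eb⟩ := hb.eq_integral
  have := ae_eq_zero_of_integral_hatProd hd (ia.sub ib) (fun k σ ξ => ?_) (fun m => ?_) k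
  · filter_upwards [this] with ξ hξ
    simp only [Pi.sub_apply, Pi.zero_apply, weight, ← mul_sub] at hξ
    refine sub_eq_zero.1 ((mul_eq_zero.1 hξ).resolve_left (inv_ne_zero (mul_ne_zero ?_ ?_)))
    · exact_mod_cast k.ne_zero
    · exact_mod_cast Nat.factorial_ne_zero _
  · simp only [Pi.sub_apply, weight, (ha.1.1 k).2, (hb.1.1 k).2]
  · simp only [Pi.sub_apply, sub_mul]
    rw [integral_sub (Integrable.mul_hatProd ia m) (Integrable.mul_hatProd ib m), ← ea, ← eb,
      sub_self]

lemma coeffs_ae_eq (hd : 0 < d) {F : P2 d → ℂ} {a : Coeffs d} (ha : HasCoeffs F a) (k : ℕ+) :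
    coeffs F k =ᵐ[volume] a k := by
  have h : MemH0 F := ⟨a, ha⟩
  rw [coeffs, dif_pos h]
  exact h.choose_spec.ae_eq hd ha k

end

end WassersteinFourier

namespace WassersteinFourier

noncomputable section

variable {d : ℕ}

/-! ### Calculus for Fourier integrals -/

section Measurability

variable {X : Type*} [MeasurableSpace X]

lemma measurable_coeff {w : Freq d → ℂ} (hw : Measurable w) {k : ℕ+} {f : X → Fin k → E d}
    (hf : Measurable f) : Measurable fun x => w ⟨k, f x⟩ :=
  (hw.comp (measurable_freqMk k)).comp hf

lemma measurable_prod_hat {ι : Type*} (s : Finset ι) (m : P2 d) {f : X → ι → E d}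
    (hf : Measurable f) : Measurable fun x => ∏ i ∈ s, hat m (f x i) :=
  Finset.measurable_fun_prod s fun i _ =>
    (continuous_hat m).measurable.comp ((measurable_pi_apply i).comp hf)

lemma measurable_wave {f g : X → E d} (hf : Measurable f) (hg : Measurable g) :
    Measurable fun x => wave (f x) (g x) := continuous_wave.measurable2 hf hg

lemma measurable_rankOne {f g : X → E d} (hf : Measurable f) (hg : Measurable g) :
    Measurable fun x => InnerProductSpace.rankOne ℝ (f x) (g x) := by
  have : Continuous fun q : E d × E d => InnerProductSpace.rankOne ℝ q.1 q.2 :=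
    ((InnerProductSpace.rankOne ℝ).continuous.comp continuous_fst).clm_apply continuous_snd
  exact this.measurable2 (c := fun x y => InnerProductSpace.rankOne ℝ x y) hf hg

lemma measurable_eval {ι : Type*} {f : X → ι → E d} (hf : Measurable f) (j : ι) :
    Measurable fun x => f x j := (measurable_pi_apply j).comp hf

variable {w : Freq d → ℂ}

lemma measurable_monoVal (hw : Measurable w) (m : P2 d) :
    Measurable fun z : Freq d => monoVal (w z) z.2 m := by
  refine measurable_freq fun k => ?_
  exact ((measurable_coeff hw measurable_id).mul
    (measurable_prod_hat Finset.univ m (measurable_id (α := Fin k → E d)))).re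

lemma measurable_monoPot (hw : Measurable w) (m : P2 d) (x : E d) :
    Measurable fun z : Freq d => monoPot (w z) z.2 m x := by
  refine measurable_freq fun k => ?_
  refine Finset.measurable_fun_sum (f := fun j (ξ : Fin k → E d) => (w ⟨k, ξ⟩ *
    ((wave (ξ j) x - 1) * ∏ i ∈ Finset.univ.erase j, hat m (ξ i))).re)
    Finset.univ fun j _ => ?_
  have h0 : Measurable fun ξ : Fin k → E d => ξ := measurable_id
  exact ((measurable_coeff hw h0).mul (((measurable_wave (measurable_eval h0 j)
    measurable_const).sub_const 1).mul (measurable_prod_hat _ m h0))).re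

lemma measurable_monoGrad (hw : Measurable w) (m : P2 d) :
    Measurable fun q : Freq d × E d => monoGrad (w q.1) q.1.2 m q.2 := by
  refine measurable_freq_prod fun k => ?_
  refine Finset.measurable_fun_sum (f := fun j (q : (Fin k → E d) × E d) => (w ⟨k, q.1⟩ * tau *
    (wave (q.1 j) q.2 * ∏ i ∈ Finset.univ.erase j, hat m (q.1 i))).re • q.1 j)
    Finset.univ fun j _ => ?_
  have h0 : Measurable fun q : (Fin k → E d) × E d => q.1 := measurable_fst
  exact (((measurable_coeff hw h0).mul_const tau).mul
    ((measurable_wave (measurable_eval h0 j) measurable_snd).mul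
      (measurable_prod_hat _ m h0))).re.smul (measurable_eval h0 j)

lemma measurable_monoHess₁ (hw : Measurable w) (m : P2 d) :
    Measurable fun q : Freq d × E d => monoHess₁ (w q.1) q.1.2 m q.2 := by
  refine measurable_freq_prod fun k => ?_
  refine Finset.measurable_fun_sum (f := fun j (q : (Fin k → E d) × E d) =>
    (w ⟨k, q.1⟩ * tau ^ 2 *
      (wave (q.1 j) q.2 * ∏ i ∈ Finset.univ.erase j, hat m (q.1 i))).re •
    InnerProductSpace.rankOne ℝ (q.1 j) (q.1 j)) Finset.univ fun j _ => ?_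
  have h0 : Measurable fun q : (Fin k → E d) × E d => q.1 := measurable_fst
  exact (((measurable_coeff hw h0).mul_const (tau ^ 2)).mul
    ((measurable_wave (measurable_eval h0 j) measurable_snd).mul
      (measurable_prod_hat _ m h0))).re.smul
    (measurable_rankOne (measurable_eval h0 j) (measurable_eval h0 j))

lemma measurable_monoHess₂ (hw : Measurable w) (m : P2 d) :
    Measurable fun q : Freq d × (E d × E d) => monoHess₂ (w q.1) q.1.2 m q.2 := by
  refine measurable_freq_prod fun k => ?_
  refine Finset.measurable_fun_sum (f := fun j (q : (Fin k → E d) × (E d × E d)) =>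
    ∑ i ∈ Finset.univ.erase j, (w ⟨k, q.1⟩ * tau ^ 2 * (wave (q.1 j) q.2.1 *
      wave (q.1 i) q.2.2 * ∏ l ∈ (Finset.univ.erase j).erase i, hat m (q.1 l))).re •
    InnerProductSpace.rankOne ℝ (q.1 j) (q.1 i)) Finset.univ fun j _ => ?_
  refine Finset.measurable_fun_sum _ fun i _ => ?_
  have h0 : Measurable fun q : (Fin k → E d) × (E d × E d) => q.1 := measurable_fst
  exact (((measurable_coeff hw h0).mul_const (tau ^ 2)).mul
    (((measurable_wave (measurable_eval h0 j) measurable_snd.fst).mul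
      (measurable_wave (measurable_eval h0 i) measurable_snd.snd)).mul
      (measurable_prod_hat _ m h0))).re.smul
    (measurable_rankOne (measurable_eval h0 j) (measurable_eval h0 i))

end Measurability

/-- Weights on the frequency space with finite third moment. -/
structure IsRegular (w : Freq d → ℂ) : Prop where
  meas : Measurable w
  integrable : Integrable (fun z => ‖w z‖ * (1 + freqSize z.2) ^ 3) freqMeasure

section Integrals

variable {w : Freq d → ℂ}

lemma IsRegular.const_mul (hw : IsRegular w) (c : ℂ) : IsRegular fun z => c * w z := by
  refine ⟨hw.meas.const_mul c, (hw.integrable.const_mul ‖c‖).congr (ae_of_all _ fun z => ?_)⟩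
  simp only [norm_mul, mul_assoc]

lemma IsRegular.integrable_const (hw : IsRegular w) :
    Integrable (fun z => 2 * ‖w z‖ * (1 + freqSize z.2) ^ 3) freqMeasure := by
  simpa only [mul_assoc] using hw.integrable.const_mul 2

theorem IsRegular.hasExpansion (hw : IsRegular w) :
    HasExpansion (fun m => ∫ z, monoVal (w z) z.2 m ∂freqMeasure)
      (fun m x => ∫ z, monoGrad (w z) z.2 m x ∂freqMeasure)
      (fun m x => ∫ z, monoHess₁ (w z) z.2 m x ∂freqMeasure)
      (fun m p => ∫ z, monoHess₂ (w z) z.2 m p ∂freqMeasure)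
      (fun m x => ∫ z, monoPot (w z) z.2 m x ∂freqMeasure)
      (∫ z, 2 * ‖w z‖ * (1 + freqSize z.2) ^ 3 ∂freqMeasure) :=
  HasExpansion.integral (U := fun z => monoVal (w z) z.2)
    (fun z => monomial_hasExpansion (w z) z.2) hw.integrable_const (measurable_monoVal hw.meas)
    (measurable_monoGrad hw.meas) (measurable_monoHess₁ hw.meas) (measurable_monoHess₂ hw.meas)
    (measurable_monoPot hw.meas)

lemma IsRegular.integrable_mul (hw : IsRegular w) {f : Freq d → ℂ} (hf : Measurable f)
    (hle : ∀ z, ‖f z‖ ≤ 2 * (1 + freqSize z.2) ^ 3) :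
    Integrable (fun z => w z * f z) freqMeasure := by
  refine hw.integrable_const.mono' (hw.meas.mul hf).aestronglyMeasurable
    (ae_of_all _ fun z => ?_)
  rw [norm_mul, mul_comm 2, mul_assoc]
  exact mul_le_mul_of_nonneg_left (hle z) (norm_nonneg _)

/-- Fubini's theorem for fields on the product of the frequency space and a probability space. -/
lemma integral_integral_freq {X V : Type*} [MeasurableSpace X] [NormedAddCommGroup V]
    [NormedSpace ℝ V] [MeasurableSpace V] [BorelSpace V] [SecondCountableTopology V]
    {π : Measure X} [IsProbabilityMeasure π] {f : Freq d → X → V} {K : Freq d → ℝ}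
    (hf : Measurable fun q : Freq d × X => f q.1 q.2) (hK : Integrable K freqMeasure)
    (hle : ∀ z x, ‖f z x‖ ≤ K z) :
    ∫ x, ∫ z, f z x ∂freqMeasure ∂π = ∫ z, ∫ x, f z x ∂π ∂freqMeasure := by
  refine integral_integral_swap (f := fun x z => f z x) ?_
  refine integrable_prod_of_le (b := fun _ => (1 : ℝ)) ?_ (integrable_const _) hK
    fun x z => by rw [one_mul]; exact hle z x
  exact hf.comp measurable_swap

lemma integral_re_smul {X V : Type*} [MeasurableSpace X] [NormedAddCommGroup V] [NormedSpace ℝ V]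
    [CompleteSpace V] {π : Measure X} {f : X → ℂ} (hf : Integrable f π) (v : V) :
    Integrable (fun x => (f x).re • v) π ∧ ∫ x, (f x).re • v ∂π = (∫ x, f x ∂π).re • v := by
  have h : Integrable (fun x => (f x).re) π := hf.re
  refine ⟨h.smul_const v, ?_⟩
  rw [integral_smul_const]
  congr 1
  exact integral_re hf

/-! ### Mean values of the derivatives of a monomial -/

section Means

variable {ι : Type*} [Fintype ι] [DecidableEq ι] (c : ℂ) (ξ : ι → E d) (m : P2 d)

/-- The j-th wave, integrated against m, restores the factor that was erased from the product. -/
lemma integral_wave_mul (j : ι) :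
    Integrable (fun x => c * (wave (ξ j) x * ∏ i ∈ Finset.univ.erase j, hat m (ξ i))) m.meas ∧
    ∫ x, c * (wave (ξ j) x * ∏ i ∈ Finset.univ.erase j, hat m (ξ i)) ∂m.meas =
      c * ∏ j, hat m (ξ j) := by
  refine ⟨((integrable_wave m (ξ j)).mul_const _).const_mul c, ?_⟩
  rw [integral_const_mul, integral_mul_const, ← Finset.mul_prod_erase _ _ (Finset.mem_univ j)]
  rfl

lemma integral_wave_mul_wave_mul {j i : ι} (hij : i ∈ Finset.univ.erase j) :
    Integrable (fun p : E d × E d => c * (wave (ξ j) p.1 * wave (ξ i) p.2 *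
      ∏ l ∈ (Finset.univ.erase j).erase i, hat m (ξ l))) (m.meas.prod m.meas) ∧
    ∫ p : E d × E d, c * (wave (ξ j) p.1 * wave (ξ i) p.2 *
      ∏ l ∈ (Finset.univ.erase j).erase i, hat m (ξ l)) ∂(m.meas.prod m.meas) =
      c * ∏ j, hat m (ξ j) := by
  refine ⟨(((integrable_wave m (ξ j)).mul_prod (integrable_wave m (ξ i))).mul_const _).const_mul c,
    ?_⟩
  rw [integral_const_mul, integral_mul_const, integral_prod_mul,
    ← Finset.mul_prod_erase _ _ (Finset.mem_univ j), ← Finset.mul_prod_erase _ _ hij, mul_assoc]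
  rfl

lemma integral_monoGrad :
    ∫ x, monoGrad c ξ m x ∂m.meas = (c * tau * ∏ j, hat m (ξ j)).re • ∑ j, ξ j := by
  have h := fun j => integral_re_smul (integral_wave_mul (c * tau) ξ m j).1 (ξ j)
  simp only [monoGrad]
  rw [integral_finsetSum _ fun j _ => (h j).1, Finset.smul_sum]
  simp only [(h _).2, (integral_wave_mul (c * tau) ξ m _).2]

lemma integral_monoHess₁ : ∫ x, monoHess₁ c ξ m x ∂m.meas =
    (c * tau ^ 2 * ∏ j, hat m (ξ j)).re • ∑ j, InnerProductSpace.rankOne ℝ (ξ j) (ξ j) := by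
  have h := fun j => integral_re_smul (integral_wave_mul (c * tau ^ 2) ξ m j).1
    (InnerProductSpace.rankOne ℝ (ξ j) (ξ j))
  simp only [monoHess₁]
  rw [integral_finsetSum _ fun j _ => (h j).1, Finset.smul_sum]
  simp only [(h _).2, (integral_wave_mul (c * tau ^ 2) ξ m _).2]

lemma integral_monoHess₂ : ∫ p, monoHess₂ c ξ m p ∂(m.meas.prod m.meas) =
    (c * tau ^ 2 * ∏ j, hat m (ξ j)).re •
      ∑ j, ∑ i ∈ Finset.univ.erase j, InnerProductSpace.rankOne ℝ (ξ j) (ξ i) := by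
  have h := fun (j i : ι) (hij : i ∈ Finset.univ.erase j) =>
    integral_re_smul (integral_wave_mul_wave_mul (c * tau ^ 2) ξ m hij).1
      (InnerProductSpace.rankOne ℝ (ξ j) (ξ i))
  simp only [monoHess₂]
  rw [integral_finsetSum _ fun j _ => integrable_finsetSum _ fun i hi => (h j i hi).1,
    Finset.smul_sum]
  refine Finset.sum_congr rfl fun j _ => ?_
  rw [integral_finsetSum _ fun i hi => (h j i hi).1, Finset.smul_sum]
  refine Finset.sum_congr rfl fun i hi => ?_
  rw [(h j i hi).2, (integral_wave_mul_wave_mul (c * tau ^ 2) ξ m hi).2]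

/-- The quadratic form of the mean Hessian of a monomial. -/
lemma inner_integral_monoHess_apply (e : E d) :
    inner ℝ ((∫ x, monoHess₁ c ξ m x ∂m.meas) e) e +
      inner ℝ ((∫ p, monoHess₂ c ξ m p ∂(m.meas.prod m.meas)) e) e =
      (c * tau ^ 2 * ∏ j, hat m (ξ j)).re * inner ℝ e (∑ j, ξ j) ^ 2 := by
  have hr : ∀ j i, inner ℝ (InnerProductSpace.rankOne ℝ (ξ j) (ξ i) e) e =
      inner ℝ e (ξ j) * inner ℝ e (ξ i) := fun j i => by
    rw [InnerProductSpace.rankOne_apply, real_inner_smul_left, real_inner_comm e (ξ i),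
      real_inner_comm e (ξ j), mul_comm]
  rw [integral_monoHess₁, integral_monoHess₂, smul_apply, smul_apply, real_inner_smul_left,
    real_inner_smul_left, ← mul_add, sq (inner ℝ e _), inner_sum,
    Finset.sum_mul_sum]
  simp only [sum_apply, sum_inner, hr]
  rw [← Finset.sum_add_distrib]
  congr 1
  -- The spatial Hessian supplies i = j, the measure part i ≠ j; together they complete the square
  -- of ⟨e, Σ ξ j⟩.
  exact Finset.sum_congr rfl fun j _ =>
    Finset.add_sum_erase _ (fun i => inner ℝ e (ξ j) * inner ℝ e (ξ i)) (Finset.mem_univ j)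

end Means

end Integrals

end

end WassersteinFourier

namespace WassersteinFourier

noncomputable section

variable {d : ℕ}

/-! ### Mean gradient and Laplacian as Fourier multipliers -/

section Complexify

variable {w : Freq d → ℂ}

lemma norm_sum_le_freqSize {ι : Type*} [Fintype ι] [DecidableEq ι] (ξ : ι → E d) :
    2 * Real.pi * ‖∑ j, ξ j‖ ≤ freqSize ξ := by
  refine le_trans ?_ (sum_norm_le_freqSize ξ)
  gcongr
  exact norm_sum_le _ _

lemma measurable_sum_freq : Measurable fun z : Freq d => ∑ j, z.2 j :=
  measurable_freq fun k => Finset.measurable_fun_sum (f := fun j (ξ : Fin k → E d) => ξ j)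
    Finset.univ fun j _ => measurable_pi_apply j

lemma IsRegular.integral_grad (hw : IsRegular w) (n : Fin d) (m : P2 d) :
    (∫ x, ∫ z, monoGrad (w z) z.2 m x ∂freqMeasure ∂m.meas) n =
      ∫ z, (w z * (tau * ((∑ j, z.2 j) n : ℝ)) * hatProd m z).re ∂freqMeasure := by
  rw [integral_integral_freq (measurable_monoGrad hw.meas m) hw.integrable_const
    fun z x => (monomial_hasExpansion (w z) z.2).grad_bound m x]
  have hi : Integrable (fun z => ∫ x, monoGrad (w z) z.2 m x ∂m.meas) freqMeasure := by
    refine hw.integrable_const.mono' ?_ (ae_of_all _ fun z => ?_)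
    · exact (measurable_monoGrad hw.meas m).stronglyMeasurable.integral_prod_right.aestronglyMeasurable
    · refine (norm_integral_le_of_norm_le_const (ae_of_all _ fun x =>
        (monomial_hasExpansion (w z) z.2).grad_bound m x)).trans (by simp)
  refine ((EuclideanSpace.proj n : E d →L[ℝ] ℝ).integral_comp_comm hi).symm.trans ?_
  refine integral_congr_ae (ae_of_all _ fun z => ?_)
  simp only [integral_monoGrad, map_smul, smul_eq_mul, PiLp.proj_apply]
  rw [mul_comm, ← Complex.re_ofReal_mul, hatProd]
  congr 1
  ring

lemma IsRegular.integral_hess (hw : IsRegular w) (m : P2 d) :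
    ∑ i, (∫ x, inner ℝ ((∫ z, monoHess₁ (w z) z.2 m x ∂freqMeasure) (coordVec i)) (coordVec i)
        ∂m.meas +
      ∫ p, inner ℝ ((∫ z, monoHess₂ (w z) z.2 m p ∂freqMeasure) (coordVec i)) (coordVec i)
        ∂(m.meas.prod m.meas)) =
      ∫ z, (w z * (-(lamSq z.1 z.2 : ℂ)) * hatProd m z).re ∂freqMeasure := by
  have hexp := hw.hasExpansion
  have b₁ := fun z m x => (monomial_hasExpansion (w z) z.2).hess₁_bound m x
  have b₂ := fun z m x => (monomial_hasExpansion (w z) z.2).hess₂_bound m x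
  -- mean values of the two parts of the Hessian as frequency integrals
  have f₁ := integral_integral_freq (π := m.meas) (measurable_monoHess₁ hw.meas m)
    hw.integrable_const fun z x => b₁ z m x
  have f₂ := integral_integral_freq (π := m.meas.prod m.meas) (measurable_monoHess₂ hw.meas m)
    hw.integrable_const fun z x => b₂ z m x
  have i₁ : Integrable (fun z => ∫ x, monoHess₁ (w z) z.2 m x ∂m.meas) freqMeasure := by
    refine hw.integrable_const.mono' ?_ (ae_of_all _ fun z => ?_)
    · exact (measurable_monoHess₁ hw.meas m).stronglyMeasurable.integral_prod_right.aestronglyMeasurable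
    · exact (norm_integral_le_of_norm_le_const (ae_of_all _ (b₁ z m))).trans (by simp)
  have i₂ : Integrable (fun z => ∫ p, monoHess₂ (w z) z.2 m p ∂(m.meas.prod m.meas))
      freqMeasure := by
    refine hw.integrable_const.mono' ?_ (ae_of_all _ fun z => ?_)
    · exact (measurable_monoHess₂ hw.meas m).stronglyMeasurable.integral_prod_right.aestronglyMeasurable
    · exact (norm_integral_le_of_norm_le_const (ae_of_all _ (b₂ z m))).trans (by simp)
  -- A continuous linear functional on operators, so that taking the diagonal entry commutes with
  -- all the integrals.
  let L : Fin d → (E d →L[ℝ] E d) →L[ℝ] ℝ := fun i =>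
    (innerSL ℝ (coordVec i)).comp (ContinuousLinearMap.apply ℝ (E d) (coordVec i))
  have hL : ∀ i T, inner ℝ (T (coordVec i)) (coordVec i) = L i T := fun i T => by
    simp [L, real_inner_comm]
  have j₁ : Integrable (fun x => ∫ z, monoHess₁ (w z) z.2 m x ∂freqMeasure) m.meas :=
    Integrable.of_bound (hexp.hess₁_cont m).aestronglyMeasurable _
      (ae_of_all _ (hexp.hess₁_bound m))
  have j₂ : Integrable (fun p => ∫ z, monoHess₂ (w z) z.2 m p ∂freqMeasure)
      (m.meas.prod m.meas) :=
    Integrable.of_bound (hexp.hess₂_cont m).aestronglyMeasurable _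
      (ae_of_all _ (hexp.hess₂_bound m))
  have key : ∀ i, ∫ x, L i (∫ z, monoHess₁ (w z) z.2 m x ∂freqMeasure) ∂m.meas +
      ∫ p, L i (∫ z, monoHess₂ (w z) z.2 m p ∂freqMeasure) ∂(m.meas.prod m.meas) =
      ∫ z, (w z * tau ^ 2 * hatProd m z).re * ((∑ j, z.2 j) i) ^ 2 ∂freqMeasure := fun i => by
    rw [(L i).integral_comp_comm j₁, (L i).integral_comp_comm j₂, f₁, f₂,
      ← (L i).integral_comp_comm i₁, ← (L i).integral_comp_comm i₂,
      ← integral_add ((L i).integrable_comp i₁) ((L i).integrable_comp i₂)]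
    refine integral_congr_ae (ae_of_all _ fun z => ?_)
    simp only [← hL]
    rw [inner_integral_monoHess_apply, inner_coordVec]
    rfl
  simp only [hL, key]
  have hint : ∀ i, Integrable (fun z : Freq d => (w z * tau ^ 2 * hatProd m z).re *
      ((∑ j, z.2 j) i) ^ 2) freqMeasure := fun i => by
    refine (((L i).integrable_comp i₁).add ((L i).integrable_comp i₂)).congr
      (ae_of_all _ fun z => ?_)
    simp only [Pi.add_apply, ← hL]
    rw [inner_integral_monoHess_apply, inner_coordVec]
    rfl
  rw [← integral_finsetSum _ fun i _ => hint i]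
  refine integral_congr_ae (ae_of_all _ fun z => ?_)
  simp only
  rw [← Finset.mul_sum]
  have : ∑ i, ((∑ j, z.2 j) i) ^ 2 = ‖∑ j, z.2 j‖ ^ 2 :=
    (EuclideanSpace.real_norm_sq_eq _).symm
  rw [this, mul_comm, ← Complex.re_ofReal_mul, tau_sq, lamSq]
  congr 1
  push_cast
  ring

lemma IsRegular.integrable_mul_hatProd (hw : IsRegular w) {f : Freq d → ℂ} (hf : Measurable f)
    (hle : ∀ z, ‖f z‖ ≤ 2 * (1 + freqSize z.2) ^ 3) (m : P2 d) :
    Integrable (fun z => w z * f z * hatProd m z) freqMeasure :=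
  Integrable.mul_hatProd (hw.integrable_mul hf hle) m

lemma re_add_I_mul_integral {Z : Type*} [MeasurableSpace Z] {μ : Measure Z} {f : Z → ℂ}
    (hf : Integrable f μ) :
    ((∫ z, (f z).re ∂μ : ℝ) : ℂ) + Complex.I * ((∫ z, (-Complex.I * f z).re ∂μ : ℝ) : ℂ) =
      ∫ z, f z ∂μ := by
  rw [mul_comm, ← integral_re_add_im hf]
  simp

lemma re_neg_I_mul (u : ℂ) : (-Complex.I * u).re = u.im := by simp

variable {F : P2 d → ℂ}

lemma IsRegular.re_eq (hw : IsRegular w) (hF : ∀ m, F m = ∫ z, w z * hatProd m z ∂freqMeasure) :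
    (fun m => (F m).re) = fun m => ∫ z, monoVal (w z) z.2 m ∂freqMeasure := by
  funext m
  have hi : Integrable (fun z => w z * hatProd m z) freqMeasure := by
    simpa using hw.integrable_mul_hatProd (f := fun _ => 1) measurable_const (fun z => by
      have := one_le_pow₀ (M₀ := ℝ) (a := 1 + freqSize z.2) (n := 3)
        (by linarith [freqSize_nonneg z.2])
      rw [norm_one]; linarith) m
  rw [hF]
  exact (integral_re hi).symm

/-- Im F = Re(-iF), and -i w is again regular, so the calculus is needed only for real parts. -/
lemma IsRegular.im_eq (hw : IsRegular w) (hF : ∀ m, F m = ∫ z, w z * hatProd m z ∂freqMeasure) :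
    (fun m => (F m).im) = fun m => ∫ z, monoVal (-Complex.I * w z) z.2 m ∂freqMeasure := by
  rw [← (hw.const_mul (-Complex.I)).re_eq (F := fun m => -Complex.I * F m)]
  · funext m
    exact (re_neg_I_mul _).symm
  · intro m
    rw [hF, ← integral_const_mul]
    simp only [mul_assoc]

theorem IsRegular.cWDifferentiable (hw : IsRegular w)
    (hF : ∀ m, F m = ∫ z, w z * hatProd m z ∂freqMeasure) : CWDifferentiable F := by
  intro m
  rw [hw.re_eq hF, hw.im_eq hF]
  exact ⟨(isGradientField_and_wGrad_eq hw.hasExpansion m).1,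
    (isGradientField_and_wGrad_eq (hw.const_mul _).hasExpansion m).1⟩

theorem IsRegular.hasWLaplacian (hw : IsRegular w)
    (hF : ∀ m, F m = ∫ z, w z * hatProd m z ∂freqMeasure) : HasWLaplacian F := by
  intro m
  rw [hw.re_eq hF, hw.im_eq hF]
  exact ⟨(hasWLaplacianAt_and_eq hw.hasExpansion m).1,
    (hasWLaplacianAt_and_eq (hw.const_mul _).hasExpansion m).1⟩

theorem IsRegular.meanGrad_eq (hw : IsRegular w)
    (hF : ∀ m, F m = ∫ z, w z * hatProd m z ∂freqMeasure) (n : Fin d) (m : P2 d) :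
    meanGrad F n m =
      ∫ z, w z * (tau * ((∑ j, z.2 j) n : ℝ)) * hatProd m z ∂freqMeasure := by
  rw [meanGrad, hw.re_eq hF, hw.im_eq hF,
    integral_congr_ae (isGradientField_and_wGrad_eq hw.hasExpansion m).2.2,
    integral_congr_ae (isGradientField_and_wGrad_eq (hw.const_mul _).hasExpansion m).2.2,
    hw.integral_grad, (hw.const_mul _).integral_grad]
  simp only [mul_assoc (-Complex.I)]
  refine re_add_I_mul_integral (hw.integrable_mul_hatProd ?_ (fun z => ?_) m)
  · refine (Complex.measurable_ofReal.comp ?_).const_mul tau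
    exact (EuclideanSpace.proj n : E d →L[ℝ] ℝ).continuous.measurable.comp measurable_sum_freq
  · have h1 := norm_sum_le_freqSize z.2
    have h2 := freqSize_nonneg z.2
    have h3 := PiLp.norm_apply_le (∑ j, z.2 j) n
    rw [norm_mul, norm_tau, Complex.norm_real]
    calc _ ≤ 2 * Real.pi * ‖∑ j, z.2 j‖ := by gcongr
      _ ≤ freqSize z.2 := h1
      _ ≤ _ := by nlinarith [pow_nonneg h2 2, pow_nonneg h2 3]

lemma measurable_lamSq (k : ℕ+) : Measurable (lamSq (d := d) k) := by
  unfold lamSq; fun_prop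

lemma lamSq_nonneg (k : ℕ+) (ξ : Fin k → E d) : 0 ≤ lamSq k ξ := by
  unfold lamSq; positivity

theorem IsRegular.wLaplacian_eq (hw : IsRegular w)
    (hF : ∀ m, F m = ∫ z, w z * hatProd m z ∂freqMeasure) (m : P2 d) :
    wLaplacian F m = ∫ z, w z * (-(lamSq z.1 z.2 : ℂ)) * hatProd m z ∂freqMeasure := by
  rw [wLaplacian, hw.re_eq hF, hw.im_eq hF, (hasWLaplacianAt_and_eq hw.hasExpansion m).2,
    (hasWLaplacianAt_and_eq (hw.const_mul _).hasExpansion m).2, hw.integral_hess,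
    (hw.const_mul _).integral_hess]
  simp only [mul_assoc (-Complex.I)]
  refine re_add_I_mul_integral (hw.integrable_mul_hatProd ?_ (fun z => ?_) m)
  · exact (Complex.measurable_ofReal.comp (measurable_freq measurable_lamSq)).neg
  · have h1 := norm_sum_le_freqSize z.2
    have h2 := freqSize_nonneg z.2
    rw [norm_neg, Complex.norm_real, Real.norm_eq_abs, abs_of_nonneg (lamSq_nonneg _ _), lamSq]
    calc _ = (2 * Real.pi * ‖∑ j, z.2 j‖) ^ 2 := by ring
      _ ≤ freqSize z.2 ^ 2 := by gcongr
      _ ≤ _ := by nlinarith [pow_nonneg h2 2, pow_nonneg h2 3]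

end Complexify

end

end WassersteinFourier

namespace WassersteinFourier

noncomputable section

variable {d : ℕ}

/-! ### Moment bounds -/

/-- Products of three distinct frequencies are not covered by the moment bounds. This trades them
for products of the form |ξ_i|²|ξ_j|. -/
lemma mul_mul_le_cyclic {a b c : ℝ} (ha : 0 ≤ a) (hb : 0 ≤ b) (hc : 0 ≤ c) :
    a * b * c ≤ a ^ 2 * b + b ^ 2 * c + c ^ 2 * a := by
  rcases le_total a b with h1 | h1 <;> rcases le_total b c with h2 | h2 <;>
    rcases le_total a c with h3 | h3 <;>
    nlinarith [mul_nonneg (mul_nonneg ha hb) hc, mul_nonneg (mul_nonneg ha hb) (sub_nonneg.2 h1),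
      mul_nonneg (mul_nonneg hb hc) (sub_nonneg.2 h2),
      mul_nonneg (mul_nonneg hc ha) (sub_nonneg.2 h3),
      mul_nonneg (mul_nonneg hb hc) (sub_nonneg.2 h1),
      mul_nonneg (mul_nonneg hc ha) (sub_nonneg.2 h2),
      mul_nonneg (mul_nonneg ha hb) (sub_nonneg.2 h3), mul_nonneg (pow_nonneg ha 2) hb,
      mul_nonneg (pow_nonneg hb 2) hc, mul_nonneg (pow_nonneg hc 2) ha]

/-- The cube of a sum is controlled by the cubes and the off-diagonal products. -/
lemma sum_pow_three_le {ι : Type*} [Fintype ι] [DecidableEq ι] {a : ι → ℝ} (ha : ∀ i, 0 ≤ a i) :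
    (∑ i, a i) ^ 3 ≤ ∑ i, a i ^ 3 +
      3 * Fintype.card ι * ∑ i, ∑ j ∈ Finset.univ.erase i, a i ^ 2 * a j := by
  -- Zero on the diagonal: pure cubes occur only for i = j = l and are counted separately, without
  -- the factor `Fintype.card ι`.
  let b : ι → ι → ℝ := fun i j => if i = j then 0 else a i ^ 2 * a j
  have hb : ∀ i j, 0 ≤ b i j := fun i j => by
    simp only [b]; split_ifs
    · exact le_rfl
    · exact mul_nonneg (sq_nonneg _) (ha j)
  have hbe : ∀ i, ∑ j ∈ Finset.univ.erase i, a i ^ 2 * a j = ∑ j, b i j := fun i => by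
    rw [← Finset.add_sum_erase _ _ (Finset.mem_univ i)]
    simp only [b, if_true, zero_add]
    exact Finset.sum_congr rfl fun j hj => (if_neg (Finset.ne_of_mem_erase hj).symm).symm
  have key : ∀ i j l, a i * a j * a l ≤
      (if i = j then (if i = l then a i ^ 3 else 0) else 0) + (b i j + b j l + b l i) := by
    intro i j l
    have hij := mul_nonneg (sq_nonneg (a i)) (ha j)
    by_cases h1 : i = j
    · subst h1
      by_cases h2 : i = l
      · subst h2
        simp only [b, if_true]
        linarith [show a i * a i * a i = a i ^ 3 by ring]
      · rw [if_pos rfl, if_neg h2, zero_add]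
        have : b i l = a i ^ 2 * a l := if_neg h2
        nlinarith [hb i i, hb l i]
    · rw [if_neg h1, zero_add]
      have e1 : b i j = a i ^ 2 * a j := if_neg h1
      by_cases h2 : j = l
      · subst h2
        have : b j i = a j ^ 2 * a i := if_neg (Ne.symm h1)
        nlinarith [hb i j, hb j j]
      · have e2 : b j l = a j ^ 2 * a l := if_neg h2
        by_cases h3 : i = l
        · subst h3
          nlinarith [hb i i, hb j i]
        · have e3 : b l i = a l ^ 2 * a i := if_neg (Ne.symm h3)
          rw [e1, e2, e3]
          exact mul_mul_le_cyclic (ha i) (ha j) (ha l)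
  calc (∑ i, a i) ^ 3 = ∑ i, ∑ j, ∑ l, a i * a j * a l := by
        rw [pow_succ, sq, Finset.sum_mul_sum, Finset.sum_mul]
        simp_rw [Finset.sum_mul, Finset.mul_sum]
    _ ≤ ∑ i, ∑ j, ∑ l, ((if i = j then (if i = l then a i ^ 3 else 0) else 0) +
        (b i j + b j l + b l i)) :=
        Finset.sum_le_sum fun i _ => Finset.sum_le_sum fun j _ => Finset.sum_le_sum fun l _ =>
          key i j l
    _ = _ := by
        simp_rw [hbe, Finset.sum_add_distrib]
        have s0 : ∑ i, ∑ j, ∑ l, (if i = j then (if i = l then a i ^ 3 else 0) else 0) =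
            ∑ i, a i ^ 3 := by
          refine Finset.sum_congr rfl fun i _ => ?_
          rw [Finset.sum_eq_single i]
          · simp
          · intro j _ hj
            simp [Ne.symm hj]
          · simp
        have s1 : ∑ i, ∑ j, ∑ _l : ι, b i j = Fintype.card ι * ∑ i, ∑ j, b i j := by
          simp_rw [Finset.sum_const, nsmul_eq_mul, ← Finset.mul_sum, Finset.card_univ]
        have s2 : ∑ _i : ι, ∑ j, ∑ l, b j l = Fintype.card ι * ∑ i, ∑ j, b i j := by
          simp_rw [Finset.sum_const, nsmul_eq_mul, Finset.card_univ]
        have s3 : ∑ i, ∑ _j : ι, ∑ l, b l i = Fintype.card ι * ∑ i, ∑ j, b i j := by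
          simp_rw [Finset.sum_const, nsmul_eq_mul, ← Finset.mul_sum, Finset.card_univ]
          rw [Finset.sum_comm]
        rw [s0, s1, s2, s3]
        ring

/-- The cubic moment of the frequencies, in terms of the moments of one and two frequencies. -/
lemma enorm_one_add_freqSize_pow_le {k : ℕ+} (ξ : Fin k → E d) :
    ‖(1 + freqSize ξ) ^ 3‖ₑ ≤ ENNReal.ofReal (768 * Real.pi ^ 3) * (1 + (∑ i, ‖ξ i‖ₑ ^ 3 +
      (k : ℕ) * ∑ i, ∑ j ∈ Finset.univ.erase i, ‖ξ i‖ₑ ^ 2 * ‖ξ j‖ₑ)) := by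
  have hS := freqSize_nonneg ξ
  have h3 := sum_pow_three_le fun i => norm_nonneg (ξ i)
  rw [Fintype.card_fin] at h3
  have p1 : ∀ i j, (0 : ℝ) ≤ ‖ξ i‖ ^ 2 * ‖ξ j‖ := fun i j => by positivity
  have p2 : ∀ i, (0 : ℝ) ≤ ‖ξ i‖ ^ 3 := fun i => by positivity
  have eP : ∑ i, ‖ξ i‖ₑ ^ 3 = ENNReal.ofReal (∑ i, ‖ξ i‖ ^ 3) := by
    rw [ENNReal.ofReal_sum_of_nonneg fun i _ => p2 i]
    refine Finset.sum_congr rfl fun i _ => ?_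
    rw [ENNReal.ofReal_pow (norm_nonneg _), ofReal_norm]
  have eQ : ∑ i, ∑ j ∈ Finset.univ.erase i, ‖ξ i‖ₑ ^ 2 * ‖ξ j‖ₑ =
      ENNReal.ofReal (∑ i, ∑ j ∈ Finset.univ.erase i, ‖ξ i‖ ^ 2 * ‖ξ j‖) := by
    rw [ENNReal.ofReal_sum_of_nonneg fun i _ => Finset.sum_nonneg fun j _ => p1 i j]
    refine Finset.sum_congr rfl fun i _ => ?_
    rw [ENNReal.ofReal_sum_of_nonneg fun j _ => p1 i j]
    refine Finset.sum_congr rfl fun j _ => ?_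
    rw [ENNReal.ofReal_mul (sq_nonneg _), ENNReal.ofReal_pow (norm_nonneg _), ofReal_norm,
      ofReal_norm]
  have hP : 0 ≤ ∑ i, ‖ξ i‖ ^ 3 := Finset.sum_nonneg fun i _ => p2 i
  have hQ : 0 ≤ ∑ i, ∑ j ∈ Finset.univ.erase i, ‖ξ i‖ ^ 2 * ‖ξ j‖ :=
    Finset.sum_nonneg fun i _ => Finset.sum_nonneg fun j _ => p1 i j
  have hT : freqSize ξ = 4 * Real.pi * ∑ i, ‖ξ i‖ := by rw [freqSize, ← Finset.mul_sum]
  rw [eP, eQ]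
  generalize ∑ i, ‖ξ i‖ = T at *
  generalize ∑ i, ‖ξ i‖ ^ 3 = P at *
  generalize ∑ i, ∑ j ∈ Finset.univ.erase i, ‖ξ i‖ ^ 2 * ‖ξ j‖ = Q at *
  have hk : (0 : ℝ) ≤ (k : ℕ) := Nat.cast_nonneg _
  have hp : 1 ≤ Real.pi ^ 3 := one_le_pow₀ (by linarith [Real.pi_gt_three])
  rw [← ENNReal.ofReal_natCast, ← ENNReal.ofReal_mul hk, ← ENNReal.ofReal_add hP (mul_nonneg hk hQ),
    ← ENNReal.ofReal_one, ← ENNReal.ofReal_add one_pos.le (add_nonneg hP (mul_nonneg hk hQ)),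
    ← ENNReal.ofReal_mul (by linarith), Real.enorm_eq_ofReal (pow_nonneg (by linarith) 3)]
  refine ENNReal.ofReal_le_ofReal ?_
  -- The constant: freqSize ξ = 4πT gives 4(4π)³ = 256π³, and the bound on T³ contributes a factor
  -- 3.
  calc (1 + freqSize ξ) ^ 3 ≤ 4 * (1 + freqSize ξ ^ 3) := by
        nlinarith [mul_nonneg (add_nonneg one_pos.le hS) (sq_nonneg (1 - freqSize ξ))]
    _ = 4 + 256 * Real.pi ^ 3 * T ^ 3 := by rw [hT]; ring
    _ ≤ 768 * Real.pi ^ 3 * 1 + 256 * Real.pi ^ 3 * (3 * P + 3 * (k : ℕ) * Q) := by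
        gcongr
        · linarith
        · linarith
    _ = _ := by ring

lemma natCast_mul_ofReal_le {k : ℕ+} (C δ : ℝ) (n : ℕ) :
    ((k : ℕ) : ℝ≥0∞) ^ n * ENNReal.ofReal (C * (k : ℕ)! / (k : ℝ) ^ (n + δ)) =
      ENNReal.ofReal (C * (k : ℕ)! / (k : ℝ) ^ δ) := by
  have hk : (0 : ℝ) < (k : ℕ) := by exact_mod_cast k.pos
  rw [← ENNReal.ofReal_natCast, ← ENNReal.ofReal_pow hk.le, ← ENNReal.ofReal_mul (by positivity),
    Real.rpow_add hk, Real.rpow_natCast]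
  have : ((k : ℕ) : ℝ) ^ δ ≠ 0 := (Real.rpow_pos_of_pos hk δ).ne'
  congr 1
  field_simp

/-- The number of terms is matched by the decay assumed on each: k cubes against k^{1+δ}, and k²
pairs, with the further k from `sum_pow_three_le`, against k^{3+δ}. Each group is then bounded by C
k!/k^δ, which the weight makes summable. -/
theorem isRegular_weight {a : Coeffs d} {C δ : ℝ} (hδ : 0 < δ) (ha : ∀ k, Measurable (a k))
    (hU : UniformBound a C δ) (hM : MomentBounds a C δ) : IsRegular (weight a) := by
  have hfs : Measurable fun z : Freq d => freqSize z.2 :=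
    measurable_freq fun k => Finset.measurable_fun_sum
      (f := fun j (ξ : Fin k → E d) => 4 * Real.pi * ‖ξ j‖) Finset.univ fun j _ =>
        (measurable_pi_apply j).norm.const_mul _
  refine ⟨measurable_weight ha, integrable_weight_mul ha
    (C := 768 * Real.pi ^ 3 * 3 * C) ((hfs.const_add 1).pow_const 3) hδ fun k => ?_⟩
  have hA : Measurable fun ξ : Fin k → E d => ‖a k ξ‖ₑ := (ha k).enorm
  have hn : ∀ i, Measurable fun ξ : Fin k → E d => ‖ξ i‖ₑ := fun i =>
    (measurable_pi_apply i).enorm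
  set R := ENNReal.ofReal (C * (k : ℕ)! / (k : ℝ) ^ δ) with hR
  calc _ ≤ ∫⁻ ξ : Fin k → E d, ENNReal.ofReal (768 * Real.pi ^ 3) *
        (‖a k ξ‖ₑ + (∑ i, ‖a k ξ‖ₑ * ‖ξ i‖ₑ ^ 3 + (k : ℕ) *
          ∑ i, ∑ j ∈ Finset.univ.erase i, ‖a k ξ‖ₑ * ‖ξ i‖ₑ ^ 2 * ‖ξ j‖ₑ)) := by
        refine lintegral_mono fun ξ => ?_
        refine (mul_le_mul_right (enorm_one_add_freqSize_pow_le ξ) _).trans (le_of_eq ?_)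
        simp_rw [mul_assoc ‖a k ξ‖ₑ, ← Finset.mul_sum]
        ring
    _ = ENNReal.ofReal (768 * Real.pi ^ 3) * ((∫⁻ ξ, ‖a k ξ‖ₑ) +
        ((∑ i, ∫⁻ ξ, ‖a k ξ‖ₑ * ‖ξ i‖ₑ ^ 3) + (k : ℕ) *
          ∑ i, ∑ j ∈ Finset.univ.erase i, ∫⁻ ξ, ‖a k ξ‖ₑ * ‖ξ i‖ₑ ^ 2 * ‖ξ j‖ₑ)) := by
        have m1 : ∀ i, Measurable fun ξ : Fin k → E d => ‖a k ξ‖ₑ * ‖ξ i‖ₑ ^ 3 := fun i =>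
          hA.mul ((hn i).pow_const 3)
        have m2 : ∀ i j, Measurable fun ξ : Fin k → E d => ‖a k ξ‖ₑ * ‖ξ i‖ₑ ^ 2 * ‖ξ j‖ₑ :=
          fun i j => (hA.mul ((hn i).pow_const 2)).mul (hn j)
        have m3 : ∀ i, Measurable fun ξ : Fin k → E d =>
            ∑ j ∈ Finset.univ.erase i, ‖a k ξ‖ₑ * ‖ξ i‖ₑ ^ 2 * ‖ξ j‖ₑ := fun i =>
          Finset.measurable_fun_sum _ fun j _ => m2 i j
        rw [lintegral_const_mul' _ _ ENNReal.ofReal_ne_top, lintegral_add_left hA,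
          lintegral_add_left (Finset.measurable_fun_sum _ fun i _ => m1 i),
          lintegral_finsetSum _ fun i _ => m1 i,
          lintegral_const_mul' _ _ (ENNReal.natCast_ne_top _),
          lintegral_finsetSum _ fun i _ => m3 i]
        congr 4
        exact Finset.sum_congr rfl fun i _ => lintegral_finsetSum _ fun j _ => m2 i j
    _ ≤ ENNReal.ofReal (768 * Real.pi ^ 3) * (R + (R + R)) := by
        refine mul_le_mul_right (add_le_add (hU k) (add_le_add ?_ ?_)) _
        · refine (Finset.sum_le_sum fun i _ => (hM k i).2.2.1).trans (le_of_eq ?_)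
          rw [Finset.sum_const, Finset.card_univ, Fintype.card_fin, nsmul_eq_mul, hR,
            ← natCast_mul_ofReal_le C δ 1]
          norm_num
        · have : ∑ i : Fin k, ∑ j ∈ Finset.univ.erase i,
              ∫⁻ ξ, ‖a k ξ‖ₑ * ‖ξ i‖ₑ ^ 2 * ‖ξ j‖ₑ ≤ ∑ _i : Fin k, ∑ _j : Fin k,
                ENNReal.ofReal (C * (k : ℕ)! / (k : ℝ) ^ (3 + δ)) := by
            refine Finset.sum_le_sum fun i _ => ?_
            refine (Finset.sum_le_sum fun j hj =>
              ((hM k i).2.2.2 j (Finset.ne_of_mem_erase hj).symm).2).trans ?_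
            exact Finset.sum_le_sum_of_subset (Finset.subset_univ _)
          refine (mul_le_mul_right this _).trans (le_of_eq ?_)
          simp only [Finset.sum_const, Finset.card_univ, Fintype.card_fin, nsmul_eq_mul]
          rw [hR, ← natCast_mul_ofReal_le C δ 3]
          push_cast
          ring
    _ = _ := by
        rw [show R + (R + R) = ENNReal.ofReal 3 * R by
          rw [ENNReal.ofReal_ofNat]; ring, ← mul_assoc, hR, ← ENNReal.ofReal_mul (by positivity),
          ← ENNReal.ofReal_mul (by positivity)]
        congr 1
        ring

end

end WassersteinFourier

namespace WassersteinFourier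

noncomputable section

variable {d : ℕ}

/-! ### The space `𝓗⁰` -/

/-- The density of the inner product of two sequences of coefficients. -/
def innerDensity (a b : Coeffs d) (z : Freq d) : ℂ :=
  ((z.1 : ℕ)! : ℂ)⁻¹ * (a z.1 z.2 * (starRingEnd ℂ) (b z.1 z.2))

lemma enorm_mul_conj_le (u v : ℂ) : ‖u * (starRingEnd ℂ) v‖ₑ ≤ ‖u‖ₑ ^ 2 + ‖v‖ₑ ^ 2 := by
  have h : ‖u‖ * ‖v‖ ≤ ‖u‖ ^ 2 + ‖v‖ ^ 2 := by
    nlinarith [sq_nonneg (‖u‖ - ‖v‖), sq_nonneg ‖u‖, sq_nonneg ‖v‖]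
  rw [← ofReal_norm, ← ofReal_norm, ← ofReal_norm, ← ENNReal.ofReal_pow (norm_nonneg _),
    ← ENNReal.ofReal_pow (norm_nonneg _), ← ENNReal.ofReal_add (sq_nonneg _) (sq_nonneg _),
    norm_mul, RCLike.norm_conj]
  exact ENNReal.ofReal_le_ofReal h

lemma enorm_inv_factorial (k : ℕ) : ‖((k ! : ℕ) : ℂ)⁻¹‖ₑ = ((k ! : ℕ) : ℝ≥0∞)⁻¹ := by
  rw [enorm_inv (by exact_mod_cast Nat.factorial_ne_zero k), ← ofReal_norm, Complex.norm_natCast,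
    ENNReal.ofReal_natCast]

lemma integrable_innerDensity {a b : Coeffs d} (ha : MemA0 a) (hb : MemA0 b) :
    Integrable (innerDensity a b) freqMeasure := by
  refine ⟨?_, ?_⟩
  · refine (measurable_freq fun k => ?_).aestronglyMeasurable
    exact ((ha.1 k).1.mul (Complex.continuous_conj.measurable.comp (hb.1 k).1)).const_mul
      ((k : ℕ)! : ℂ)⁻¹
  · rw [HasFiniteIntegral, lintegral_freq]
    refine lt_of_le_of_lt ?_ (ENNReal.add_lt_top.2 ⟨ha.2, hb.2⟩)
    rw [← ENNReal.tsum_add]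
    refine ENNReal.tsum_le_tsum fun k => ?_
    rw [← mul_add, ← lintegral_add_left ((ha.1 k).1.enorm.pow_const 2),
      ← lintegral_const_mul' _ _ (ENNReal.inv_ne_top.2
        (Nat.cast_ne_zero.2 (Nat.factorial_ne_zero _)))]
    refine lintegral_mono fun ξ => ?_
    rw [innerDensity, enorm_mul, enorm_inv_factorial]
    exact mul_le_mul_right (enorm_mul_conj_le _ _) _

/-- Uniqueness of the coefficients up to null sets lets any admissible sequences replace those
chosen in the definition. -/
lemma H0inner_eq (hd : 0 < d) {F G : P2 d → ℂ} {a b : Coeffs d} (hF : HasCoeffs F a)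
    (hG : HasCoeffs G b) : H0inner F G = ∫ z, innerDensity a b z ∂freqMeasure := by
  rw [← (hasSum_integral_freq (integrable_innerDensity hF.1 hG.1)).tsum_eq, H0inner]
  refine tsum_congr fun k => ?_
  rw [← integral_const_mul]
  refine integral_congr_ae ?_
  filter_upwards [coeffs_ae_eq hd hF k, coeffs_ae_eq hd hG k] with ξ h1 h2
  rw [h1, h2, innerDensity]

/-- The coefficients of the components of the mean gradient. -/
def gradCoeffs (a : Coeffs d) (n : Fin d) : Coeffs d :=
  fun k ξ => a k ξ * (tau * ((∑ j, ξ j) n : ℝ))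

/-- The coefficients of the Wasserstein Laplacian. -/
def laplacianCoeffs (a : Coeffs d) : Coeffs d := fun k ξ => a k ξ * (-(lamSq k ξ : ℂ))

lemma MemA0.mul {a : Coeffs d} (ha : MemA0 a) {f : Coeffs d} (hf : ∀ k, Measurable (f k))
    (hsymm : ∀ (k : ℕ+) (σ : Equiv.Perm (Fin k)) (ξ : Fin k → E d),
      f k (fun j => ξ (σ j)) = f k ξ)
    {B : (k : ℕ+) → (Fin k → E d) → ℝ≥0∞} (hle : ∀ k ξ, ‖f k ξ‖ₑ ^ 2 ≤ B k ξ)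
    (hsum : ∑' k : ℕ+, ((k : ℕ)! : ℝ≥0∞)⁻¹ * ∫⁻ ξ, ‖a k ξ‖ₑ ^ 2 * B k ξ < ⊤) :
    MemA0 (fun k ξ => a k ξ * f k ξ) := by
  refine ⟨fun k => ⟨(ha.1 k).1.mul (hf k), fun σ ξ => ?_⟩, lt_of_le_of_lt ?_ hsum⟩
  · simp only [(ha.1 k).2, hsymm]
  · refine ENNReal.tsum_le_tsum fun k => mul_le_mul_right (lintegral_mono fun ξ => ?_) _
    rw [enorm_mul, mul_pow]
    exact mul_le_mul_right (hle k ξ) _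

lemma lamSq_perm (k : ℕ+) (σ : Equiv.Perm (Fin k)) (ξ : Fin k → E d) :
    lamSq k (fun j => ξ (σ j)) = lamSq k ξ := by
  rw [lamSq, Equiv.sum_comp σ ξ, lamSq]

lemma norm_tau_mul_sq_le (k : ℕ+) (ξ : Fin k → E d) (n : Fin d) :
    ‖tau * ((∑ j, ξ j) n : ℝ)‖ ^ 2 ≤ lamSq k ξ := by
  rw [norm_mul, norm_tau, Complex.norm_real, mul_pow, mul_pow, lamSq]
  have := PiLp.norm_apply_le (∑ j, ξ j) n
  calc _ = 4 * Real.pi ^ 2 * ‖(∑ j, ξ j) n‖ ^ 2 := by ring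
    _ ≤ _ := by gcongr

lemma enorm_tau_mul_sq_le (k : ℕ+) (ξ : Fin k → E d) (n : Fin d) :
    ‖tau * ((∑ j, ξ j) n : ℝ)‖ₑ ^ 2 ≤ ENNReal.ofReal (lamSq k ξ) := by
  rw [← ofReal_norm, ← ENNReal.ofReal_pow (norm_nonneg _)]
  exact ENNReal.ofReal_le_ofReal (norm_tau_mul_sq_le k ξ n)

/-- The multiplier has size at most λ_k, and s ≤ 1 + s². The L¹ bounds without weight and with
weight λ_k² thus control the gradient coefficients. -/
lemma enorm_tau_mul_le (k : ℕ+) (ξ : Fin k → E d) (n : Fin d) :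
    ‖tau * ((∑ j, ξ j) n : ℝ)‖ₑ ≤ 1 + ENNReal.ofReal (lamSq k ξ) := by
  rw [← ofReal_norm, ← ENNReal.ofReal_one, ← ENNReal.ofReal_add one_pos.le (lamSq_nonneg k ξ)]
  refine ENNReal.ofReal_le_ofReal ?_
  nlinarith [norm_tau_mul_sq_le k ξ n, sq_nonneg (‖tau * ((∑ j, ξ j) n : ℝ)‖ - 1)]

lemma memA0_gradCoeffs {a : Coeffs d} (ha : MemA0 a) (ha2 : ∑' k : ℕ+, ((k : ℕ)! : ℝ≥0∞)⁻¹ *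
      ∫⁻ ξ, ‖a k ξ‖ₑ ^ 2 * ENNReal.ofReal (lamSq k ξ) < ⊤) (n : Fin d) :
    MemA0 (gradCoeffs a n) := by
  refine ha.mul (fun k => ?_) (fun k σ ξ => ?_) (fun k ξ => enorm_tau_mul_sq_le k ξ n) ha2
  · fun_prop
  · simp only [Equiv.sum_comp σ ξ]

lemma memA0_laplacianCoeffs {a : Coeffs d} (ha : MemA0 a) (ha4 : ∑' k : ℕ+,
      ((k : ℕ)! : ℝ≥0∞)⁻¹ * ∫⁻ ξ, ‖a k ξ‖ₑ ^ 2 * ENNReal.ofReal (lamSq k ξ) ^ 2 < ⊤) :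
    MemA0 (laplacianCoeffs a) := by
  refine ha.mul (fun k => ?_) (fun k σ ξ => ?_) (fun k ξ => ?_) ha4
  · exact (Complex.measurable_ofReal.comp (measurable_lamSq k)).neg
  · simp only [lamSq_perm]
  · rw [enorm_neg, ← ofReal_norm, Complex.norm_real, Real.norm_of_nonneg (lamSq_nonneg k ξ)]

lemma tsum_lamSq_lt_top {a : Coeffs d} (ha : MemA0 a) (ha4 : ∑' k : ℕ+,
      ((k : ℕ)! : ℝ≥0∞)⁻¹ * ∫⁻ ξ, ‖a k ξ‖ₑ ^ 2 * ENNReal.ofReal (lamSq k ξ) ^ 2 < ⊤) :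
    ∑' k : ℕ+, ((k : ℕ)! : ℝ≥0∞)⁻¹ * ∫⁻ ξ, ‖a k ξ‖ₑ ^ 2 * ENNReal.ofReal (lamSq k ξ) < ⊤ := by
  refine lt_of_le_of_lt ?_ (ENNReal.add_lt_top.2 ⟨ha.2, ha4⟩)
  rw [← ENNReal.tsum_add]
  refine ENNReal.tsum_le_tsum fun k => ?_
  rw [← mul_add, ← lintegral_add_left ((ha.1 k).1.enorm.pow_const 2)]
  refine mul_le_mul_right (lintegral_mono fun ξ => ?_) _
  rw [← mul_one_add]
  refine mul_le_mul_right ?_ _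
  rw [← ENNReal.ofReal_one, ← ENNReal.ofReal_pow (lamSq_nonneg k ξ),
    ← ENNReal.ofReal_add one_pos.le (sq_nonneg _)]
  exact ENNReal.ofReal_le_ofReal (by nlinarith [sq_nonneg (lamSq k ξ - 1)])

lemma uniformBound_laplacianCoeffs {a : Coeffs d} {C δ : ℝ} (h : ∀ k : ℕ+,
      ∫⁻ ξ, ‖a k ξ‖ₑ * ENNReal.ofReal (lamSq k ξ) ≤
        ENNReal.ofReal (C * (k : ℕ)! / (k : ℝ) ^ δ)) : UniformBound (laplacianCoeffs a) C δ := by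
  refine fun k => le_trans (lintegral_mono fun ξ => ?_) (h k)
  rw [laplacianCoeffs, enorm_mul, enorm_neg, ← ofReal_norm (lamSq k ξ : ℂ), Complex.norm_real,
    Real.norm_of_nonneg (lamSq_nonneg k ξ)]

lemma uniformBound_gradCoeffs {a : Coeffs d} (ha : ∀ k, Measurable (a k)) {C δ : ℝ}
    (hU : UniformBound a C δ) (h : ∀ k : ℕ+, ∫⁻ ξ, ‖a k ξ‖ₑ * ENNReal.ofReal (lamSq k ξ) ≤
      ENNReal.ofReal (C * (k : ℕ)! / (k : ℝ) ^ δ)) (n : Fin d) :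
    UniformBound (gradCoeffs a n) (2 * C) δ := by
  intro k
  calc _ ≤ ∫⁻ ξ, (‖a k ξ‖ₑ + ‖a k ξ‖ₑ * ENNReal.ofReal (lamSq k ξ)) := by
        refine lintegral_mono fun ξ => ?_
        rw [gradCoeffs, enorm_mul, ← mul_one_add]
        exact mul_le_mul_right (enorm_tau_mul_le k ξ n) _
    _ = (∫⁻ ξ, ‖a k ξ‖ₑ) + ∫⁻ ξ, ‖a k ξ‖ₑ * ENNReal.ofReal (lamSq k ξ) :=
        lintegral_add_left (ha k).enorm _
    _ ≤ _ := add_le_add (hU k) (h k)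
    _ = _ := by
        rw [← two_mul, ← ENNReal.ofReal_ofNat, ← ENNReal.ofReal_mul zero_le_two]
        congr 1
        ring

section Series

variable {a : Coeffs d} {C δ : ℝ}

lemma fourierSeries_eq (hi : Integrable (weight a) freqMeasure)
    (m : P2 d) : fourierSeries a m = ∫ z, weight a z * hatProd m z ∂freqMeasure :=
  (hasSum_fourierTerm hi m).tsum_eq

lemma hasCoeffs_meanGrad (hδ : 0 < δ) (ha : MemA0 a) (hU : UniformBound a C δ)
    (hM : MomentBounds a C δ) (hl : ∀ k : ℕ+, ∫⁻ ξ, ‖a k ξ‖ₑ * ENNReal.ofReal (lamSq k ξ) ≤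
      ENNReal.ofReal (C * (k : ℕ)! / (k : ℝ) ^ δ))
    (ha2 : ∑' k : ℕ+, ((k : ℕ)! : ℝ≥0∞)⁻¹ *
      ∫⁻ ξ, ‖a k ξ‖ₑ ^ 2 * ENNReal.ofReal (lamSq k ξ) < ⊤) {F : P2 d → ℂ}
    (hF : ∀ m, F m = ∫ z, weight a z * hatProd m z ∂freqMeasure) (n : Fin d) :
    HasCoeffs (meanGrad F n) (gradCoeffs a n) := by
  have hm := fun k => (ha.1 k).1
  refine hasCoeffs_of_eq_integral (memA0_gradCoeffs ha ha2 n) hδ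
    (uniformBound_gradCoeffs hm hU hl n) fun m => ?_
  rw [(isRegular_weight hδ hm hU hM).meanGrad_eq hF]
  simp only [weight, gradCoeffs, mul_assoc]

lemma hasCoeffs_wLaplacian (hδ : 0 < δ) (ha : MemA0 a) (hU : UniformBound a C δ)
    (hM : MomentBounds a C δ) (hl : ∀ k : ℕ+, ∫⁻ ξ, ‖a k ξ‖ₑ * ENNReal.ofReal (lamSq k ξ) ≤
      ENNReal.ofReal (C * (k : ℕ)! / (k : ℝ) ^ δ))
    (ha4 : ∑' k : ℕ+, ((k : ℕ)! : ℝ≥0∞)⁻¹ *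
      ∫⁻ ξ, ‖a k ξ‖ₑ ^ 2 * ENNReal.ofReal (lamSq k ξ) ^ 2 < ⊤) {F : P2 d → ℂ}
    (hF : ∀ m, F m = ∫ z, weight a z * hatProd m z ∂freqMeasure) :
    HasCoeffs (wLaplacian F) (laplacianCoeffs a) := by
  have hm := fun k => (ha.1 k).1
  refine hasCoeffs_of_eq_integral (memA0_laplacianCoeffs ha ha4) hδ
    (uniformBound_laplacianCoeffs hl) fun m => ?_
  rw [(isRegular_weight hδ hm hU hM).wLaplacian_eq hF]
  simp only [weight, laplacianCoeffs, mul_assoc]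

end Series

/-- Integration by parts on the Fourier side: |τ|² Σₙ (Σ ξ j)ₙ² = λ_k². -/
lemma sum_innerDensity_gradCoeffs (a b : Coeffs d) (z : Freq d) :
    ∑ n, innerDensity (gradCoeffs a n) (gradCoeffs b n) z =
      -innerDensity (laplacianCoeffs a) b z := by
  have ht : tau * (starRingEnd ℂ) tau = ((4 * Real.pi ^ 2 : ℝ) : ℂ) := by
    rw [Complex.mul_conj, Complex.normSq_eq_norm_sq, norm_tau]
    congr 1; ring
  have hs : ((‖∑ j, z.2 j‖ ^ 2 : ℝ) : ℂ) = ∑ n, ((((∑ j, z.2 j) n : ℝ) : ℂ)) ^ 2 := by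
    rw [EuclideanSpace.real_norm_sq_eq]
    push_cast
    rfl
  have hn : ∀ n, innerDensity (gradCoeffs a n) (gradCoeffs b n) z =
      ((z.1 : ℕ)! : ℂ)⁻¹ * (a z.1 z.2 * (starRingEnd ℂ) (b z.1 z.2)) *
        (tau * (starRingEnd ℂ) tau) * (((∑ j, z.2 j) n : ℝ) : ℂ) ^ 2 := fun n => by
    simp only [innerDensity, gradCoeffs, map_mul, Complex.conj_ofReal]
    ring
  simp_rw [hn]
  rw [← Finset.mul_sum, ← hs, ht, innerDensity, laplacianCoeffs, lamSq]
  push_cast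
  ring

lemma neg_H0inner_eq (hd : 0 < d) {G L : P2 d → ℂ} {V W : Fin d → P2 d → ℂ} {a b : Coeffs d}
    (hG : HasCoeffs G b) (hL : HasCoeffs L (laplacianCoeffs a))
    (hV : ∀ n, HasCoeffs (V n) (gradCoeffs a n)) (hW : ∀ n, HasCoeffs (W n) (gradCoeffs b n)) :
    -H0inner L G = H0innerVec V W := by
  rw [H0innerVec, H0inner_eq hd hL hG]
  simp_rw [H0inner_eq hd (hV _) (hW _)]
  rw [← integral_finsetSum _ fun n _ => integrable_innerDensity (hV n).1 (hW n).1,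
    ← integral_neg]
  simp_rw [sum_innerDensity_gradCoeffs]

/-- Each diagonal inner product is a nonnegative real, so taking the real part and a square root in
`H0normVec` loses nothing. -/
lemma H0innerVec_self (hd : 0 < d) {V : Fin d → P2 d → ℂ} {a : Fin d → Coeffs d}
    (hV : ∀ n, HasCoeffs (V n) (a n)) : H0innerVec V V = ((H0normVec V ^ 2 : ℝ) : ℂ) := by
  have h : ∀ n, ∃ r : ℝ, 0 ≤ r ∧ H0inner (V n) (V n) = r := fun n => by
    refine ⟨∫ z : Freq d, ((z.1 : ℕ)! : ℝ)⁻¹ * ‖a n z.1 z.2‖ ^ 2 ∂freqMeasure,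
      integral_nonneg fun z => by positivity, ?_⟩
    rw [H0inner_eq hd (hV n) (hV n), ← integral_complex_ofReal]
    refine integral_congr_ae (ae_of_all _ fun z => ?_)
    simp only [innerDensity, Complex.mul_conj, Complex.normSq_eq_norm_sq]
    push_cast
    rfl
  choose r hr0 hr using h
  have e : H0innerVec V V = ((∑ n, r n : ℝ) : ℂ) := by
    rw [H0innerVec, Complex.ofReal_sum]
    exact Finset.sum_congr rfl fun n _ => hr n
  rw [H0normVec, e, Complex.ofReal_re, Real.sq_sqrt (Finset.sum_nonneg fun n _ => hr0 n)]

end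

end WassersteinFourier

theorem mainTheorem7 (d : ℕ) (hd : 0 < d) (a b : Coeffs d) (C δ : ℝ) (hδ : 0 < δ)
    (ha : MemA0 a) (hb : MemA0 b)
    (haU : UniformBound a C δ) (hbU : UniformBound b C δ)
    (haM : MomentBounds a C δ) (hbM : MomentBounds b C δ)
    (hab : ∀ k : ℕ+, ∫⁻ ξ, (‖a k ξ‖ₑ + ‖b k ξ‖ₑ) * ENNReal.ofReal (lamSq k ξ)
      ≤ ENNReal.ofReal (C * (k : ℕ)! / (k : ℝ) ^ δ))
    (ha4 : ∑' k : ℕ+, ((k : ℕ)! : ℝ≥0∞)⁻¹ *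
      ∫⁻ ξ, ‖a k ξ‖ₑ ^ 2 * ENNReal.ofReal (lamSq k ξ) ^ 2 < ⊤)
    (hb2 : ∑' k : ℕ+, ((k : ℕ)! : ℝ≥0∞)⁻¹ *
      ∫⁻ ξ, ‖b k ξ‖ₑ ^ 2 * ENNReal.ofReal (lamSq k ξ) < ⊤)
    (F G : P2 d → ℂ) (hF : F = fourierSeries a) (hG : G = fourierSeries b) :
    -- the functions are in `𝓗⁰` and the gradients and the Laplacian are defined
    (MemH0 F ∧ MemH0 G ∧ CWDifferentiable F ∧ CWDifferentiable G ∧ HasWLaplacian F) ∧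
    (∀ n, MemH0 (meanGrad F n) ∧ MemH0 (meanGrad G n)) ∧
    MemH0 (wLaplacian F) ∧
    -H0inner (wLaplacian F) G = H0innerVec (meanGrad F) (meanGrad G) ∧
    -H0inner (wLaplacian F) F = ((H0normVec (meanGrad F) ^ 2 : ℝ) : ℂ) := by
  have hal : ∀ k : ℕ+, ∫⁻ ξ, ‖a k ξ‖ₑ * ENNReal.ofReal (lamSq k ξ) ≤
      ENNReal.ofReal (C * (k : ℕ)! / (k : ℝ) ^ δ) := fun k =>
    (lintegral_mono fun ξ => mul_le_mul_left le_self_add _).trans (hab k)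
  have hbl : ∀ k : ℕ+, ∫⁻ ξ, ‖b k ξ‖ₑ * ENNReal.ofReal (lamSq k ξ) ≤
      ENNReal.ofReal (C * (k : ℕ)! / (k : ℝ) ^ δ) := fun k =>
    (lintegral_mono fun ξ => mul_le_mul_left le_add_self _).trans (hab k)
  have ma := fun k => (ha.1 k).1
  have mb := fun k => (hb.1 k).1
  have eF : ∀ m, F m = ∫ z, weight a z * hatProd m z ∂freqMeasure := fun m => by
    rw [hF, fourierSeries_eq (integrable_weight ma hδ haU)]
  have eG : ∀ m, G m = ∫ z, weight b z * hatProd m z ∂freqMeasure := fun m => by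
    rw [hG, fourierSeries_eq (integrable_weight mb hδ hbU)]
  have rF := isRegular_weight hδ ma haU haM
  have rG := isRegular_weight hδ mb hbU hbM
  have cF := hasCoeffs_of_eq_integral ha hδ haU eF
  have cG := hasCoeffs_of_eq_integral hb hδ hbU eG
  -- For a, square summability with weight λ_k² follows from the weights 1 and λ_k⁴; for b it is a
  -- hypothesis.
  have gF := hasCoeffs_meanGrad hδ ha haU haM hal (tsum_lamSq_lt_top ha ha4) eF
  have gG := hasCoeffs_meanGrad hδ hb hbU hbM hbl hb2 eG
  have lF := hasCoeffs_wLaplacian hδ ha haU haM hal ha4 eF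
  refine ⟨⟨⟨a, cF⟩, ⟨b, cG⟩, rF.cWDifferentiable eF, rG.cWDifferentiable eG, rF.hasWLaplacian eF⟩,
    fun n => ⟨⟨_, gF n⟩, ⟨_, gG n⟩⟩, ⟨_, lF⟩, neg_H0inner_eq hd cG lF gF gG, ?_⟩
  rw [← H0innerVec_self hd gF]
  exact neg_H0inner_eq hd cF lF gF gF
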